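/- Let $X$ be a complex manifold, with its bundle $T$ of holomorphic tangent vectors, and let $R$ be a $\mathbb Z$-graded Artin algebra over $\mathbb C$ (graded-commutative, finite-dimensional, local, with maximal ideal $\mathfrak M_R$) or a projective limit $R=\varprojlim R_i$ of such algebras. In the second case everything below over $R$ means compatible families over the $R_i$, and tensor products with $R$ are completed. Tensor products with $R$ carry Koszul signs. Let $\mathfrak g_{A_\infty}=\bigoplus_{p,q}\Omega^{0,q}(X,\Lambda^pT)$, with $\Omega^{0,q}(X,\Lambda^pT)$ in degree $q-p+1$, with the Dolbeault differential $\bar\partial$ and with the Schouten–Nijenhuis bracket extended by the cup product of $(0,*)$-forms. For $\gamma=\bar\beta\otimes v$ let $i_\gamma$ be the contraction with the polyvector $v$ followed by the wedge product with the $(0,q)$-form $\bar\beta$. The signs of the bracket are those for which $i_{[\gamma_1,\gamma_2]}=[[\partial,i_{\gamma_1}],i_{\gamma_2}]$ with graded commutators; in local coordinates, with $\theta_j=\partial/\partial z_j$ regarded as odd variables and $|a|$ the parity of $q-p$ plus the degree in $R$, $$[a,b]=\sum_j\Bigl(\frac{\partial a}{\partial\theta_j}\frac{\partial b}{\partial z_j}+(-1)^{|a|}\frac{\partial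 a}{\partial z_j}\frac{\partial b}{\partial\theta_j}\Bigr).$$ Let $\Omega^*(X,\mathbb C)[[\hbar^{-1},\hbar]]$ be the space of formal series, infinite in both directions, in integral powers of $\hbar$ with coefficients forms of even degree plus half-integral powers of $\hbar$ with coefficients forms of odd degree. Let $l_\hbar$ be the rescaling operator $\varphi^{p,q}\mapsto\hbar^{(q-p)/2}\varphi^{p,q}$ for $\varphi^{p,q}\in\Omega^{p,q}$. Let $\gamma\in(\mathfrak g_{A_\infty}\otimes\mathfrak M_R)^1$ be a solution of the Maurer–Cartan equation $\bar\partial\gamma+\frac12[\gamma,\gamma]=0$, and let $\widetilde L_\gamma$ be the space of the elements $$l_\hbar\exp\bigl(\tfrac1\hbar i_\gamma\bigr)(\varphi_0+\varphi_1\hbar+\varphi_2\hbar^2+\dots),\qquad\varphi_k\in\Omega^*(X,\mathbb C)\otimes R .$$ Then $\bigl(\Omega^*(X,\mathbb C)[[\hbar^{-1},\hbar]]\otimes R,\ \hbar^{1/2}(\bar\partial+\partial)\bigr)$ is a complex and $\widetilde L_\gamma$ is a sub-complex of it: $\widetilde L_\gamma$ is contained in $\Omega^*(X,\mathbb C)[[\hbar^{-1},\hbar]]\otimes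 R$ and is mapped to itself by $\hbar^{1/2}(\bar\partial+\partial)$. Moreover, on series in powers of $\hbar^{1/2}$ with coefficients in $\Omega^*(X,\mathbb C)\otimes R$, $$\exp\bigl(-\tfrac1\hbar i_\gamma\bigr)(\bar\partial+\hbar\partial)\exp\bigl(\tfrac1\hbar i_\gamma\bigr)=\bar\partial+[\partial,i_\gamma]+\hbar\partial .$$ -/

import Mathlib

open scoped TensorProduct Manifold ContDiff ComplexConjugate

noncomputable section

namespace SemiInfHodge

/-! ### Linear algebra of one tangent space

`V` is the holomorphic tangent space, `V →ₗ⋆[ℂ] ℂ` the space of `(0,1)`-covectors. -/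

section Fibre

variable (V : Type*) [AddCommGroup V] [Module ℂ V]

/-- `(0,1)`-covectors: conjugate-linear functionals. -/
abbrev ConjDual := V →ₗ⋆[ℂ] ℂ

/-- Exterior forms with complex values: `Λ(T^* ⊕ \bar T^*) = ⨁ Λ^{p,q}`. -/
abbrev FormAlg := ExteriorAlgebra ℂ (Module.Dual ℂ V × ConjDual V)

/-- Polyvectors with coefficients in `(0,*)`-forms: `Λ(\bar T^* ⊕ T) = ⨁ Λ^q \bar T^* ⊗ Λ^p T`. -/
abbrev PolyAlg := ExteriorAlgebra ℂ (ConjDual V × V)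

variable {V}

/-- The conjugate `\bar α` of a `(1,0)`-covector `α`. -/
def conjCovector (α : Module.Dual ℂ V) : ConjDual V where
  toFun v := conj (α v)
  map_add' v w := by simp
  map_smul' c v := by simp

/-- Precomposition of `(0,1)`-covectors with a complex linear map. -/
def conjPull {W : Type*} [AddCommGroup W] [Module ℂ W] (A : V →ₗ[ℂ] W) :
    ConjDual W →ₗ[ℂ] ConjDual V where
  toFun β := β.comp A
  map_add' _ _ := rfl
  map_smul' _ _ := rfl

/-- A `(1,0)`-covector as a form. -/
def covForm : Module.Dual ℂ V →ₗ[ℂ] FormAlg V :=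
  (ExteriorAlgebra.ι ℂ).comp (LinearMap.inl ℂ _ _)

/-- A `(0,1)`-covector as a form. -/
def conjForm : ConjDual V →ₗ[ℂ] FormAlg V :=
  (ExteriorAlgebra.ι ℂ).comp (LinearMap.inr ℂ _ _)

/-- A `(0,1)`-covector as an element of `Λ(\bar T^* ⊕ T)`. -/
def conjPoly : ConjDual V →ₗ[ℂ] PolyAlg V :=
  (ExteriorAlgebra.ι ℂ).comp (LinearMap.inl ℂ _ _)

/-- A tangent vector as an element of `Λ(\bar T^* ⊕ T)`. -/
def vecPoly : V →ₗ[ℂ] PolyAlg V :=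
  (ExteriorAlgebra.ι ℂ).comp (LinearMap.inr ℂ _ _)

/-- Pull-back of forms along a complex linear map. -/
def formPull {W : Type*} [AddCommGroup W] [Module ℂ W] (A : V →ₗ[ℂ] W) :
    FormAlg W →ₗ[ℂ] FormAlg V :=
  (ExteriorAlgebra.map (A.dualMap.prodMap (conjPull A))).toLinearMap

/-- Transport of polyvectors with `(0,*)`-form coefficients along an isomorphism `A` with
inverse `B`: covectors are pulled back by `A`, vectors are pushed by `B`. -/
def polyPull {W : Type*} [AddCommGroup W] [Module ℂ W] (A : V →ₗ[ℂ] W) (B : W →ₗ[ℂ] V) :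
    PolyAlg W →ₗ[ℂ] PolyAlg V :=
  (ExteriorAlgebra.map ((conjPull A).prodMap B)).toLinearMap

/-- Contraction of forms with a holomorphic tangent vector `v`: the odd derivation with
`α ↦ α v` on `(1,0)`-covectors and `0` on `(0,1)`-covectors. -/
def contractVec : V →ₗ[ℂ] Module.End ℂ (FormAlg V) :=
  (CliffordAlgebra.contractLeft (Q := (0 : QuadraticForm ℂ (Module.Dual ℂ V × ConjDual V)))).comp
    ((LinearMap.fst ℂ (Module.Dual ℂ V) (ConjDual V)).dualMap.comp (Module.Dual.eval ℂ V))

/-- The generators `(β, v)` of `Λ(\bar T^* ⊕ T)` acting on forms by `β ∧ · + ι_v`. -/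
def contractGen : (ConjDual V × V) →ₗ[ℂ] Module.End ℂ (FormAlg V) :=
  ((Algebra.lmul ℂ (FormAlg V)).toLinearMap.comp conjForm).coprod contractVec

theorem contractGen_sq (a : ConjDual V × V) : contractGen a * contractGen a = 0 := by
  refine LinearMap.ext fun x => ?_
  have h1 : conjForm a.1 * conjForm a.1 = 0 := ExteriorAlgebra.ι_sq_zero _
  have h2 : ∀ y, contractVec a.2 (contractVec a.2 y) = 0 := fun y =>
    CliffordAlgebra.contractLeft_contractLeft _ y
  have h3 : ∀ y, contractVec a.2 (conjForm a.1 * y) = -(conjForm a.1 * contractVec a.2 y) := by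
    intro y
    refine (CliffordAlgebra.contractLeft_ι_mul
      (Q := (0 : QuadraticForm ℂ (Module.Dual ℂ V × ConjDual V))) _ (0, a.1) y).trans ?_
    simp [contractVec, conjForm, ExteriorAlgebra.ι]
  simp [contractGen, mul_add, ← mul_assoc, h1, h2, h3]

/-- The contraction `i : Λ(\bar T^* ⊕ T) → End(Λ(T^* ⊕ \bar T^*))`,
`i_{β₁ ⋯ β_q v₁ ⋯ v_p} φ = β₁ ∧ ⋯ ∧ β_q ∧ ι_{v₁} ⋯ ι_{v_p} φ`. -/
def contraction : PolyAlg V →ₐ[ℂ] Module.End ℂ (FormAlg V) :=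
  ExteriorAlgebra.lift ℂ ⟨contractGen, contractGen_sq⟩

/-- The left derivative `∂/∂θ` of `Λ(\bar T^* ⊕ T)` dual to vectors, in the direction of the
`(1,0)`-covector `α`: the odd derivation with `v ↦ α v` and `β ↦ 0`. -/
def thetaDeriv (α : Module.Dual ℂ V) : PolyAlg V →ₗ[ℂ] PolyAlg V :=
  CliffordAlgebra.contractLeft (Q := (0 : QuadraticForm ℂ (ConjDual V × V)))
    (α.comp (LinearMap.snd ℂ _ _))

variable (V) in
/-- The summand `Λ^q \bar T^* ⊗ Λ^p T` of `Λ(\bar T^* ⊕ T)`. -/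
def polyBidegree (q p : ℕ) : Submodule ℂ (PolyAlg V) :=
  LinearMap.range (conjPoly (V := V)) ^ q * LinearMap.range (vecPoly (V := V)) ^ p

/-- The rescaling on generators, `T` standing for `ħ^{1/2}`: `α ↦ α T⁻¹` for `(1,0)`-covectors
and `β ↦ β T` for `(0,1)`-covectors. -/
def rescaleGen :
    (Module.Dual ℂ V × ConjDual V) →ₗ[ℂ] AddMonoidAlgebra (FormAlg V) ℤ :=
  ((AddMonoidAlgebra.lsingle (-1)).comp covForm).coprod
    ((AddMonoidAlgebra.lsingle 1).comp conjForm)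

theorem rescaleGen_sq (a : Module.Dual ℂ V × ConjDual V) : rescaleGen a * rescaleGen a = 0 := by
  have h1 : covForm a.1 * covForm a.1 = 0 := ExteriorAlgebra.ι_sq_zero _
  have h2 : conjForm a.2 * conjForm a.2 = 0 := ExteriorAlgebra.ι_sq_zero _
  have h3 : covForm a.1 * conjForm a.2 + conjForm a.2 * covForm a.1 = 0 :=
    ExteriorAlgebra.ι_add_mul_swap _ _
  have h : rescaleGen a = AddMonoidAlgebra.single (-1) (covForm a.1) +
      AddMonoidAlgebra.single 1 (conjForm a.2) := rfl
  rw [h, mul_add, add_mul, add_mul]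
  simp only [AddMonoidAlgebra.single_mul_single, h1, h2, AddMonoidAlgebra.single_zero,
    zero_add, add_zero, neg_add_cancel, add_neg_cancel]
  rw [← AddMonoidAlgebra.single_add, add_comm, h3, AddMonoidAlgebra.single_zero]

/-- The multiplicative rescaling `φ^{p,q} ↦ φ^{p,q} T^{q-p}`. -/
def rescaleAlg : FormAlg V →ₐ[ℂ] AddMonoidAlgebra (FormAlg V) ℤ :=
  ExteriorAlgebra.lift ℂ ⟨rescaleGen, rescaleGen_sq⟩

/-- The projection of `Λ(T^* ⊕ \bar T^*)` onto `⨁_{q-p=w} Λ^{p,q}`: the coefficient of `T^w` in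
the rescaled form. -/
def weightPart (w : ℤ) : FormAlg V →ₗ[ℂ] FormAlg V where
  toFun a := (rescaleAlg a).coeff w
  map_add' a b := by simp
  map_smul' c a := by simp

end Fibre

/-! ### Graded Artin algebras and coefficients -/

section Coefficients

variable {R : Type*} [Ring R] [Algebra ℂ R]

/-- A `ℤ`-graded Artin algebra over `ℂ`: graded-commutative, finite-dimensional and local. -/
class IsGradedArtin (𝒜 : ℤ → Submodule ℂ R) [GradedAlgebra 𝒜] : Prop where
  graded_comm : ∀ i j : ℤ, ∀ a ∈ 𝒜 i, ∀ b ∈ 𝒜 j, a * b = (((i * j).negOnePow : ℤ) : ℂ) • (b * a)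
  finite : FiniteDimensional ℂ R
  isLocal : IsLocalRing R

variable (𝒜 : ℤ → Submodule ℂ R) [GradedAlgebra 𝒜]

/-- The parity involution `r ↦ (-1)^{|r|} r`. -/
def parityInv : R →ₗ[ℂ] R :=
  (DirectSum.toModule ℂ ℤ R fun i => (((i.negOnePow : ℤˣ) : ℤ) : ℂ) • (𝒜 i).subtype).comp
    (DirectSum.decomposeLinearEquiv 𝒜).toLinearMap

/-- The even part of an element of `R`. -/
def evenPart : R →ₗ[ℂ] R := (1 / 2 : ℂ) • (LinearMap.id + parityInv 𝒜)

/-- The odd part of an element of `R`. -/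
def oddPart : R →ₗ[ℂ] R := (1 / 2 : ℂ) • (LinearMap.id - parityInv 𝒜)

/-- Extension of an action `ρ` of `P` on a `ℤ/2`-graded space `M` (with parity involution `s`) to
an action of `P ⊗ R` on `M ⊗ R` by the Koszul rule
`(a ⊗ r) · (m ⊗ t) = (-1)^{|r||m|} ρ(a) m ⊗ r t`. -/
def superAct {P M : Type*} [AddCommGroup P] [Module ℂ P] [AddCommGroup M] [Module ℂ M]
    (s : M →ₗ[ℂ] M) (ρ : P →ₗ[ℂ] Module.End ℂ M) : P ⊗[ℂ] R →ₗ[ℂ] Module.End ℂ (M ⊗[ℂ] R) :=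
  (TensorProduct.homTensorHomMap (RingHom.id ℂ) M R M R).comp
      (TensorProduct.map ρ ((Algebra.lmul ℂ R).toLinearMap.comp (evenPart 𝒜))) +
    (TensorProduct.homTensorHomMap (RingHom.id ℂ) M R M R).comp
      (TensorProduct.map ((LinearMap.lcomp ℂ M s).comp ρ)
        ((Algebra.lmul ℂ R).toLinearMap.comp (oddPart 𝒜)))

section Fibre

variable {V : Type*} [AddCommGroup V] [Module ℂ V]

/-- The contraction `i_γ` on forms with coefficients in `R`. `CliffordAlgebra.involute` is
`(-1)^k` on `Λ^k`. -/
def contractR : PolyAlg V ⊗[ℂ] R →ₗ[ℂ] Module.End ℂ (FormAlg V ⊗[ℂ] R) :=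
  superAct 𝒜 CliffordAlgebra.involute.toLinearMap contraction.toLinearMap

/-- The product of polyvectors with coefficients in `R`:
`(a ⊗ r)(b ⊗ t) = (-1)^{|r||b|} ab ⊗ rt`. -/
def polyMul : PolyAlg V ⊗[ℂ] R →ₗ[ℂ] Module.End ℂ (PolyAlg V ⊗[ℂ] R) :=
  superAct 𝒜 CliffordAlgebra.involute.toLinearMap (Algebra.lmul ℂ (PolyAlg V)).toLinearMap

/-- The total parity involution on polyvectors with coefficients in `R`. -/
def polyParity : PolyAlg V ⊗[ℂ] R →ₗ[ℂ] PolyAlg V ⊗[ℂ] R :=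
  TensorProduct.map CliffordAlgebra.involute.toLinearMap (parityInv 𝒜)

variable (V) in
/-- The elements of `Λ(\bar T^* ⊕ T) ⊗ 𝔐_R` of total degree zero, where `Λ^q \bar T^* ⊗ Λ^p T` has
degree `q - p`. The maximal ideal `𝔐_R` of the local ring `R` consists of the non-units. -/
def degreeZeroPart : Submodule ℂ (PolyAlg V ⊗[ℂ] R) :=
  Submodule.span ℂ {t | ∃ q p : ℕ, ∃ a ∈ polyBidegree V q p, ∃ r ∈ 𝒜 ((p : ℤ) - q),
    r ∈ nonunits R ∧ t = a ⊗ₜ[ℂ] r}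

end Fibre

end Coefficients

/-! ### Calculus in a coordinate domain -/

section Local

variable {E : Type*} [NormedAddCommGroup E] [NormedSpace ℂ E]

/-- Smoothness of a map into a finite-dimensional complex vector space (which carries no chosen
norm): all linear functionals of it are smooth. -/
def SmoothOn {F : Type*} [AddCommGroup F] [Module ℂ F] (f : E → F) (s : Set E) : Prop :=
  ∀ l : Module.Dual ℂ F, ContDiffOn ℝ ∞ (fun y => l (f y)) s

/-- The derivative at `y` in the real direction `v` of a map into a finite-dimensional complex
vector space, computed in the coordinates of a basis. -/
def dirDeriv {F : Type*} [AddCommGroup F] [Module ℂ F] (f : E → F) (y v : E) : F :=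
  ∑ᶠ k, fderiv ℝ (fun z => (Module.Basis.ofVectorSpace ℂ F).repr (f z) k) y v •
    Module.Basis.ofVectorSpace ℂ F k

/-- The Wirtinger derivative `∂_v = (D_v - i D_{iv}) / 2`. -/
def wirt {F : Type*} [AddCommGroup F] [Module ℂ F] (f : E → F) (y v : E) : F :=
  (1 / 2 : ℂ) • (dirDeriv f y v - Complex.I • dirDeriv f y (Complex.I • v))

/-- The Wirtinger derivative `\bar∂_v = (D_v + i D_{iv}) / 2`. -/
def wirtBar {F : Type*} [AddCommGroup F] [Module ℂ F] (f : E → F) (y v : E) : F :=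
  (1 / 2 : ℂ) • (dirDeriv f y v + Complex.I • dirDeriv f y (Complex.I • v))

variable [FiniteDimensional ℂ E]

variable (E) in
/-- The linear coordinate `z_j` on `E`. -/
def coordinate (j : Fin (Module.finrank ℂ E)) : Module.Dual ℂ E := (Module.finBasis ℂ E).coord j

variable {R : Type*} [Ring R] [Algebra ℂ R]

/-- `∂ω = ∑ dz_j ∧ ∂ω/∂z_j`. -/
def delLoc (f : E → FormAlg E ⊗[ℂ] R) (y : E) : FormAlg E ⊗[ℂ] R :=
  ∑ j, (LinearMap.mulLeft ℂ (covForm (coordinate E j))).rTensor R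
    (wirt f y (Module.finBasis ℂ E j))

/-- `\bar∂ω = ∑ d\bar z_j ∧ ∂ω/∂\bar z_j` on forms. -/
def delbarLoc (f : E → FormAlg E ⊗[ℂ] R) (y : E) : FormAlg E ⊗[ℂ] R :=
  ∑ j, (LinearMap.mulLeft ℂ (conjForm (conjCovector (coordinate E j)))).rTensor R
    (wirtBar f y (Module.finBasis ℂ E j))

/-- The Dolbeault differential `\bar∂γ = ∑ d\bar z_j ∧ ∂γ/∂\bar z_j` on polyvectors with
coefficients in `(0,*)`-forms. -/
def polyDelbarLoc (f : E → PolyAlg E ⊗[ℂ] R) (y : E) : PolyAlg E ⊗[ℂ] R :=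
  ∑ j, (LinearMap.mulLeft ℂ (conjPoly (conjCovector (coordinate E j)))).rTensor R
    (wirtBar f y (Module.finBasis ℂ E j))

/-- The Schouten–Nijenhuis bracket, extended to coefficients in `(0,*)`-forms and in `R`:
`[a, b] = ∑ ∂a/∂θ_j · ∂b/∂z_j + (-1)^{|a|} ∂a/∂z_j · ∂b/∂θ_j`, where `θ_j` is the vector
`∂/∂z_j` viewed as an odd variable.
This is the Lie bracket on vector fields, and `[v, f] = v(f)` for a function `f`. The signs are those
of the convention `[a, b] = (-1)^{|a||b|} [b, a]`, for which
`i_{[a,b]} = [[∂, i_a], i_b]` with graded commutators. -/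
def schoutenLoc (𝒜 : ℤ → Submodule ℂ R) [GradedAlgebra 𝒜] (a b : E → PolyAlg E ⊗[ℂ] R) (y : E) :
    PolyAlg E ⊗[ℂ] R :=
  ∑ j, (polyMul 𝒜 ((thetaDeriv (coordinate E j)).rTensor R (a y))
      (wirt b y (Module.finBasis ℂ E j)) +
    polyMul 𝒜 (polyParity 𝒜 (wirt a y (Module.finBasis ℂ E j)))
      ((thetaDeriv (coordinate E j)).rTensor R (b y)))

end Local

/-! ### Forms and polyvector fields on a complex manifold -/

section Manifold

variable (E : Type*) [NormedAddCommGroup E] [NormedSpace ℂ E]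
variable (X : Type*) [TopologicalSpace X] [ChartedSpace E X]
variable (R : Type*) [Ring R] [Algebra ℂ R]

/-- Sections (not necessarily continuous) of `Λ(T^* ⊕ \bar T^*) ⊗ R` over `X`. -/
abbrev FormSec := ∀ x : X, FormAlg (TangentSpace 𝓘(ℂ, E) x) ⊗[ℂ] R

/-- Sections (not necessarily continuous) of `Λ(\bar T^* ⊕ T) ⊗ R` over `X`. -/
abbrev PolySec := ∀ x : X, PolyAlg (TangentSpace 𝓘(ℂ, E) x) ⊗[ℂ] R

variable {E X R}

/-- The differential at `x` of the chart `e`. -/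
def dChart (e : OpenPartialHomeomorph X E) (x : X) : TangentSpace 𝓘(ℂ, E) x →ₗ[ℂ] E :=
  (NormedSpace.fromTangentSpace (𝕜 := ℂ) (e x)).toLinearEquiv.toLinearMap.comp
    (mfderiv 𝓘(ℂ, E) 𝓘(ℂ, E) e x).toLinearMap

/-- The differential at `y` of the inverse of the chart `e`. -/
def dChartSymm (e : OpenPartialHomeomorph X E) (y : E) :
    E →ₗ[ℂ] TangentSpace 𝓘(ℂ, E) (e.symm y) :=
  (mfderiv 𝓘(ℂ, E) 𝓘(ℂ, E) e.symm y).toLinearMap.comp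
    (NormedSpace.fromTangentSpace (𝕜 := ℂ) y).symm.toLinearEquiv.toLinearMap

/-- The expression of a form in the chart `e` (meaningful on `e.target`). -/
def FormSec.inChart (e : OpenPartialHomeomorph X E) (φ : FormSec E X R) (y : E) :
    FormAlg E ⊗[ℂ] R :=
  (formPull (dChartSymm e y)).rTensor R (φ (e.symm y))

/-- The expression of a polyvector field in the chart `e` (meaningful on `e.target`). -/
def PolySec.inChart (e : OpenPartialHomeomorph X E) (γ : PolySec E X R) (y : E) :
    PolyAlg E ⊗[ℂ] R :=
  (polyPull (dChartSymm e y) (dChart e (e.symm y))).rTensor R (γ (e.symm y))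

/-- Smooth forms with values in `R`, that is, elements of `Ω^*(X, ℂ) ⊗ R`. -/
def FormSec.IsSmooth (φ : FormSec E X R) : Prop :=
  ∀ e ∈ atlas E X, SmoothOn (φ.inChart e) e.target

/-- Smooth sections of `Λ(\bar T^* ⊕ T) ⊗ R`, that is, elements of `Ω^{0,*}(X, Λ^* T) ⊗ R`. -/
def PolySec.IsSmooth (γ : PolySec E X R) : Prop :=
  ∀ e ∈ atlas E X, SmoothOn (γ.inChart e) e.target

variable [FiniteDimensional ℂ E]

/-- The operator `∂` on forms, computed at `x` in the preferred chart at `x`. -/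
def del (φ : FormSec E X R) : FormSec E X R := fun x =>
  (formPull (dChart (chartAt E x) x)).rTensor R
    (delLoc (φ.inChart (chartAt E x)) (chartAt E x x))

/-- The operator `\bar∂` on forms, computed at `x` in the preferred chart at `x`. -/
def delbar (φ : FormSec E X R) : FormSec E X R := fun x =>
  (formPull (dChart (chartAt E x) x)).rTensor R
    (delbarLoc (φ.inChart (chartAt E x)) (chartAt E x x))

/-- The Maurer–Cartan equation `\bar∂γ + [γ, γ] / 2 = 0`, written in the charts of `X`. -/
def MaurerCartanEq (𝒜 : ℤ → Submodule ℂ R) [GradedAlgebra 𝒜] (γ : PolySec E X R) : Prop :=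
  ∀ e ∈ atlas E X, ∀ y ∈ e.target,
    polyDelbarLoc (γ.inChart e) y +
      (1 / 2 : ℂ) • schoutenLoc 𝒜 (γ.inChart e) (γ.inChart e) y = 0

/-- The set `MC(R)`: smooth `γ ∈ (𝔤[1] ⊗ 𝔐_R)^0` that satisfy the Maurer–Cartan equation. -/
structure IsMaurerCartan (𝒜 : ℤ → Submodule ℂ R) [GradedAlgebra 𝒜] (γ : PolySec E X R) :
    Prop where
  smooth : γ.IsSmooth
  degree : ∀ x, γ x ∈ degreeZeroPart 𝒜 (TangentSpace 𝓘(ℂ, E) x)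
  equation : MaurerCartanEq 𝒜 γ

/-! ### Series in powers of `ħ^{1/2}` -/

variable (E X R) in
/-- Formal series `∑_{m ∈ ℤ} ξ_m ħ^{m/2}`, infinite in both directions, whose coefficients are
sections of `Λ(T^* ⊕ \bar T^*) ⊗ R`. -/
abbrev Series := ℤ → FormSec E X R

/-- `ħ^{1/2} (\bar∂ + ∂)`. -/
def totalD (ξ : Series E X R) : Series E X R := fun m => delbar (ξ (m - 1)) + del (ξ (m - 1))

/-- `\bar∂ + ħ ∂`. -/
def hbarD (ξ : Series E X R) : Series E X R := fun m => delbar (ξ m) + del (ξ (m - 2))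

/-- The contraction `i_γ` on forms. -/
def contractSec (𝒜 : ℤ → Submodule ℂ R) [GradedAlgebra 𝒜] (γ : PolySec E X R)
    (φ : FormSec E X R) : FormSec E X R := fun x => contractR 𝒜 (γ x) (φ x)

/-- `\bar∂ + [∂, i_γ] + ħ ∂`, for `i_γ` of even degree. -/
def twistedD (𝒜 : ℤ → Submodule ℂ R) [GradedAlgebra 𝒜] (γ : PolySec E X R)
    (ξ : Series E X R) : Series E X R := fun m =>
  delbar (ξ m) + (del (contractSec 𝒜 γ (ξ m)) - contractSec 𝒜 γ (del (ξ m))) + del (ξ (m - 2))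

/-- `exp(i_γ / ħ) = ∑_k ħ^{-k} i_γ^k / k!`, for nilpotent `i_γ`. -/
def expContract (𝒜 : ℤ → Submodule ℂ R) [GradedAlgebra 𝒜] (γ : PolySec E X R) :
    Series E X R →ₗ[ℂ] Series E X R where
  toFun ξ := fun m x => ∑ k ∈ Finset.range (nilpotencyClass (contractR 𝒜 (γ x))),
    ((k.factorial : ℂ)⁻¹) • (contractR 𝒜 (γ x) ^ k) (ξ (m + 2 * k) x)
  map_add' ξ η := by
    funext m x
    simp [Finset.sum_add_distrib]
  map_smul' c ξ := by
    funext m x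
    simp [Finset.smul_sum, smul_comm c]

variable (E X R) in
/-- The rescaling `l_ħ : φ^{p,q} ↦ ħ^{(q-p)/2} φ^{p,q}`, with `|q - p| ≤ dim X`. -/
def rescale : Series E X R →ₗ[ℂ] Series E X R where
  toFun ξ := fun m x => ∑ w ∈ Finset.Icc (-(Module.finrank ℂ E : ℤ)) (Module.finrank ℂ E),
    (weightPart w).rTensor R (ξ (m - w) x)
  map_add' ξ η := by
    funext m x
    simp [Finset.sum_add_distrib]
  map_smul' c ξ := by
    funext m x
    simp [Finset.smul_sum]

end Manifold

/-! ### Inverse systems of graded Artin algebras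

The forms over the pro-Artin algebra `lim R_i` are the compatible families of forms over the
`R_i`; one Artin algebra is the case of a one-point index set. -/

section ProArtin

variable {E : Type*} [NormedAddCommGroup E] [NormedSpace ℂ E]
variable {X : Type*} [TopologicalSpace X] [ChartedSpace E X]
variable {ι : Type*} [Preorder ι] {R : ι → Type*} [∀ i, Ring (R i)] [∀ i, Algebra ℂ (R i)]

variable (E X R) in
/-- Families of series of forms over the `R_i`. -/
abbrev ProSeries := ∀ i, Series E X (R i)

/-- Compatible families of polyvector fields. -/
def PolyCompatible (f : ∀ i j, i ≤ j → R j →ₐ[ℂ] R i) (γ : ∀ i, PolySec E X (R i)) : Prop :=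
  ∀ i j (h : i ≤ j) x, (f i j h).toLinearMap.lTensor _ (γ j x) = γ i x

theorem SmoothOn.add {F : Type*} [AddCommGroup F] [Module ℂ F] {f g : E → F} {s : Set E}
    (hf : SmoothOn f s) (hg : SmoothOn g s) : SmoothOn (fun y => f y + g y) s := fun l => by
  simpa using (hf l).add (hg l)

theorem SmoothOn.smul {F : Type*} [AddCommGroup F] [Module ℂ F] {f : E → F} {s : Set E} (c : ℂ)
    (hf : SmoothOn f s) : SmoothOn (fun y => c • f y) s := fun l => by
  simpa using contDiffOn_const.mul (hf l)

variable (E X) in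
/-- All series `∑_m ξ_m ħ^{m/2}` with coefficients in `Ω^*(X, ℂ) ⊗ R`, `R = lim R_i`. -/
def smoothSeries (f : ∀ i j, i ≤ j → R j →ₐ[ℂ] R i) : Submodule ℂ (ProSeries E X R) where
  carrier := {ξ | (∀ i m, (ξ i m).IsSmooth) ∧
    ∀ i j (h : i ≤ j) m x, (f i j h).toLinearMap.lTensor _ (ξ j m x) = ξ i m x}
  zero_mem' := by
    refine ⟨fun i m e _ l => ?_, fun i j h m x => by simp⟩
    have : (fun y => l (FormSec.inChart e (((0 : ProSeries E X R) i) m) y)) = fun _ => 0 := by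
      funext y; simp [FormSec.inChart]
    rw [this]; exact contDiffOn_const
  add_mem' := by
    rintro ξ η ⟨h1, h2⟩ ⟨h3, h4⟩
    refine ⟨fun i m e he => ?_, fun i j h m x => by simp [h2 i j h m x, h4 i j h m x]⟩
    have : FormSec.inChart e ((ξ + η) i m) =
        fun y => FormSec.inChart e (ξ i m) y + FormSec.inChart e (η i m) y := by
      funext y; simp [FormSec.inChart]
    rw [this]; exact (h1 i m e he).add (h3 i m e he)
  smul_mem' := by
    rintro c ξ ⟨h1, h2⟩
    refine ⟨fun i m e he => ?_, fun i j h m x => by simp [h2 i j h m x]⟩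
    have : FormSec.inChart e ((c • ξ) i m) = fun y => c • FormSec.inChart e (ξ i m) y := by
      funext y; simp [FormSec.inChart]
    rw [this]; exact (h1 i m e he).smul c

variable (E X) in
/-- The space `Ω^*(X, ℂ)[[ħ^{-1}, ħ]] ⊗ R`: the coefficient of `ħ^{m/2}` is a form of even degree
for even `m` and of odd degree for odd `m`. -/
def omegaHbar (f : ∀ i j, i ≤ j → R j →ₐ[ℂ] R i) : Submodule ℂ (ProSeries E X R) :=
  smoothSeries E X f ⊓
  { carrier := {ξ | ∀ i m x, (CliffordAlgebra.involute.toLinearMap.rTensor (R i)) (ξ i m x) =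
      ((m.negOnePow : ℤ) : ℂ) • ξ i m x}
    zero_mem' := fun i m x => by simp
    add_mem' := fun {ξ η} h1 h2 i m x => by simp [h1 i m x, h2 i m x]
    smul_mem' := fun c ξ h i m x => by simp [h i m x, smul_comm c] }

variable (E X) in
/-- The series `φ_0 + φ_1 ħ + φ_2 ħ² + ⋯` with `φ_k ∈ Ω^*(X, ℂ) ⊗ R`. -/
def powerSeries (f : ∀ i j, i ≤ j → R j →ₐ[ℂ] R i) : Submodule ℂ (ProSeries E X R) :=
  smoothSeries E X f ⊓
  { carrier := {ξ | ∀ i m, (m < 0 ∨ Odd m) → ξ i m = 0}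
    zero_mem' := fun i m _ => rfl
    add_mem' := fun {ξ η} h1 h2 i m hm => by simp [h1 i m hm, h2 i m hm]
    smul_mem' := fun c ξ h i m hm => by simp [h i m hm] }

variable [FiniteDimensional ℂ E]

/-- The subspace `L̃_γ` of the elements `l_ħ exp(i_γ / ħ)(φ_0 + φ_1 ħ + φ_2 ħ² + ⋯)`. -/
def Ltilde (𝒜 : ∀ i, ℤ → Submodule ℂ (R i)) [∀ i, GradedAlgebra (𝒜 i)]
    (f : ∀ i j, i ≤ j → R j →ₐ[ℂ] R i) (γ : ∀ i, PolySec E X (R i)) :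
    Submodule ℂ (ProSeries E X R) :=
  (powerSeries E X f).map (LinearMap.pi fun i =>
    ((rescale E X (R i)).comp (expContract (𝒜 i) (γ i))).comp (LinearMap.proj i))

/-- `D` restricts to a linear differential on the subspace `Ω`. -/
structure IsDifferentialOn {S : Type*} [AddCommGroup S] [Module ℂ S] (Ω : Submodule ℂ S)
    (D : S → S) : Prop where
  map_mem : ∀ ξ ∈ Ω, D ξ ∈ Ω
  map_add : ∀ ξ ∈ Ω, ∀ η ∈ Ω, D (ξ + η) = D ξ + D η
  map_smul : ∀ c : ℂ, ∀ ξ ∈ Ω, D (c • ξ) = c • D ξ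
  sq_zero : ∀ ξ ∈ Ω, D (D ξ) = 0

end ProArtin

end SemiInfHodge
end

open SemiInfHodge

noncomputable section

namespace SemiInfHodge

/-! ### Exterior algebras -/

section Exterior

variable {M : Type*} [AddCommGroup M] [Module ℂ M]

/-! Put `D = \bar∂ + ħ∂` and `A = i_γ / ħ`. Because `γ` has even total degree, `i_γ` commutes with
every contraction, so the expansion `e^{-A} D e^A = D + [D, A] + [[D, A], A] / 2 + ⋯` is short. The
commutator `[\bar∂, i_γ] = i_{\bar∂γ}` is a contraction and therefore commutes with `i_γ`. The
double commutator `[[∂, i_γ], i_γ] = i_{[γ, γ]}` is a contraction too, and nothing survives beyond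
second order. The terms in `ħ^{-1}` add up to `i_{\bar∂γ + [γ, γ]/2}`, which vanishes by the
Maurer–Cartan equation, and `\bar∂ + [∂, i_γ] + ħ∂` remains.

This conjugated operator involves no negative power of `ħ`, so it preserves the series `φ_0 + φ_1 ħ
+ ⋯`. Since `\bar∂` raises `q - p` by one and `∂` lowers it by one, `l_ħ` carries `\bar∂ + ħ∂` to
`ħ^{1/2}(\bar∂ + ∂)`. Together these give the stability of `L̃_γ`. The inclusion of `L̃_γ` in the
big complex holds because `q - p` and `p + q` have the same parity.

Four things carry the argument. The exponential is a finite sum, with one bound for all points: the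
coefficients of `γ` lie in the nilpotent Jacobson radical of `R` (`exists_contractR_pow_eq_zero`).
The operators `∂` and `\bar∂`, defined by preferred charts, have the same formula in every chart
(`formOp_inChart`), since pull-backs of constant forms by holomorphic maps are closed. In a chart,
the commutators come from the fibrewise identity `[dz_j ∧, i_a] = i_{∂a/∂θ_j}`
(`covForm_mul_contraction`), the supercommutativity of polyvectors (`polyMul_comm`) and the Leibniz
rule. Finally, `mul_truncExp` is the conjugation formula in an abstract algebra; it is applied to
endomorphisms of the space of series of smooth forms. -/

theorem exteriorPower_eq_bot [FiniteDimensional ℂ M] {k : ℕ} (hk : Module.finrank ℂ M < k) :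
    (⋀[ℂ]^k M) = ⊥ := by
  rw [← Submodule.finrank_eq_zero, exteriorPower.finrank_eq, Nat.choose_eq_zero_of_lt hk]

/-- Only the powers up to `dim M` are nonzero. Finiteness is what lets derivatives of algebra-valued
maps be computed in coordinates. -/
instance exteriorAlgebra_finite [FiniteDimensional ℂ M] :
    Module.Finite ℂ (ExteriorAlgebra ℂ M) := by
  have h : (⨆ k : ℕ, ⋀[ℂ]^k M) = ⊤ :=
    (DirectSum.Decomposition.isInternal (fun k : ℕ => ⋀[ℂ]^k M)).submodule_iSup_eq_top
  have h' : (⨆ k ∈ Finset.range (Module.finrank ℂ M + 1), ⋀[ℂ]^k M) = ⊤ := by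
    rw [eq_top_iff, ← h]
    refine iSup_le fun k => ?_
    by_cases hk : k < Module.finrank ℂ M + 1
    · exact le_iSup₂_of_le k (Finset.mem_range.2 hk) le_rfl
    · rw [exteriorPower_eq_bot (by omega)]
      exact bot_le
  refine ⟨?_⟩
  rw [← h']
  exact Submodule.fg_biSup _ _ fun k _ => Module.Finite.iff_fg.1 inferInstance

theorem exterior_left_induction {P : ExteriorAlgebra ℂ M → Prop}
    (algebraMap : ∀ r : ℂ, P (algebraMap _ _ r)) (add : ∀ x y, P x → P y → P (x + y))
    (ι_mul : ∀ x m, P x → P (ExteriorAlgebra.ι ℂ m * x)) (x : ExteriorAlgebra ℂ M) : P x :=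
  CliffordAlgebra.left_induction (Q := (0 : QuadraticForm ℂ M)) algebraMap add ι_mul x

theorem involute_ι' (m : M) :
    CliffordAlgebra.involute (ExteriorAlgebra.ι ℂ m) = -ExteriorAlgebra.ι ℂ m :=
  CliffordAlgebra.involute_ι m

theorem involute_involute' (a : ExteriorAlgebra ℂ M) :
    CliffordAlgebra.involute (CliffordAlgebra.involute a) = a :=
  CliffordAlgebra.involute_involute a

theorem ι_mul_comm (m : M) (b : ExteriorAlgebra ℂ M) :
    ExteriorAlgebra.ι ℂ m * b = CliffordAlgebra.involute b * ExteriorAlgebra.ι ℂ m := by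
  induction b using exterior_left_induction with
  | algebraMap r => simp [Algebra.commutes]
  | add x y hx hy => simp [mul_add, add_mul, hx, hy]
  | ι_mul x m' hx =>
    have h : ExteriorAlgebra.ι ℂ m * ExteriorAlgebra.ι ℂ m' =
        -(ExteriorAlgebra.ι ℂ m' * ExteriorAlgebra.ι ℂ m) :=
      eq_neg_of_add_eq_zero_left (ExteriorAlgebra.ι_add_mul_swap _ _)
    rw [map_mul, involute_ι', ← mul_assoc, h, neg_mul, mul_assoc, hx, neg_mul, neg_mul, mul_assoc]

/-- Twice the even part of `a` is central, and twice the odd part commutes up to the parity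
involution. Left multiplication by a generator exchanges the two parts, so both statements go
through one induction. -/
theorem supercomm (a : ExteriorAlgebra ℂ M) : ∀ b : ExteriorAlgebra ℂ M,
    (a + CliffordAlgebra.involute a) * b = b * (a + CliffordAlgebra.involute a) ∧
    (a - CliffordAlgebra.involute a) * b =
      CliffordAlgebra.involute b * (a - CliffordAlgebra.involute a) := by
  induction a using exterior_left_induction with
  | algebraMap r =>
    intro b
    simp only [AlgHom.commutes, sub_self, zero_mul, mul_zero, and_true]
    simp [mul_add, add_mul, Algebra.commutes]
  | add x y hx hy =>
    intro b
    have h1 := hx b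
    have h2 := hy b
    simp only [map_add]
    constructor
    · rw [add_add_add_comm, add_mul, mul_add, h1.1, h2.1]
    · rw [add_sub_add_comm, add_mul, mul_add, h1.2, h2.2]
  | ι_mul x m hx =>
    intro b
    have e1 : ExteriorAlgebra.ι ℂ m * x +
        CliffordAlgebra.involute (ExteriorAlgebra.ι ℂ m * x) =
        ExteriorAlgebra.ι ℂ m * (x - CliffordAlgebra.involute x) := by
      rw [map_mul, involute_ι', mul_sub, neg_mul, sub_eq_add_neg]
    have e2 : ExteriorAlgebra.ι ℂ m * x -
        CliffordAlgebra.involute (ExteriorAlgebra.ι ℂ m * x) =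
        ExteriorAlgebra.ι ℂ m * (x + CliffordAlgebra.involute x) := by
      rw [map_mul, involute_ι', mul_add, neg_mul, sub_neg_eq_add]
    rw [e1, e2]
    constructor
    · rw [mul_assoc, (hx b).2, ← mul_assoc, ι_mul_comm, involute_involute', mul_assoc]
    · rw [mul_assoc, (hx b).1, ← mul_assoc, ι_mul_comm, mul_assoc]

end Exterior

/-! ### Forms and polyvectors at a point -/

section FibreLemmas

variable {V W U : Type*} [AddCommGroup V] [Module ℂ V] [AddCommGroup W] [Module ℂ W]
  [AddCommGroup U] [Module ℂ U]

/-- The linear functional `conj ∘ β`. -/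
def conjConj (β : ConjDual V) : Module.Dual ℂ V where
  toFun v := conj (β v)
  map_add' v w := by simp
  map_smul' c v := by simp

theorem conjConj_apply (β : ConjDual V) (v : V) : conjConj β v = conj (β v) := rfl

theorem conj_conjConj (β : ConjDual V) (v : V) : conj (conjConj β v) = β v := by
  simp [conjConj_apply]

theorem conjDual_expand {κ : Type*} [Fintype κ] (b : Module.Basis κ ℂ V) (β : ConjDual V) :
    β = ∑ k, β (b k) • conjCovector (b.coord k) := by
  refine LinearMap.ext fun v => ?_
  conv_lhs => rw [← b.sum_repr v, map_sum]
  simp [conjCovector, mul_comm]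

theorem dual_expand {κ : Type*} [Fintype κ] (b : Module.Basis κ ℂ V) (α : Module.Dual ℂ V) :
    α = ∑ k, α (b k) • b.coord k := by
  refine LinearMap.ext fun v => ?_
  conv_lhs => rw [← b.sum_repr v, map_sum]
  simp only [map_smul, smul_eq_mul, LinearMap.sum_apply, LinearMap.smul_apply,
    Module.Basis.coord_apply, mul_comm]

instance conjDual_finite [FiniteDimensional ℂ V] : Module.Finite ℂ (ConjDual V) := by
  let b := Module.finBasis ℂ V
  refine ⟨Submodule.fg_def.2
    ⟨Set.range fun k => conjCovector (b.coord k), Set.finite_range _, ?_⟩⟩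
  rw [eq_top_iff]
  intro β _
  rw [conjDual_expand b β]
  exact Submodule.sum_mem _ fun k _ => Submodule.smul_mem _ _ (Submodule.subset_span ⟨k, rfl⟩)

theorem finrank_conjDual_le [FiniteDimensional ℂ V] :
    Module.finrank ℂ (ConjDual V) ≤ Module.finrank ℂ V := by
  let b := Module.finBasis ℂ V
  have h : Submodule.span ℂ (Set.range fun k => conjCovector (b.coord k)) = ⊤ := by
    rw [eq_top_iff]
    intro β _
    rw [conjDual_expand b β]
    exact Submodule.sum_mem _ fun k _ => Submodule.smul_mem _ _ (Submodule.subset_span ⟨k, rfl⟩)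
  have := finrank_range_le_card (R := ℂ) fun k => conjCovector (b.coord k)
  rw [Set.finrank, h, finrank_top] at this
  simpa using this

theorem ι_eq_add (a : Module.Dual ℂ V × ConjDual V) :
    ExteriorAlgebra.ι ℂ a = covForm a.1 + conjForm a.2 := by
  simp [covForm, conjForm, ← map_add]

/-! Pull-back. -/

theorem formPull_algebraMap (A : V →ₗ[ℂ] W) (r : ℂ) :
    formPull A (algebraMap ℂ _ r) = algebraMap ℂ _ r := by simp [formPull]

theorem formPull_mul (A : V →ₗ[ℂ] W) (a b : FormAlg W) :
    formPull A (a * b) = formPull A a * formPull A b := by simp [formPull]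

theorem formPull_ι (A : V →ₗ[ℂ] W) (a : Module.Dual ℂ W × ConjDual W) :
    formPull A (ExteriorAlgebra.ι ℂ a) = ExteriorAlgebra.ι ℂ (a.1.comp A, a.2.comp A) := by
  simp only [formPull, AlgHom.toLinearMap_apply, ExteriorAlgebra.map_apply_ι]
  rfl

theorem formPull_covForm (A : V →ₗ[ℂ] W) (α : Module.Dual ℂ W) :
    formPull A (covForm α) = covForm (α.comp A) := by
  refine (formPull_ι A (α, 0)).trans ?_
  simp [covForm]

theorem formPull_conjForm (A : V →ₗ[ℂ] W) (β : ConjDual W) :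
    formPull A (conjForm β) = conjForm (β.comp A) := by
  refine (formPull_ι A (0, β)).trans ?_
  simp [conjForm]

theorem formPull_comp (A : V →ₗ[ℂ] W) (B : W →ₗ[ℂ] U) :
    (formPull A).comp (formPull B) = formPull (B.comp A) := by
  refine LinearMap.ext fun x => ?_
  induction x using exterior_left_induction with
  | algebraMap r => simp [formPull_algebraMap]
  | add x y hx hy => rw [map_add, hx, hy, map_add]
  | ι_mul x m hx =>
    simp only [LinearMap.comp_apply, formPull_mul, formPull_ι] at hx ⊢
    rw [hx]; rfl

theorem formPull_id : formPull (LinearMap.id : V →ₗ[ℂ] V) = LinearMap.id := by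
  refine LinearMap.ext fun x => ?_
  induction x using exterior_left_induction with
  | algebraMap r => simp [formPull_algebraMap]
  | add x y hx hy => rw [map_add, hx, hy, map_add]
  | ι_mul x m hx =>
    simp only [formPull_mul, formPull_ι, hx]; rfl

theorem involute_formPull (A : V →ₗ[ℂ] W) (x : FormAlg W) :
    CliffordAlgebra.involute (formPull A x) = formPull A (CliffordAlgebra.involute x) := by
  induction x using exterior_left_induction with
  | algebraMap r => simp [formPull_algebraMap]
  | add x y hx hy => simp only [map_add, hx, hy]
  | ι_mul x m hx =>
    simp only [formPull_mul, formPull_ι, map_mul, involute_ι', map_neg, hx]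

theorem polyPull_mul (A : V →ₗ[ℂ] W) (B : W →ₗ[ℂ] V) (a b : PolyAlg W) :
    polyPull A B (a * b) = polyPull A B a * polyPull A B b := by simp [polyPull]

theorem polyPull_algebraMap (A : V →ₗ[ℂ] W) (B : W →ₗ[ℂ] V) (r : ℂ) :
    polyPull A B (algebraMap ℂ _ r) = algebraMap ℂ _ r := by simp [polyPull]

theorem polyPull_ι (A : V →ₗ[ℂ] W) (B : W →ₗ[ℂ] V) (a : ConjDual W × W) :
    polyPull A B (ExteriorAlgebra.ι ℂ a) = ExteriorAlgebra.ι ℂ (a.1.comp A, B a.2) := by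
  simp only [polyPull, AlgHom.toLinearMap_apply, ExteriorAlgebra.map_apply_ι]
  rfl

theorem involute_polyPull (A : V →ₗ[ℂ] W) (B : W →ₗ[ℂ] V) (x : PolyAlg W) :
    CliffordAlgebra.involute (polyPull A B x) = polyPull A B (CliffordAlgebra.involute x) := by
  induction x using exterior_left_induction with
  | algebraMap r => simp [polyPull_algebraMap]
  | add x y hx hy => simp only [map_add, hx, hy]
  | ι_mul x m hx =>
    simp only [polyPull_mul, polyPull_ι, map_mul, involute_ι', map_neg, hx]

/-! Contraction. -/

theorem contractVec_ι_mul (v : V) (a : Module.Dual ℂ V × ConjDual V) (x : FormAlg V) :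
    contractVec v (ExteriorAlgebra.ι ℂ a * x) =
      a.1 v • x - ExteriorAlgebra.ι ℂ a * contractVec v x :=
  CliffordAlgebra.contractLeft_ι_mul
    (Q := (0 : QuadraticForm ℂ (Module.Dual ℂ V × ConjDual V))) _ a x

theorem contractVec_algebraMap (v : V) (r : ℂ) :
    contractVec v (algebraMap ℂ (FormAlg V) r) = 0 :=
  CliffordAlgebra.contractLeft_algebraMap
    (Q := (0 : QuadraticForm ℂ (Module.Dual ℂ V × ConjDual V))) _ r

theorem contraction_ι (a : ConjDual V × V) (x : FormAlg V) :
    contraction (ExteriorAlgebra.ι ℂ a) x = conjForm a.1 * x + contractVec a.2 x := by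
  simp [contraction, contractGen]

theorem contraction_conjPoly (β : ConjDual V) :
    contraction (conjPoly β) = LinearMap.mulLeft ℂ (conjForm β) := by
  refine LinearMap.ext fun x => ?_
  refine (contraction_ι (β, 0) x).trans ?_
  simp

theorem contraction_algebraMap (r : ℂ) (x : FormAlg V) :
    contraction (algebraMap ℂ (PolyAlg V) r) x = r • x := by
  simp [Module.algebraMap_end_apply]

theorem involute_contractVec (v : V) (x : FormAlg V) :
    CliffordAlgebra.involute (contractVec v x) = -contractVec v (CliffordAlgebra.involute x) := by
  induction x using exterior_left_induction with
  | algebraMap r => simp [contractVec_algebraMap]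
  | add x y hx hy => simp only [map_add, hx, hy, neg_add]
  | ι_mul x m hx =>
    simp only [contractVec_ι_mul, map_sub, map_mul, map_smul, involute_ι', hx, neg_mul, map_neg]
    simp

theorem involute_conjForm (β : ConjDual V) :
    CliffordAlgebra.involute (conjForm β) = -conjForm β := involute_ι' _

theorem involute_covForm (α : Module.Dual ℂ V) :
    CliffordAlgebra.involute (covForm α) = -covForm α := involute_ι' _

theorem involute_contraction (a : PolyAlg V) : ∀ x : FormAlg V,
    CliffordAlgebra.involute (contraction a x) =
      contraction (CliffordAlgebra.involute a) (CliffordAlgebra.involute x) := by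
  induction a using exterior_left_induction with
  | algebraMap r =>
    intro x
    rw [CliffordAlgebra.involute.commutes, contraction_algebraMap, contraction_algebraMap, map_smul]
  | add a b ha hb => intro x; simp only [map_add, LinearMap.add_apply, ha, hb]
  | ι_mul a m ha =>
    intro x
    simp only [map_mul, Module.End.mul_apply, involute_ι', map_neg, LinearMap.neg_apply,
      contraction_ι, map_add, involute_contractVec, involute_conjForm, ha, neg_mul, neg_add]

/-- Contraction is natural although vectors and forms move in opposite directions: on a generator
only the pairing `α (A (B w)) = α w` enters. -/
theorem contractVec_formPull {A : V →ₗ[ℂ] W} {B : W →ₗ[ℂ] V} (hAB : A.comp B = LinearMap.id)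
    (w : W) (x : FormAlg W) :
    contractVec (B w) (formPull A x) = formPull A (contractVec w x) := by
  induction x using exterior_left_induction with
  | algebraMap r => simp [formPull_algebraMap, contractVec_algebraMap]
  | add x y hx hy => simp only [map_add, hx, hy]
  | ι_mul x m hx =>
    have h : A (B w) = w := LinearMap.congr_fun hAB w
    simp only [contractVec_ι_mul, formPull_mul, formPull_ι, map_sub, map_smul, hx,
      LinearMap.comp_apply, h]

theorem contraction_polyPull {A : V →ₗ[ℂ] W} {B : W →ₗ[ℂ] V} (hAB : A.comp B = LinearMap.id)
    (a : PolyAlg W) : ∀ x : FormAlg W,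
    contraction (polyPull A B a) (formPull A x) = formPull A (contraction a x) := by
  induction a using exterior_left_induction with
  | algebraMap r =>
    intro x
    rw [polyPull_algebraMap, contraction_algebraMap, contraction_algebraMap, map_smul]
  | add a b ha hb => intro x; simp only [map_add, LinearMap.add_apply, ha, hb]
  | ι_mul a m ha =>
    intro x
    simp only [polyPull_mul, polyPull_ι, map_mul, Module.End.mul_apply, contraction_ι, map_add,
      ha, formPull_mul, formPull_conjForm, contractVec_formPull hAB]

theorem thetaDeriv_ι_mul (α : Module.Dual ℂ V) (a : ConjDual V × V) (x : PolyAlg V) :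
    thetaDeriv α (ExteriorAlgebra.ι ℂ a * x) =
      α a.2 • x - ExteriorAlgebra.ι ℂ a * thetaDeriv α x :=
  CliffordAlgebra.contractLeft_ι_mul (Q := (0 : QuadraticForm ℂ (ConjDual V × V))) _ a x

theorem thetaDeriv_algebraMap (α : Module.Dual ℂ V) (r : ℂ) :
    thetaDeriv α (algebraMap ℂ (PolyAlg V) r) = 0 :=
  CliffordAlgebra.contractLeft_algebraMap (Q := (0 : QuadraticForm ℂ (ConjDual V × V))) _ r

/-- As functions of `a`, both sides obey the same odd Leibniz rule, so generators decide: `α ∧`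
anticommutes with `β ∧`, and its anticommutator with `ι_v` is `α v`. This identity is the source of
the `∂/∂θ_j` in the bracket. -/
theorem covForm_mul_contraction (α : Module.Dual ℂ V) (a : PolyAlg V) : ∀ x : FormAlg V,
    covForm α * contraction a x - contraction (CliffordAlgebra.involute a) (covForm α * x) =
      contraction (thetaDeriv α a) x := by
  induction a using exterior_left_induction with
  | algebraMap r =>
    intro x
    rw [CliffordAlgebra.involute.commutes, contraction_algebraMap, contraction_algebraMap,
      thetaDeriv_algebraMap]
    simp
  | add a b ha hb =>
    intro x
    simp only [map_add, LinearMap.add_apply, ← ha, ← hb, mul_add]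
    abel
  | ι_mul a m ha =>
    intro x
    have h1 : ∀ y, contractVec m.2 (covForm α * y) = α m.2 • y - covForm α * contractVec m.2 y :=
      fun y => contractVec_ι_mul m.2 (α, 0) y
    have h2 : covForm α * conjForm m.1 = -(conjForm m.1 * covForm α) :=
      eq_neg_of_add_eq_zero_left (ExteriorAlgebra.ι_add_mul_swap _ _)
    have h3 : ∀ y, conjForm m.1 * (covForm α * y) = -(covForm α * (conjForm m.1 * y)) := by
      intro y; rw [← mul_assoc, ← mul_assoc, h2, neg_mul, neg_neg]
    have h4 : contraction (CliffordAlgebra.involute a) (covForm α * x) =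
        covForm α * contraction a x - contraction (thetaDeriv α a) x := by rw [← ha]; abel
    simp only [thetaDeriv_ι_mul, map_mul, Module.End.mul_apply, involute_ι', map_neg,
      LinearMap.neg_apply, contraction_ι, h4, map_sub, map_smul, LinearMap.sub_apply,
      LinearMap.smul_apply, mul_add, h1, h3]
    abel

/-! Weights. -/

theorem rescaleAlg_covForm (α : Module.Dual ℂ V) :
    rescaleAlg (covForm α) = AddMonoidAlgebra.single (-1) (covForm α) := by
  have : rescaleAlg (covForm α) = rescaleGen (α, 0) := ExteriorAlgebra.lift_ι_apply _ _ _ _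
  rw [this]; simp [rescaleGen]

theorem rescaleAlg_conjForm (β : ConjDual V) :
    rescaleAlg (conjForm β) = AddMonoidAlgebra.single 1 (conjForm β) := by
  have : rescaleAlg (conjForm β) = rescaleGen (0, β) := ExteriorAlgebra.lift_ι_apply _ _ _ _
  rw [this]; simp [rescaleGen]

theorem weightPart_covForm_mul (w : ℤ) (α : Module.Dual ℂ V) (x : FormAlg V) :
    weightPart w (covForm α * x) = covForm α * weightPart (w + 1) x := by
  simp only [weightPart, LinearMap.coe_mk, AddHom.coe_mk, map_mul, rescaleAlg_covForm]
  rw [AddMonoidAlgebra.coeff_single_mul_apply]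
  congr 2; ring

theorem weightPart_conjForm_mul (w : ℤ) (β : ConjDual V) (x : FormAlg V) :
    weightPart w (conjForm β * x) = conjForm β * weightPart (w - 1) x := by
  simp only [weightPart, LinearMap.coe_mk, AddHom.coe_mk, map_mul, rescaleAlg_conjForm]
  rw [AddMonoidAlgebra.coeff_single_mul_apply]
  congr 2; ring

theorem weightPart_ι_mul (w : ℤ) (m : Module.Dual ℂ V × ConjDual V) (x : FormAlg V) :
    weightPart w (ExteriorAlgebra.ι ℂ m * x) =
      covForm m.1 * weightPart (w + 1) x + conjForm m.2 * weightPart (w - 1) x := by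
  rw [ι_eq_add, add_mul, map_add, weightPart_covForm_mul, weightPart_conjForm_mul]

theorem weightPart_algebraMap (w : ℤ) (r : ℂ) :
    weightPart w (algebraMap ℂ (FormAlg V) r) = if w = 0 then algebraMap ℂ (FormAlg V) r else 0 := by
  simp only [weightPart, LinearMap.coe_mk, AddHom.coe_mk, AlgHom.commutes]
  simp

theorem weightPart_formPull (w : ℤ) (A : V →ₗ[ℂ] W) (x : FormAlg W) :
    weightPart w (formPull A x) = formPull A (weightPart w x) := by
  induction x using exterior_left_induction generalizing w with
  | algebraMap r =>
    rw [formPull_algebraMap, weightPart_algebraMap, weightPart_algebraMap]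
    split_ifs
    · rw [formPull_algebraMap]
    · rw [map_zero]
  | add x y hx hy => simp only [map_add, hx, hy]
  | ι_mul x m hx =>
    simp only [formPull_mul, formPull_ι, weightPart_ι_mul, hx, map_add, formPull_covForm,
      formPull_conjForm]

theorem involute_weightPart (w : ℤ) (x : FormAlg V) :
    CliffordAlgebra.involute (weightPart w x) = ((w.negOnePow : ℤ) : ℂ) • weightPart w x := by
  induction x using exterior_left_induction generalizing w with
  | algebraMap r =>
    rw [weightPart_algebraMap]
    split_ifs with h
    · simp [h]
    · simp
  | add x y hx hy => simp only [map_add, hx, hy, smul_add]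
  | ι_mul x m hx =>
    simp only [weightPart_ι_mul, map_add, map_mul, hx, involute_covForm, involute_conjForm,
      Int.negOnePow_add, Int.negOnePow_sub, Int.negOnePow_one, smul_add]
    simp

/-- The `(1,0)`-covectors generate a homomorphic image of `Λ(T^*)`, whose powers above `dim V`
vanish. -/
theorem pow_range_covForm_eq_bot [FiniteDimensional ℂ V] {k : ℕ} (hk : Module.finrank ℂ V < k) :
    LinearMap.range (covForm (V := V)) ^ k = ⊥ := by
  have h : LinearMap.range (covForm (V := V)) = (LinearMap.range (ExteriorAlgebra.ι ℂ)).map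
      (ExteriorAlgebra.map (LinearMap.inl ℂ (Module.Dual ℂ V) (ConjDual V))).toLinearMap := by
    rw [← LinearMap.range_comp]
    congr 1
    refine LinearMap.ext fun a => ?_
    simp [covForm]
  rw [h, ← Submodule.map_pow]
  have h' : (LinearMap.range (ExteriorAlgebra.ι ℂ (M := Module.Dual ℂ V))) ^ k = ⊥ :=
    exteriorPower_eq_bot (by rwa [Subspace.dual_finrank_eq])
  rw [h', Submodule.map_bot]

theorem pow_range_conjForm_eq_bot [FiniteDimensional ℂ V] {k : ℕ} (hk : Module.finrank ℂ V < k) :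
    LinearMap.range (conjForm (V := V)) ^ k = ⊥ := by
  have h : LinearMap.range (conjForm (V := V)) = (LinearMap.range (ExteriorAlgebra.ι ℂ)).map
      (ExteriorAlgebra.map (LinearMap.inr ℂ (Module.Dual ℂ V) (ConjDual V))).toLinearMap := by
    rw [← LinearMap.range_comp]
    congr 1
    refine LinearMap.ext fun a => ?_
    simp [conjForm]
  rw [h, ← Submodule.map_pow]
  have h' : (LinearMap.range (ExteriorAlgebra.ι ℂ (M := ConjDual V))) ^ k = ⊥ :=
    exteriorPower_eq_bot (finrank_conjDual_le.trans_lt hk)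
  rw [h', Submodule.map_bot]

theorem iSup_bidegree_eq_top : (⨆ (p : ℕ) (q : ℕ), LinearMap.range (covForm (V := V)) ^ p *
    LinearMap.range (conjForm (V := V)) ^ q) = ⊤ := by
  set S := ⨆ (p : ℕ) (q : ℕ), LinearMap.range (covForm (V := V)) ^ p *
    LinearMap.range (conjForm (V := V)) ^ q with hS
  have hle : ∀ p q, LinearMap.range (covForm (V := V)) ^ p *
    LinearMap.range (conjForm (V := V)) ^ q ≤ S := fun p q => le_iSup₂_of_le p q le_rfl
  -- A product of `p` covectors of type `(1,0)` changes only by the parity involution when a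
  -- `(0,1)`-covector moves across it, and that involution preserves the `p`-th power.
  have hswap : ∀ (p : ℕ) (β : ConjDual V), ∀ c ∈ LinearMap.range (covForm (V := V)) ^ p,
      ∃ c' ∈ LinearMap.range (covForm (V := V)) ^ p, conjForm β * c = c' * conjForm β := by
    intro p β c hc
    have hinv : (LinearMap.range (covForm (V := V)) ^ p).map
        CliffordAlgebra.involute.toLinearMap ≤ LinearMap.range (covForm (V := V)) ^ p := by
      rw [Submodule.map_pow]
      refine pow_le_pow_left' ?_ p
      rintro _ ⟨_, ⟨α, rfl⟩, rfl⟩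
      exact ⟨-α, by rw [map_neg]; exact (involute_covForm α).symm⟩
    exact ⟨_, hinv ⟨c, hc, rfl⟩, ι_mul_comm _ _⟩
  have hmul : ∀ m : Module.Dual ℂ V × ConjDual V, ∀ x ∈ S, ExteriorAlgebra.ι ℂ m * x ∈ S := by
    intro m
    suffices S ≤ S.comap (LinearMap.mulLeft ℂ (ExteriorAlgebra.ι ℂ m)) from this
    refine iSup₂_le fun p q => Submodule.mul_le.2 fun c hc d hd => ?_
    rw [Submodule.mem_comap, LinearMap.mulLeft_apply, ι_eq_add, add_mul]
    refine S.add_mem (hle (p + 1) q ?_) (hle p (q + 1) ?_)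
    · rw [← mul_assoc, pow_succ']
      exact Submodule.mul_mem_mul (Submodule.mul_mem_mul ⟨_, rfl⟩ hc) hd
    · obtain ⟨c', hc', h⟩ := hswap p m.2 c hc
      rw [← mul_assoc, h, mul_assoc, pow_succ']
      exact Submodule.mul_mem_mul hc' (Submodule.mul_mem_mul ⟨_, rfl⟩ hd)
  rw [eq_top_iff]
  intro x _
  induction x using exterior_left_induction with
  | algebraMap r =>
    refine hle 0 0 ?_
    simp only [pow_zero, mul_one]
    exact Submodule.mem_one.2 ⟨r, rfl⟩
  | add x y hx hy => exact S.add_mem (hx trivial) (hy trivial)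
  | ι_mul x m hx => exact hmul m x (hx trivial)

theorem weightPart_bidegree (w : ℤ) (p q : ℕ) (hw : w ≠ q - p) (x : FormAlg V)
    (hx : x ∈ LinearMap.range (covForm (V := V)) ^ p * LinearMap.range (conjForm (V := V)) ^ q) :
    weightPart w x = 0 := by
  induction p generalizing w x with
  | zero =>
    rw [pow_zero, one_mul] at hx
    induction q generalizing w x with
    | zero =>
      obtain ⟨r, rfl⟩ := Submodule.mem_one.1 (by simpa using hx)
      rw [weightPart_algebraMap, if_neg (by simpa using hw)]
    | succ q ih =>
      rw [pow_succ'] at hx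
      refine Submodule.mul_induction_on hx ?_ fun a b ha hb => by rw [map_add, ha, hb, add_zero]
      rintro _ ⟨β, rfl⟩ y hy
      rw [weightPart_conjForm_mul, ih (w - 1) (by push_cast at hw; lia) y hy, mul_zero]
  | succ p ih =>
    rw [pow_succ', mul_assoc] at hx
    refine Submodule.mul_induction_on hx ?_ fun a b ha hb => by rw [map_add, ha, hb, add_zero]
    rintro _ ⟨α, rfl⟩ y hy
    rw [weightPart_covForm_mul, ih (w + 1) (by push_cast at hw; lia) y hy, mul_zero]

/-- Nonzero forms of type `(p, q)` have `p, q ≤ dim V`, so `|q - p| ≤ dim V`. Hence the finite sum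
that defines `rescale` omits nothing. -/
theorem weightPart_eq_zero [FiniteDimensional ℂ V] {w : ℤ}
    (hw : w ∉ Finset.Icc (-(Module.finrank ℂ V : ℤ)) (Module.finrank ℂ V)) :
    weightPart (V := V) w = 0 := by
  rw [← LinearMap.ker_eq_top, eq_top_iff, ← iSup_bidegree_eq_top]
  refine iSup₂_le fun p q x hx => ?_
  by_cases hp : Module.finrank ℂ V < p
  · rw [pow_range_covForm_eq_bot hp, Submodule.bot_mul, Submodule.mem_bot] at hx
    simp [hx]
  by_cases hq : Module.finrank ℂ V < q
  · rw [pow_range_conjForm_eq_bot hq, Submodule.mul_bot, Submodule.mem_bot] at hx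
    simp [hx]
  · refine weightPart_bidegree w p q ?_ x hx
    rintro rfl
    exact hw (Finset.mem_Icc.2 (by lia))

end FibreLemmas

/-! ### Parity in a graded algebra -/

section Parity

variable {R : Type*} [Ring R] [Algebra ℂ R] (𝒜 : ℤ → Submodule ℂ R) [GradedAlgebra 𝒜]

theorem parityInv_of_mem {i : ℤ} {r : R} (hr : r ∈ 𝒜 i) :
    parityInv 𝒜 r = ((i.negOnePow : ℤ) : ℂ) • r := by
  simp only [parityInv, LinearMap.comp_apply, LinearEquiv.coe_coe,
    DirectSum.decomposeLinearEquiv_apply]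
  rw [DirectSum.decompose_of_mem 𝒜 hr]
  exact DirectSum.toModule_lof (M := fun i => 𝒜 i) ℂ i ⟨r, hr⟩

theorem negOnePow_mul_self (i : ℤ) : ((i.negOnePow : ℤ) : ℂ) * ((i.negOnePow : ℤ) : ℂ) = 1 := by
  rw [← Int.cast_mul, ← Units.val_mul, Int.units_mul_self, Units.val_one, Int.cast_one]

theorem parityInv_parityInv (r : R) : parityInv 𝒜 (parityInv 𝒜 r) = r := by
  induction r using DirectSum.Decomposition.inductionOn 𝒜 with
  | zero => simp
  | @homogeneous i m =>
    rw [parityInv_of_mem 𝒜 m.2, map_smul, parityInv_of_mem 𝒜 m.2, smul_smul,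
      negOnePow_mul_self, one_smul]
  | add a b ha hb => rw [map_add, map_add, ha, hb]

theorem parityInv_mul (r t : R) : parityInv 𝒜 (r * t) = parityInv 𝒜 r * parityInv 𝒜 t := by
  induction r using DirectSum.Decomposition.inductionOn 𝒜 with
  | zero => simp
  | @homogeneous i m =>
    induction t using DirectSum.Decomposition.inductionOn 𝒜 with
    | zero => simp
    | @homogeneous j n =>
      rw [parityInv_of_mem 𝒜 m.2, parityInv_of_mem 𝒜 n.2,
        parityInv_of_mem 𝒜 (SetLike.mul_mem_graded m.2 n.2), Int.negOnePow_add,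
        smul_mul_smul_comm]
      push_cast
      rfl
    | add a b ha hb => rw [mul_add, map_add, map_add, ha, hb, mul_add]
  | add a b ha hb => rw [add_mul, map_add, map_add, ha, hb, add_mul]

theorem parityInv_one : parityInv 𝒜 (1 : R) = 1 := by
  rw [parityInv_of_mem 𝒜 SetLike.GradedOne.one_mem]; simp

theorem evenPart_apply (r : R) : evenPart 𝒜 r = (1 / 2 : ℂ) • (r + parityInv 𝒜 r) := rfl

theorem oddPart_apply (r : R) : oddPart 𝒜 r = (1 / 2 : ℂ) • (r - parityInv 𝒜 r) := rfl

theorem evenPart_one : evenPart 𝒜 (1 : R) = 1 := by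
  rw [evenPart_apply, parityInv_one, ← two_smul ℂ (1 : R), smul_smul]; norm_num

theorem oddPart_one : oddPart 𝒜 (1 : R) = 0 := by
  rw [oddPart_apply, parityInv_one]; simp

theorem parityInv_evenPart (r : R) : parityInv 𝒜 (evenPart 𝒜 r) = evenPart 𝒜 r := by
  rw [evenPart_apply, map_smul, map_add, parityInv_parityInv, add_comm]

theorem parityInv_oddPart (r : R) : parityInv 𝒜 (oddPart 𝒜 r) = -oddPart 𝒜 r := by
  rw [oddPart_apply, map_smul, map_sub, parityInv_parityInv, ← smul_neg, neg_sub]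

theorem evenPart_parityInv (r : R) : evenPart 𝒜 (parityInv 𝒜 r) = evenPart 𝒜 r := by
  rw [evenPart_apply, parityInv_parityInv, add_comm, ← evenPart_apply]

theorem oddPart_parityInv (r : R) : oddPart 𝒜 (parityInv 𝒜 r) = -oddPart 𝒜 r := by
  rw [oddPart_apply, oddPart_apply, parityInv_parityInv, ← smul_neg, neg_sub]

theorem evenPart_add_oddPart (r : R) : evenPart 𝒜 r + oddPart 𝒜 r = r := by
  rw [evenPart_apply, oddPart_apply, ← smul_add, add_add_sub_cancel, ← two_smul ℂ r, smul_smul]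
  norm_num

/-- This and the next three rules express that parity is additive in products; they perform the
Koszul bookkeeping in `contractR_polyMul`. -/
theorem evenPart_evenPart_mul (r t : R) :
    evenPart 𝒜 (evenPart 𝒜 r * t) = evenPart 𝒜 r * evenPart 𝒜 t := by
  rw [evenPart_apply, parityInv_mul, parityInv_evenPart, ← mul_add, ← mul_smul_comm,
    ← evenPart_apply]

theorem oddPart_evenPart_mul (r t : R) :
    oddPart 𝒜 (evenPart 𝒜 r * t) = evenPart 𝒜 r * oddPart 𝒜 t := by
  rw [oddPart_apply, parityInv_mul, parityInv_evenPart, ← mul_sub, ← mul_smul_comm,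
    ← oddPart_apply]

theorem evenPart_oddPart_mul (r t : R) :
    evenPart 𝒜 (oddPart 𝒜 r * t) = oddPart 𝒜 r * oddPart 𝒜 t := by
  rw [evenPart_apply, parityInv_mul, parityInv_oddPart, neg_mul, ← sub_eq_add_neg, ← mul_sub,
    ← mul_smul_comm, ← oddPart_apply]

theorem oddPart_oddPart_mul (r t : R) :
    oddPart 𝒜 (oddPart 𝒜 r * t) = oddPart 𝒜 r * evenPart 𝒜 t := by
  rw [oddPart_apply, parityInv_mul, parityInv_oddPart, neg_mul, sub_neg_eq_add, ← mul_add,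
    ← mul_smul_comm, ← evenPart_apply]

theorem even_of_mem {i : ℤ} (hi : Even i) {r : R} (hr : r ∈ 𝒜 i) :
    evenPart 𝒜 r = r ∧ oddPart 𝒜 r = 0 := by
  rw [evenPart_apply, oddPart_apply, parityInv_of_mem 𝒜 hr, Int.negOnePow_even i hi]
  constructor
  · rw [Units.val_one, Int.cast_one, one_smul, ← two_smul ℂ r, smul_smul]; norm_num
  · simp

theorem odd_of_mem {i : ℤ} (hi : Odd i) {r : R} (hr : r ∈ 𝒜 i) :
    evenPart 𝒜 r = 0 ∧ oddPart 𝒜 r = r := by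
  rw [evenPart_apply, oddPart_apply, parityInv_of_mem 𝒜 hr, Int.negOnePow_odd i hi]
  constructor
  · simp
  · rw [Units.val_neg, Units.val_one, Int.cast_neg, Int.cast_one, neg_one_smul, sub_neg_eq_add,
      ← two_smul ℂ r, smul_smul]
    norm_num

theorem evenPart_mul_comm [IsGradedArtin 𝒜] (r t : R) : evenPart 𝒜 r * t = t * evenPart 𝒜 r := by
  induction r using DirectSum.Decomposition.inductionOn 𝒜 with
  | zero => simp
  | @homogeneous i m =>
    rcases Int.even_or_odd i with hi | hi
    · rw [(even_of_mem 𝒜 hi m.2).1]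
      induction t using DirectSum.Decomposition.inductionOn 𝒜 with
      | zero => simp
      | @homogeneous j n =>
        rw [IsGradedArtin.graded_comm i j _ m.2 _ n.2, Int.negOnePow_even _ (hi.mul_right j)]
        simp
      | add a b ha hb => rw [mul_add, add_mul, ha, hb]
    · simp [(odd_of_mem 𝒜 hi m.2).1]
  | add a b ha hb => rw [map_add, add_mul, mul_add, ha, hb]

/-- For `r` of odd degree `i` and `t` of degree `j` the sign `(-1)^{ij}` is `(-1)^j`, the sign by
which `parityInv` acts on `t`. -/
theorem oddPart_mul_comm [IsGradedArtin 𝒜] (r t : R) :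
    oddPart 𝒜 r * t = parityInv 𝒜 t * oddPart 𝒜 r := by
  induction r using DirectSum.Decomposition.inductionOn 𝒜 with
  | zero => simp
  | @homogeneous i m =>
    rcases Int.even_or_odd i with hi | hi
    · simp [(even_of_mem 𝒜 hi m.2).2]
    · rw [(odd_of_mem 𝒜 hi m.2).2]
      induction t using DirectSum.Decomposition.inductionOn 𝒜 with
      | zero => simp
      | @homogeneous j n =>
        rw [IsGradedArtin.graded_comm i j _ m.2 _ n.2, parityInv_of_mem 𝒜 n.2, smul_mul_assoc]
        rcases Int.even_or_odd j with hj | hj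
        · rw [Int.negOnePow_even _ (hj.mul_left i), Int.negOnePow_even _ hj]
        · rw [Int.negOnePow_odd _ (hi.mul hj), Int.negOnePow_odd _ hj]
      | add a b ha hb => rw [mul_add, map_add, add_mul, ha, hb]
  | add a b ha hb => rw [map_add, add_mul, mul_add, ha, hb]

/-! ### Parity under graded homomorphisms. -/

section Map

variable {R' : Type*} [Ring R'] [Algebra ℂ R'] (ℬ : ℤ → Submodule ℂ R') [GradedAlgebra ℬ]
  (f : R →ₐ[ℂ] R')

theorem map_parityInv (hf : ∀ d : ℤ, ∀ r ∈ 𝒜 d, f r ∈ ℬ d) (r : R) :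
    f (parityInv 𝒜 r) = parityInv ℬ (f r) := by
  induction r using DirectSum.Decomposition.inductionOn 𝒜 with
  | zero => simp
  | @homogeneous i m =>
    rw [parityInv_of_mem 𝒜 m.2, parityInv_of_mem ℬ (hf i _ m.2), map_smul]
  | add a b ha hb => rw [map_add, map_add, map_add, map_add, ha, hb]

theorem map_evenPart (hf : ∀ d : ℤ, ∀ r ∈ 𝒜 d, f r ∈ ℬ d) (r : R) :
    f (evenPart 𝒜 r) = evenPart ℬ (f r) := by
  rw [evenPart_apply, evenPart_apply, map_smul, map_add, map_parityInv 𝒜 ℬ f hf]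

theorem map_oddPart (hf : ∀ d : ℤ, ∀ r ∈ 𝒜 d, f r ∈ ℬ d) (r : R) :
    f (oddPart 𝒜 r) = oddPart ℬ (f r) := by
  rw [oddPart_apply, oddPart_apply, map_smul, map_sub, map_parityInv 𝒜 ℬ f hf]

end Map

end Parity

/-! ### Contraction with coefficients -/

section ContractR

variable {R : Type*} [Ring R] [Algebra ℂ R] (𝒜 : ℤ → Submodule ℂ R) [GradedAlgebra 𝒜]
variable {V W : Type*} [AddCommGroup V] [Module ℂ V] [AddCommGroup W] [Module ℂ W]

theorem superAct_tmul {P M : Type*} [AddCommGroup P] [Module ℂ P] [AddCommGroup M] [Module ℂ M]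
    (s : M →ₗ[ℂ] M) (ρ : P →ₗ[ℂ] Module.End ℂ M) (a : P) (r : R) (m : M) (t : R) :
    superAct 𝒜 s ρ (a ⊗ₜ r) (m ⊗ₜ t) =
      ρ a m ⊗ₜ (evenPart 𝒜 r * t) + ρ a (s m) ⊗ₜ (oddPart 𝒜 r * t) := by
  simp [superAct, TensorProduct.homTensorHomMap_apply]

theorem contractR_tmul (a : PolyAlg V) (r : R) (m : FormAlg V) (t : R) :
    contractR 𝒜 (a ⊗ₜ r) (m ⊗ₜ t) = contraction a m ⊗ₜ (evenPart 𝒜 r * t) +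
      contraction a (CliffordAlgebra.involute m) ⊗ₜ (oddPart 𝒜 r * t) :=
  superAct_tmul 𝒜 _ _ a r m t

theorem polyMul_tmul (a : PolyAlg V) (r : R) (b : PolyAlg V) (t : R) :
    polyMul 𝒜 (a ⊗ₜ r) (b ⊗ₜ t) = (a * b) ⊗ₜ (evenPart 𝒜 r * t) +
      (a * CliffordAlgebra.involute b) ⊗ₜ (oddPart 𝒜 r * t) :=
  superAct_tmul 𝒜 _ _ a r b t

theorem polyParity_tmul (a : PolyAlg V) (r : R) :
    polyParity 𝒜 (a ⊗ₜ r) = CliffordAlgebra.involute a ⊗ₜ parityInv 𝒜 r := by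
  simp [polyParity]

/-- Contraction without coefficients is multiplicative and respects parity (`involute_contraction`),
so the Koszul signs on the two sides agree term by term. -/
theorem contractR_polyMul (g h : PolyAlg V ⊗[ℂ] R) :
    contractR 𝒜 (polyMul 𝒜 g h) = contractR 𝒜 g * contractR 𝒜 h := by
  induction g with
  | zero => simp
  | add x y hx hy => simp only [map_add, LinearMap.add_apply, hx, hy, add_mul]
  | tmul a r =>
    induction h with
    | zero => simp
    | add x y hx hy => simp only [map_add, hx, hy, mul_add]
    | tmul b t =>
      refine TensorProduct.ext' fun m u => ?_
      simp only [polyMul_tmul, map_add, LinearMap.add_apply, contractR_tmul, Module.End.mul_apply,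
        evenPart_evenPart_mul, oddPart_evenPart_mul, evenPart_oddPart_mul, oddPart_oddPart_mul,
        map_mul, involute_contraction, involute_involute', mul_assoc]
      abel

/-- An element fixed by the total parity involution is supercentral. -/
theorem polyMul_comm [IsGradedArtin 𝒜] {g : PolyAlg V ⊗[ℂ] R} (hg : polyParity 𝒜 g = g)
    (h : PolyAlg V ⊗[ℂ] R) : polyMul 𝒜 g h = polyMul 𝒜 h g := by
  -- A fixed `g` need not be a sum of fixed pure tensors. The symmetrized statement makes sense for
  -- every `g`, hence can be checked on pure tensors, and for fixed `g` it is twice the claim.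
  suffices H : polyMul 𝒜 (g + polyParity 𝒜 g) h = polyMul 𝒜 h (g + polyParity 𝒜 g) by
    rw [hg, ← two_smul ℂ g] at H
    simpa using H
  clear hg
  induction g with
  | zero => simp
  | add x y hx hy =>
    have e : x + y + polyParity 𝒜 (x + y) =
      (x + polyParity 𝒜 x) + (y + polyParity 𝒜 y) := by rw [map_add]; abel
    rw [e]
    simp only [map_add (polyMul 𝒜) (x + polyParity 𝒜 x), LinearMap.add_apply, hx, hy]
    exact (map_add (polyMul 𝒜 h) _ _).symm
  | tmul a r =>
    induction h with
    | zero => simp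
    | add x y hx hy => rw [map_add, map_add (polyMul 𝒜) x y, LinearMap.add_apply, hx, hy]
    | tmul b t =>
      -- Symmetrizing keeps the even-even and odd-odd components only; to these the two halves of
      -- `supercomm` apply.
      have e : a ⊗ₜ r + polyParity 𝒜 (a ⊗ₜ r) =
          (a + CliffordAlgebra.involute a) ⊗ₜ[ℂ] evenPart 𝒜 r +
          (a - CliffordAlgebra.involute a) ⊗ₜ[ℂ] oddPart 𝒜 r := by
        rw [polyParity_tmul]
        conv_lhs => rw [← evenPart_add_oddPart 𝒜 r]
        simp only [map_add, parityInv_evenPart, parityInv_oddPart, TensorProduct.tmul_add,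
          TensorProduct.tmul_neg, TensorProduct.add_tmul, TensorProduct.sub_tmul]
        abel
      have ee : evenPart 𝒜 (evenPart 𝒜 r) = evenPart 𝒜 r := by
        simpa [evenPart_one] using evenPart_evenPart_mul 𝒜 r 1
      have eo : evenPart 𝒜 (oddPart 𝒜 r) = 0 := by
        simpa [oddPart_one] using evenPart_oddPart_mul 𝒜 r 1
      have oe : oddPart 𝒜 (evenPart 𝒜 r) = 0 := by
        simpa [oddPart_one] using oddPart_evenPart_mul 𝒜 r 1
      have oo : oddPart 𝒜 (oddPart 𝒜 r) = oddPart 𝒜 r := by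
        simpa [evenPart_one] using oddPart_oddPart_mul 𝒜 r 1
      have i1 : CliffordAlgebra.involute (a + CliffordAlgebra.involute a) =
          a + CliffordAlgebra.involute a := by rw [map_add, involute_involute', add_comm]
      have i2 : CliffordAlgebra.involute (a - CliffordAlgebra.involute a) =
          -(a - CliffordAlgebra.involute a) := by rw [map_sub, involute_involute', neg_sub]
      have s1 := (supercomm a b).1
      have s2 := (supercomm a (CliffordAlgebra.involute b)).2
      rw [involute_involute'] at s2
      rw [e]
      simp only [map_add (polyMul 𝒜), map_add (polyMul 𝒜 (b ⊗ₜ[ℂ] t)), LinearMap.add_apply,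
        polyMul_tmul, ee, eo, oe, oo, i1, i2, zero_mul, TensorProduct.tmul_zero, add_zero,
        zero_add, s1, s2, mul_neg, TensorProduct.neg_tmul]
      rw [← TensorProduct.tmul_add, ← add_mul, evenPart_add_oddPart, ← TensorProduct.tmul_neg,
        ← TensorProduct.tmul_add, evenPart_mul_comm 𝒜 r t, oddPart_mul_comm 𝒜 r t]
      congr 2
      conv_lhs => rw [← evenPart_add_oddPart 𝒜 t]
      rw [map_add, parityInv_evenPart, parityInv_oddPart, add_mul, neg_mul]

theorem contractR_comm [IsGradedArtin 𝒜] {g : PolyAlg V ⊗[ℂ] R} (hg : polyParity 𝒜 g = g)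
    (h : PolyAlg V ⊗[ℂ] R) : contractR 𝒜 g * contractR 𝒜 h = contractR 𝒜 h * contractR 𝒜 g := by
  rw [← contractR_polyMul, ← contractR_polyMul, polyMul_comm 𝒜 hg]

theorem contractR_one_tmul (a : PolyAlg V) :
    contractR 𝒜 (a ⊗ₜ (1 : R)) = (contraction a).rTensor R := by
  refine TensorProduct.ext' fun m t => ?_
  simp [contractR_tmul, evenPart_one, oddPart_one]

theorem polyMul_one_tmul (a : PolyAlg V) :
    polyMul 𝒜 (a ⊗ₜ (1 : R)) = (LinearMap.mulLeft ℂ a).rTensor R := by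
  refine TensorProduct.ext' fun m t => ?_
  simp [polyMul_tmul, evenPart_one, oddPart_one]

/-- This is `covForm_mul_contraction` with coefficients. Moving `α` past an odd coefficient costs a
sign, and this sign is what replaces the parity of `a` by the total parity. -/
theorem mulLeft_covForm_contractR (α : Module.Dual ℂ V) (g : PolyAlg V ⊗[ℂ] R) :
    (LinearMap.mulLeft ℂ (covForm α)).rTensor R * contractR 𝒜 g -
      contractR 𝒜 (polyParity 𝒜 g) * (LinearMap.mulLeft ℂ (covForm α)).rTensor R =
    contractR 𝒜 ((thetaDeriv α).rTensor R g) := by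
  induction g with
  | zero =>
    refine LinearMap.ext fun x => ?_
    simp
  | add x y hx hy =>
    simp only [map_add, ← hx, ← hy, mul_add, add_mul]
    abel
  | tmul a r =>
    refine TensorProduct.ext' fun m t => ?_
    simp only [LinearMap.sub_apply, Module.End.mul_apply, LinearMap.rTensor_tmul, contractR_tmul,
      polyParity_tmul, map_add, LinearMap.mulLeft_apply, evenPart_parityInv, oddPart_parityInv,
      map_mul CliffordAlgebra.involute, involute_covForm, neg_mul, map_neg, TensorProduct.neg_tmul,
      TensorProduct.tmul_neg, neg_neg, ← covForm_mul_contraction, TensorProduct.sub_tmul]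
    abel

theorem contractR_pull {A : V →ₗ[ℂ] W} {B : W →ₗ[ℂ] V} (hAB : A.comp B = LinearMap.id)
    (g : PolyAlg W ⊗[ℂ] R) (x : FormAlg W ⊗[ℂ] R) :
    contractR 𝒜 ((polyPull A B).rTensor R g) ((formPull A).rTensor R x) =
      (formPull A).rTensor R (contractR 𝒜 g x) := by
  induction g with
  | zero => simp
  | add g h hg hh => simp only [map_add, LinearMap.add_apply, hg, hh]
  | tmul a r =>
    induction x with
    | zero => simp
    | add x y hx hy => simp only [map_add, hx, hy]
    | tmul m t =>
      simp only [LinearMap.rTensor_tmul, contractR_tmul, map_add, involute_formPull,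
        contraction_polyPull hAB]

theorem polyParity_pull (A : V →ₗ[ℂ] W) (B : W →ₗ[ℂ] V) (g : PolyAlg W ⊗[ℂ] R) :
    polyParity 𝒜 ((polyPull A B).rTensor R g) = (polyPull A B).rTensor R (polyParity 𝒜 g) := by
  induction g with
  | zero => simp
  | add g h hg hh => simp only [map_add, hg, hh]
  | tmul a r => simp only [LinearMap.rTensor_tmul, polyParity_tmul, involute_polyPull]

theorem contractR_map {R' : Type*} [Ring R'] [Algebra ℂ R'] (ℬ : ℤ → Submodule ℂ R')
    [GradedAlgebra ℬ] (f : R →ₐ[ℂ] R') (hf : ∀ d : ℤ, ∀ r ∈ 𝒜 d, f r ∈ ℬ d)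
    (g : PolyAlg V ⊗[ℂ] R) (x : FormAlg V ⊗[ℂ] R) :
    f.toLinearMap.lTensor _ (contractR 𝒜 g x) =
      contractR ℬ (f.toLinearMap.lTensor _ g) (f.toLinearMap.lTensor _ x) := by
  induction g with
  | zero => simp
  | add g h hg hh => simp only [map_add, LinearMap.add_apply, hg, hh]
  | tmul a r =>
    induction x with
    | zero => simp
    | add x y hx hy => simp only [map_add, hx, hy]
    | tmul m t =>
      simp only [LinearMap.lTensor_tmul, contractR_tmul, map_add, AlgHom.toLinearMap_apply,
        map_mul, map_evenPart 𝒜 ℬ f hf, map_oddPart 𝒜 ℬ f hf]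

theorem involute_polyBidegree (q p : ℕ) {a : PolyAlg V} (ha : a ∈ polyBidegree V q p) :
    CliffordAlgebra.involute a = (((p - q : ℤ).negOnePow : ℤ) : ℂ) • a := by
  have h1 : ∀ n : ℕ, ∀ x ∈ LinearMap.range (conjPoly (V := V)) ^ n,
      CliffordAlgebra.involute x = (((n : ℤ).negOnePow : ℤ) : ℂ) • x := by
    intro n x hx
    induction n generalizing x with
    | zero =>
      obtain ⟨r, rfl⟩ := Submodule.mem_one.1 (by simpa using hx)
      simp
    | succ n ih =>
      rw [pow_succ'] at hx
      refine Submodule.mul_induction_on hx ?_ fun a b ha hb => by rw [map_add, ha, hb, smul_add]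
      rintro _ ⟨β, rfl⟩ y hy
      have : CliffordAlgebra.involute (conjPoly β) = -conjPoly β := involute_ι' _
      rw [map_mul, ih y hy, this, Nat.cast_succ, Int.negOnePow_succ]
      simp
  have h2 : ∀ n : ℕ, ∀ x ∈ LinearMap.range (vecPoly (V := V)) ^ n,
      CliffordAlgebra.involute x = (((n : ℤ).negOnePow : ℤ) : ℂ) • x := by
    intro n x hx
    induction n generalizing x with
    | zero =>
      obtain ⟨r, rfl⟩ := Submodule.mem_one.1 (by simpa using hx)
      simp
    | succ n ih =>
      rw [pow_succ'] at hx
      refine Submodule.mul_induction_on hx ?_ fun a b ha hb => by rw [map_add, ha, hb, smul_add]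
      rintro _ ⟨β, rfl⟩ y hy
      have : CliffordAlgebra.involute (vecPoly β) = -vecPoly β := involute_ι' _
      rw [map_mul, ih y hy, this, Nat.cast_succ, Int.negOnePow_succ]
      simp
  refine Submodule.mul_induction_on ha (fun x hx y hy => ?_)
    fun a b ha hb => by rw [map_add, ha, hb, smul_add]
  rw [map_mul, h1 q x hx, h2 p y hy, Int.negOnePow_sub, smul_mul_smul_comm, mul_comm]
  push_cast
  rfl

/-- On a generator `a ⊗ r` both factors contribute the sign `(-1)^{p-q}`, and the signs cancel. -/
theorem polyParity_of_mem_degreeZeroPart {g : PolyAlg V ⊗[ℂ] R} (hg : g ∈ degreeZeroPart 𝒜 V) :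
    polyParity 𝒜 g = g := by
  refine Submodule.span_induction ?_ (map_zero _) (fun x y _ _ hx hy => by rw [map_add, hx, hy])
    (fun c x _ hx => by rw [map_smul, hx]) hg
  rintro _ ⟨q, p, a, ha, r, hr, -, rfl⟩
  rw [polyParity_tmul, involute_polyBidegree q p ha, parityInv_of_mem 𝒜 hr,
    TensorProduct.smul_tmul_smul, negOnePow_mul_self, one_smul]

end ContractR

/-! ### Nilpotency -/

section Nilpotent

variable {R : Type*} [Ring R] [Algebra ℂ R] (𝒜 : ℤ → Submodule ℂ R) [GradedAlgebra 𝒜]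

/-- The ring is only graded-commutative, so the Jacobson radical stands in for the maximal ideal; it
is nilpotent because `R` is Artinian. -/
theorem nonunits_subset_jacobson [FiniteDimensional ℂ R] [IsLocalRing R] {x : R}
    (hx : x ∈ nonunits R) : x ∈ Ideal.jacobson (⊥ : Ideal R) := by
  have : IsArtinianRing R := IsArtinianRing.of_finite ℂ R
  have : IsNoetherianRing R := IsNoetherianRing.of_finite ℂ R
  rw [Ideal.mem_jacobson_iff]
  intro y
  have h : IsUnit (-(y * x)) ∨ IsUnit (1 + y * x) :=
    IsLocalRing.isUnit_or_isUnit_of_add_one (by abel)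
  -- If `y * x` were a unit, `x` would have a left inverse; in a finite-dimensional algebra that
  -- makes `x` a unit. So `1 + y * x` is the unit, and its inverse is the required witness.
  rcases h with h | h
  · refine absurd ?_ hx
    obtain ⟨u, hu⟩ := h.neg
    rw [neg_neg] at hu
    have : (↑u⁻¹ * y) * x = 1 := by rw [mul_assoc, ← hu, Units.inv_mul]
    exact IsUnit.of_mul_eq_one_right _ this
  · obtain ⟨u, hu⟩ := h
    refine ⟨↑u⁻¹, ?_⟩
    have : (↑u⁻¹ : R) * y * x + ↑u⁻¹ - 1 = ↑u⁻¹ * (1 + y * x) - 1 := by noncomm_ring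
    rw [this, ← hu, Units.inv_mul, sub_self]
    exact Submodule.zero_mem _

theorem exists_jacobson_pow_eq_bot [FiniteDimensional ℂ R] :
    ∃ N : ℕ, Ideal.jacobson (⊥ : Ideal R) ^ N = ⊥ := by
  have : IsArtinianRing R := IsArtinianRing.of_finite ℂ R
  exact IsArtinianRing.isNilpotent_jacobson_bot

/-- Each application of `i_γ` multiplies the coefficients by elements of the Jacobson radical `J`,
so it moves forms with coefficients in `J^k` to coefficients in `J^{k+1}`. The bound `N` depends on
`R` alone, which makes it uniform over the points of the manifold. -/
theorem exists_contractR_pow_eq_zero [hA : IsGradedArtin 𝒜] : ∃ N : ℕ,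
    ∀ {V : Type*} [AddCommGroup V] [Module ℂ V] (g : PolyAlg V ⊗[ℂ] R),
      g ∈ degreeZeroPart 𝒜 V → contractR 𝒜 g ^ N = 0 := by
  have : FiniteDimensional ℂ R := IsGradedArtin.finite 𝒜
  have : IsLocalRing R := IsGradedArtin.isLocal 𝒜
  obtain ⟨N, hN⟩ := exists_jacobson_pow_eq_bot (R := R)
  refine ⟨N, fun {V} _ _ g hg => ?_⟩
  set J := Ideal.jacobson (⊥ : Ideal R)
  let F : ℕ → Submodule ℂ (FormAlg V ⊗[ℂ] R) := fun k =>
    Submodule.span ℂ {t | ∃ m : FormAlg V, ∃ r ∈ J ^ k, t = m ⊗ₜ[ℂ] r}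
  have step : ∀ k, ∀ x ∈ F k, contractR 𝒜 g x ∈ F (k + 1) := by
    intro k x hx
    refine Submodule.span_induction ?_ (by simp)
      (fun y z _ _ hy hz => by rw [map_add, LinearMap.add_apply]; exact add_mem hy hz)
      (fun c y _ hy => by rw [map_smul, LinearMap.smul_apply]; exact Submodule.smul_mem _ _ hy) hg
    rintro _ ⟨q, p, a, -, r, hr, hr', rfl⟩
    refine Submodule.span_induction ?_ (by simp)
      (fun y z _ _ hy hz => by rw [map_add]; exact add_mem hy hz)
      (fun c y _ hy => by rw [map_smul]; exact Submodule.smul_mem _ _ hy) hx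
    rintro _ ⟨m, t, ht, rfl⟩
    have hrt : r * t ∈ J ^ (k + 1) := by
      rw [Ideal.IsTwoSided.pow_succ]
      exact Ideal.mul_mem_mul (nonunits_subset_jacobson hr') ht
    rw [contractR_tmul]
    -- The coefficient `r` is homogeneous, so one of its even and odd parts is zero and a single
    -- pure tensor is left.
    rcases Int.even_or_odd ((p : ℤ) - q) with hi | hi
    · rw [(even_of_mem 𝒜 hi hr).1, (even_of_mem 𝒜 hi hr).2, zero_mul, TensorProduct.tmul_zero,
        add_zero]
      exact Submodule.subset_span ⟨_, _, hrt, rfl⟩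
    · rw [(odd_of_mem 𝒜 hi hr).1, (odd_of_mem 𝒜 hi hr).2, zero_mul, TensorProduct.tmul_zero,
        zero_add]
      exact Submodule.subset_span ⟨_, _, hrt, rfl⟩
  have h0 : ∀ x, x ∈ F 0 := by
    intro x
    induction x with
    | zero => exact zero_mem _
    | add x y hx hy => exact add_mem hx hy
    | tmul m t => exact Submodule.subset_span ⟨m, t, by rw [Submodule.pow_zero, Ideal.one_eq_top]; trivial, rfl⟩
  have hk : ∀ k x, (contractR 𝒜 g ^ k) x ∈ F k := by
    intro k x
    induction k with
    | zero => exact h0 _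
    | succ k ih => rw [pow_succ', Module.End.mul_apply]; exact step k _ ih
  refine LinearMap.ext fun x => ?_
  have := hk N x
  have hF : F N = ⊥ := by
    rw [Submodule.span_eq_bot]
    rintro _ ⟨m, r, hr, rfl⟩
    rw [hN, Submodule.mem_bot] at hr
    rw [hr, TensorProduct.tmul_zero]
  rw [hF, Submodule.mem_bot] at this
  exact this

end Nilpotent

/-! ### Directional derivatives of maps into finite-dimensional spaces -/

section Calculus

open Topology

variable {E : Type*} [NormedAddCommGroup E] [NormedSpace ℂ E]
variable {F G H : Type*} [AddCommGroup F] [Module ℂ F] [AddCommGroup G] [Module ℂ G]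
  [AddCommGroup H] [Module ℂ H]

/-- Differentiability of a map into a finite-dimensional complex vector space: all linear
functionals of it are differentiable. -/
def WeakDiffAt (f : E → F) (y : E) : Prop :=
  ∀ l : Module.Dual ℂ F, DifferentiableAt ℝ (fun z => l (f z)) y

theorem SmoothOn.weakDiffAt {f : E → F} {s : Set E} (hf : SmoothOn f s) (hs : IsOpen s) {y : E}
    (hy : y ∈ s) : WeakDiffAt f y := fun l =>
  ((hf l).contDiffAt (hs.mem_nhds hy)).differentiableAt (by simp)

theorem SmoothOn.congr {f g : E → F} {s : Set E} (hf : SmoothOn f s) (h : ∀ y ∈ s, g y = f y) :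
    SmoothOn g s := fun l => (hf l).congr fun y hy => by rw [h y hy]

theorem SmoothOn.map {f : E → F} {s : Set E} (hf : SmoothOn f s) (L : F →ₗ[ℂ] G) :
    SmoothOn (fun y => L (f y)) s := fun l => hf (l.comp L)

theorem SmoothOn.sum {κ : Type*} (t : Finset κ) {f : κ → E → F} {s : Set E}
    (hf : ∀ k ∈ t, SmoothOn (f k) s) : SmoothOn (fun y => ∑ k ∈ t, f k y) s := fun l => by
  simp only [map_sum]
  exact ContDiffOn.sum fun k hk => hf k hk l

/-- Expanding the first argument in a basis reduces a bilinear expression to products of scalar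
functions, for which the usual calculus is available. -/
theorem apply_bilin_eq_sum [FiniteDimensional ℂ F] (b : F →ₗ[ℂ] G →ₗ[ℂ] H) (l : Module.Dual ℂ H)
    (x : F) (z : G) : l (b x z) = ∑ k, (Module.finBasis ℂ F).coord k x *
      (l.comp (b (Module.finBasis ℂ F k))) z := by
  conv_lhs => rw [← (Module.finBasis ℂ F).sum_repr x]
  simp only [map_sum, map_smul, LinearMap.sum_apply, LinearMap.smul_apply, smul_eq_mul,
    Module.Basis.coord_apply, LinearMap.comp_apply]

theorem SmoothOn.bilin [FiniteDimensional ℂ F] {f : E → F} {g : E → G} {s : Set E}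
    (b : F →ₗ[ℂ] G →ₗ[ℂ] H) (hf : SmoothOn f s) (hg : SmoothOn g s) :
    SmoothOn (fun y => b (f y) (g y)) s := fun l => by
  simp only [apply_bilin_eq_sum b l]
  exact ContDiffOn.sum fun k _ => (hf _).mul (hg _)

theorem WeakDiffAt.const (c : F) (y : E) : WeakDiffAt (fun _ => c) y := fun _ =>
  differentiableAt_const _

theorem WeakDiffAt.add {f g : E → F} {y : E} (hf : WeakDiffAt f y) (hg : WeakDiffAt g y) :
    WeakDiffAt (fun z => f z + g z) y := fun l => by
  simp only [map_add]
  exact (hf l).add (hg l)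

theorem WeakDiffAt.sum {κ : Type*} (t : Finset κ) {f : κ → E → F} {y : E}
    (hf : ∀ k ∈ t, WeakDiffAt (f k) y) : WeakDiffAt (fun z => ∑ k ∈ t, f k z) y := fun l => by
  simp only [map_sum]
  exact DifferentiableAt.fun_sum fun k hk => hf k hk l

theorem WeakDiffAt.map {f : E → F} {y : E} (hf : WeakDiffAt f y) (L : F →ₗ[ℂ] G) :
    WeakDiffAt (fun z => L (f z)) y := fun l => hf (l.comp L)

theorem WeakDiffAt.bilin [FiniteDimensional ℂ F] {f : E → F} {g : E → G} {y : E}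
    (b : F →ₗ[ℂ] G →ₗ[ℂ] H) (hf : WeakDiffAt f y) (hg : WeakDiffAt g y) :
    WeakDiffAt (fun z => b (f z) (g z)) y := fun l => by
  simp only [apply_bilin_eq_sum b l]
  exact DifferentiableAt.fun_sum fun k _ => (hf _).mul (hg _)

theorem eq_of_forall_dual {a b : F} (h : ∀ l : Module.Dual ℂ F, l a = l b) : a = b := by
  rw [← sub_eq_zero, ← Module.forall_dual_apply_eq_zero_iff ℂ]
  intro l
  rw [map_sub, h, sub_self]

/-- Any functional is a combination of the coordinates used in the definition. Since functionals
separate points, this removes the choice of basis and reduces all rules for `dirDeriv` to scalar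
ones. -/
theorem apply_dirDeriv [FiniteDimensional ℂ F] {f : E → F} {y : E} (hf : WeakDiffAt f y) (v : E)
    (l : Module.Dual ℂ F) : l (dirDeriv f y v) = fderiv ℝ (fun z => l (f z)) y v := by
  set b := Module.Basis.ofVectorSpace ℂ F
  have e : ∀ x : F, l x = ∑ k, b.coord k x * l (b k) := by
    intro x
    conv_lhs => rw [← b.sum_repr x]
    simp only [map_sum, map_smul, smul_eq_mul, Module.Basis.coord_apply]
  have hd : HasFDerivAt (fun z => ∑ k, b.coord k (f z) * l (b k))
      (∑ k, (l (b k)) • fderiv ℝ (fun z => b.coord k (f z)) y) y :=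
    HasFDerivAt.fun_sum fun k _ => (hf (b.coord k)).hasFDerivAt.mul_const (l (b k))
  simp only [e (f _)]
  rw [hd.fderiv, dirDeriv, finsum_eq_sum_of_fintype, map_sum, sum_apply]
  refine Finset.sum_congr rfl fun k _ => ?_
  rw [map_smul, smul_eq_mul, mul_comm]
  rfl

theorem dirDeriv_congr {f g : E → F} {y : E} (h : f =ᶠ[𝓝 y] g) (v : E) :
    dirDeriv f y v = dirDeriv g y v := by
  unfold dirDeriv
  refine finsum_congr fun k => ?_
  have h' : (fun z => (Module.Basis.ofVectorSpace ℂ F).repr (f z) k) =ᶠ[𝓝 y]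
      fun z => (Module.Basis.ofVectorSpace ℂ F).repr (g z) k := h.mono fun z hz => by simp only [hz]
  rw [h'.fderiv_eq]

theorem dirDeriv_map [FiniteDimensional ℂ F] [FiniteDimensional ℂ G] {f : E → F} {y : E}
    (hf : WeakDiffAt f y) (L : F →ₗ[ℂ] G) (v : E) :
    dirDeriv (fun z => L (f z)) y v = L (dirDeriv f y v) :=
  eq_of_forall_dual fun l => by
    rw [apply_dirDeriv (hf.map L)]
    exact (apply_dirDeriv hf v (l.comp L)).symm

theorem dirDeriv_add [FiniteDimensional ℂ F] {f g : E → F} {y : E}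
    (hf : WeakDiffAt f y) (hg : WeakDiffAt g y) (v : E) :
    dirDeriv (fun z => f z + g z) y v = dirDeriv f y v + dirDeriv g y v :=
  eq_of_forall_dual fun l => by
    rw [apply_dirDeriv (hf.add hg), map_add, apply_dirDeriv hf, apply_dirDeriv hg]
    simp only [map_add]
    rw [fderiv_fun_add (hf l) (hg l)]
    rfl

theorem dirDeriv_bilin [FiniteDimensional ℂ F] [FiniteDimensional ℂ G] [FiniteDimensional ℂ H]
    {f : E → F} {g : E → G} {y : E} (b : F →ₗ[ℂ] G →ₗ[ℂ] H) (hf : WeakDiffAt f y)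
    (hg : WeakDiffAt g y) (v : E) :
    dirDeriv (fun z => b (f z) (g z)) y v = b (dirDeriv f y v) (g y) + b (f y) (dirDeriv g y v) :=
  eq_of_forall_dual fun l => by
    rw [apply_dirDeriv (hf.bilin b hg), map_add]
    simp only [apply_bilin_eq_sum b l]
    have hd : ∀ k, HasFDerivAt (fun z => (Module.finBasis ℂ F).coord k (f z) *
        (l.comp (b (Module.finBasis ℂ F k))) (g z)) _ y := fun k =>
      (hf ((Module.finBasis ℂ F).coord k)).hasFDerivAt.mul
        (hg (l.comp (b (Module.finBasis ℂ F k)))).hasFDerivAt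
    rw [(HasFDerivAt.fun_sum fun k _ => hd k).fderiv, sum_apply,
      ← Finset.sum_add_distrib]
    refine Finset.sum_congr rfl fun k _ => ?_
    rw [apply_dirDeriv hf, apply_dirDeriv hg]
    simp only [add_apply, smul_apply, smul_eq_mul]
    ring

theorem dirDeriv_add_dir [FiniteDimensional ℂ F] {f : E → F} {y : E}
    (hf : WeakDiffAt f y) (v w : E) :
    dirDeriv f y (v + w) = dirDeriv f y v + dirDeriv f y w :=
  eq_of_forall_dual fun l => by
    rw [map_add, apply_dirDeriv hf, apply_dirDeriv hf, apply_dirDeriv hf, map_add]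

theorem dirDeriv_smul_dir [FiniteDimensional ℂ F] {f : E → F} {y : E}
    (hf : WeakDiffAt f y) (c : ℝ) (v : E) :
    dirDeriv f y (c • v) = (c : ℂ) • dirDeriv f y v :=
  eq_of_forall_dual fun l => by
    rw [map_smul, apply_dirDeriv hf, apply_dirDeriv hf, map_smul]
    simp

theorem dirDeriv_comp [FiniteDimensional ℂ F] {f : E → F} {g : E → E} {g' : E →L[ℂ] E} {y : E}
    (hg : HasFDerivAt g g' y) (hf : WeakDiffAt f (g y)) (v : E) :
    dirDeriv (fun z => f (g z)) y v = dirDeriv f (g y) (g' v) := by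
  have hd : ∀ l : Module.Dual ℂ F, HasFDerivAt (fun z => l (f (g z)))
      ((fderiv ℝ (fun z => l (f z)) (g y)).comp (g'.restrictScalars ℝ)) y := fun l =>
    HasFDerivAt.comp y (hf l).hasFDerivAt (hg.restrictScalars ℝ)
  refine eq_of_forall_dual fun l => ?_
  rw [apply_dirDeriv hf, apply_dirDeriv fun l => (hd l).differentiableAt, (hd l).fderiv]
  rfl

theorem WeakDiffAt.comp {f : E → F} {g : E → E} {g' : E →L[ℂ] E} {y : E}
    (hg : HasFDerivAt g g' y) (hf : WeakDiffAt f (g y)) : WeakDiffAt (fun z => f (g z)) y :=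
  fun l => (HasFDerivAt.comp y (hf l).hasFDerivAt (hg.restrictScalars ℝ)).differentiableAt

theorem SmoothOn.dirDeriv [FiniteDimensional ℂ F] {f : E → F} {s : Set E} (hf : SmoothOn f s)
    (hs : IsOpen s) (v : E) : SmoothOn (fun y => dirDeriv f y v) s := fun l => by
  refine ContDiffOn.congr (f := fun y => fderiv ℝ (fun z => l (f z)) y v) ?_
    fun y hy => apply_dirDeriv (hf.weakDiffAt hs hy) v l
  exact ((hf l).fderiv_of_isOpen hs (m := ∞) (by simp)).clm_apply contDiffOn_const

theorem two_le_infty : (1 + 1 : WithTop ℕ∞) ≤ ∞ := by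
  rw [one_add_one_eq_two]
  exact WithTop.coe_le_coe.2 (OrderTop.le_top (2 : ℕ∞))

theorem dirDeriv_dirDeriv_comm [FiniteDimensional ℂ F] {f : E → F} {s : Set E}
    (hf : SmoothOn f s) (hs : IsOpen s) {y : E} (hy : y ∈ s) (v w : E) :
    dirDeriv (fun z => dirDeriv f z v) y w = dirDeriv (fun z => dirDeriv f z w) y v := by
  -- After a functional is applied, the iterated derivative is the real second derivative, whose
  -- symmetry gives the claim.
  have key : ∀ (l : Module.Dual ℂ F) (v w : E), l (SemiInfHodge.dirDeriv
      (fun z => SemiInfHodge.dirDeriv f z v) y w) =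
      fderiv ℝ (fderiv ℝ fun z => l (f z)) y w v := by
    intro l v w
    have hc := (hf l).contDiffAt (hs.mem_nhds hy)
    have hd : DifferentiableAt ℝ (fderiv ℝ fun z => l (f z)) y :=
      (hc.fderiv_right (m := 1) two_le_infty).differentiableAt (by simp)
    rw [apply_dirDeriv ((hf.dirDeriv hs v).weakDiffAt hs hy)]
    have he : (fun z => l (SemiInfHodge.dirDeriv f z v)) =ᶠ[𝓝 y]
        fun z => fderiv ℝ (fun z => l (f z)) z v :=
      Filter.eventuallyEq_of_mem (hs.mem_nhds hy) fun z hz =>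
        apply_dirDeriv (hf.weakDiffAt hs hz) v l
    rw [he.fderiv_eq, (hd.hasFDerivAt.clm_apply (hasFDerivAt_const v y)).fderiv]
    simp
  refine eq_of_forall_dual fun l => ?_
  rw [key, key]
  exact ((hf l).contDiffAt (hs.mem_nhds hy)).isSymmSndFDerivAt
    (by rw [minSmoothness_of_isRCLikeNormedField]; exact two_le_infty) w v

/-! Wirtinger derivatives, `ε = -1` for `∂` and `ε = 1` for `\bar∂`. -/

/-- `(D_v + ε i D_{iv}) / 2`. -/
def wirtSign (ε : ℂ) (f : E → F) (y v : E) : F :=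
  (1 / 2 : ℂ) • (dirDeriv f y v + (ε * Complex.I) • dirDeriv f y (Complex.I • v))

theorem wirt_eq (f : E → F) (y v : E) : wirt f y v = wirtSign (-1) f y v := by
  simp [wirt, wirtSign, sub_eq_add_neg]

theorem wirtBar_eq (f : E → F) (y v : E) : wirtBar f y v = wirtSign 1 f y v := by
  simp [wirtBar, wirtSign]

theorem wirtSign_congr (ε : ℂ) {f g : E → F} {y : E} (h : f =ᶠ[𝓝 y] g) (v : E) :
    wirtSign ε f y v = wirtSign ε g y v := by
  simp only [wirtSign, dirDeriv_congr h]

theorem wirtSign_map [FiniteDimensional ℂ F] [FiniteDimensional ℂ G] (ε : ℂ) {f : E → F} {y : E}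
    (hf : WeakDiffAt f y) (L : F →ₗ[ℂ] G) (v : E) :
    wirtSign ε (fun z => L (f z)) y v = L (wirtSign ε f y v) := by
  simp only [wirtSign, dirDeriv_map hf, map_smul, map_add]

theorem wirtSign_add [FiniteDimensional ℂ F] (ε : ℂ) {f g : E → F} {y : E}
    (hf : WeakDiffAt f y) (hg : WeakDiffAt g y) (v : E) :
    wirtSign ε (fun z => f z + g z) y v = wirtSign ε f y v + wirtSign ε g y v := by
  simp only [wirtSign, dirDeriv_add hf hg]
  module

theorem wirtSign_const [FiniteDimensional ℂ F] (ε : ℂ) (c : F) (y v : E) :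
    wirtSign ε (fun _ => c) y v = 0 := by
  have h : ∀ v : E, dirDeriv (fun _ => c) y v = 0 := fun v => eq_of_forall_dual fun l => by
    rw [apply_dirDeriv (WeakDiffAt.const c y)]; simp
  simp [wirtSign, h]

theorem wirtSign_sum [FiniteDimensional ℂ F] (ε : ℂ) {κ : Type*} (t : Finset κ) {f : κ → E → F}
    {y : E} (hf : ∀ k ∈ t, WeakDiffAt (f k) y) (v : E) :
    wirtSign ε (fun z => ∑ k ∈ t, f k z) y v = ∑ k ∈ t, wirtSign ε (f k) y v := by
  classical
  induction t using Finset.induction_on with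
  | empty => simpa using wirtSign_const ε (0 : F) y v
  | insert a t ha ih =>
    simp only [Finset.sum_insert ha]
    rw [wirtSign_add ε (hf a (Finset.mem_insert_self a t))
      (WeakDiffAt.sum t fun k hk => hf k (Finset.mem_insert_of_mem hk)),
      ih fun k hk => hf k (Finset.mem_insert_of_mem hk)]

theorem wirtSign_bilin [FiniteDimensional ℂ F] [FiniteDimensional ℂ G] [FiniteDimensional ℂ H]
    (ε : ℂ) {f : E → F} {g : E → G} {y : E} (b : F →ₗ[ℂ] G →ₗ[ℂ] H) (hf : WeakDiffAt f y)
    (hg : WeakDiffAt g y) (v : E) :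
    wirtSign ε (fun z => b (f z) (g z)) y v =
      b (wirtSign ε f y v) (g y) + b (f y) (wirtSign ε g y v) := by
  simp only [wirtSign, dirDeriv_bilin b hf hg, map_smul, map_add, LinearMap.smul_apply,
    LinearMap.add_apply]
  module

/-- The derivative of `g` commutes with multiplication by `i`, so the chain rule does not mix `∂`
and `\bar∂`. -/
theorem wirtSign_comp [FiniteDimensional ℂ F] (ε : ℂ) {f : E → F} {g : E → E} {g' : E →L[ℂ] E}
    {y : E} (hg : HasFDerivAt g g' y) (hf : WeakDiffAt f (g y)) (v : E) :
    wirtSign ε (fun z => f (g z)) y v = wirtSign ε f (g y) (g' v) := by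
  simp only [wirtSign, dirDeriv_comp hg hf, map_smul]

theorem SmoothOn.wirtSign [FiniteDimensional ℂ F] (ε : ℂ) {f : E → F} {s : Set E}
    (hf : SmoothOn f s) (hs : IsOpen s) (v : E) : SmoothOn (fun y => wirtSign ε f y v) s :=
  ((hf.dirDeriv hs v).add ((hf.dirDeriv hs (Complex.I • v)).smul (ε * Complex.I))).smul (1 / 2)

/-- Wirtinger derivatives are combinations of directional derivatives with constant coefficients,
and those commute on smooth maps. -/
theorem wirtSign_wirtSign_comm [FiniteDimensional ℂ F] (ε δ : ℂ) {f : E → F} {s : Set E}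
    (hf : SmoothOn f s) (hs : IsOpen s) {y : E} (hy : y ∈ s) (v w : E) :
    wirtSign δ (fun z => wirtSign ε f z v) y w = wirtSign ε (fun z => wirtSign δ f z w) y v := by
  have key : ∀ (ε : ℂ) (v w : E), SemiInfHodge.dirDeriv (fun z => SemiInfHodge.wirtSign ε f z v) y w
      = (1 / 2 : ℂ) • (SemiInfHodge.dirDeriv (fun z => SemiInfHodge.dirDeriv f z v) y w +
      (ε * Complex.I) •
        SemiInfHodge.dirDeriv (fun z => SemiInfHodge.dirDeriv f z (Complex.I • v)) y w) := by
    intro ε v w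
    have h1 := (hf.dirDeriv hs v).weakDiffAt hs hy
    have h2 := (hf.dirDeriv hs (Complex.I • v)).weakDiffAt hs hy
    have h2' := h2.map (LinearMap.lsmul ℂ F (ε * Complex.I))
    have e := dirDeriv_map (h1.add h2') (LinearMap.lsmul ℂ F (1 / 2 : ℂ)) w
    rw [dirDeriv_add h1 h2', dirDeriv_map h2] at e
    exact e
  simp only [SemiInfHodge.wirtSign.eq_1 δ (fun z => SemiInfHodge.wirtSign ε f z v),
    SemiInfHodge.wirtSign.eq_1 ε (fun z => SemiInfHodge.wirtSign δ f z w), key,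
    dirDeriv_dirDeriv_comm hf hs hy w, dirDeriv_dirDeriv_comm hf hs hy (Complex.I • w)]
  module

theorem dirDeriv_complex_dir [FiniteDimensional ℂ F] {f : E → F} {y : E} (hf : WeakDiffAt f y)
    (c : ℂ) (v : E) : dirDeriv f y (c • v) =
      (c.re : ℂ) • dirDeriv f y v + (c.im : ℂ) • dirDeriv f y (Complex.I • v) := by
  rw [← dirDeriv_smul_dir hf, ← dirDeriv_smul_dir hf, ← dirDeriv_add_dir hf]
  congr 1
  conv_lhs => rw [← Complex.re_add_im c, add_smul, mul_smul]
  rfl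

theorem wirtSign_add_dir [FiniteDimensional ℂ F] (ε : ℂ) {f : E → F} {y : E}
    (hf : WeakDiffAt f y) (v w : E) :
    wirtSign ε f y (v + w) = wirtSign ε f y v + wirtSign ε f y w := by
  simp only [wirtSign, smul_add (Complex.I) v w, dirDeriv_add_dir hf]
  module

/-- The derivative `∂_v` is complex linear in `v`. -/
def wirtLin [FiniteDimensional ℂ F] {f : E → F} {y : E} (hf : WeakDiffAt f y) : E →ₗ[ℂ] F where
  toFun v := wirtSign (-1) f y v
  map_add' := wirtSign_add_dir (-1) hf
  map_smul' c v := by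
    simp only [wirtSign, smul_smul Complex.I c v, RingHom.id_apply]
    rw [dirDeriv_complex_dir hf, dirDeriv_complex_dir hf (Complex.I * c)]
    have hI := Complex.I_mul_I
    have hc := Complex.re_add_im c
    simp only [Complex.mul_re, Complex.mul_im, Complex.I_re, Complex.I_im]
    match_scalars <;> simp
    · linear_combination (1 / 2) * hc
    · linear_combination (-(1 / 2) * Complex.I) * hc + (1 / 2) * (c.im : ℂ) * hI

/-- The derivative `\bar∂_v` is conjugate-linear in `v`. -/
def wirtBarLin [FiniteDimensional ℂ F] {f : E → F} {y : E} (hf : WeakDiffAt f y) :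
    E →ₗ⋆[ℂ] F where
  toFun v := wirtSign 1 f y v
  map_add' := wirtSign_add_dir 1 hf
  map_smul' c v := by
    simp only [wirtSign, smul_smul Complex.I c v]
    rw [dirDeriv_complex_dir hf, dirDeriv_complex_dir hf (Complex.I * c)]
    have hI := Complex.I_mul_I
    have hc : (starRingEnd ℂ) c = c.re - c.im * Complex.I := by
      apply Complex.ext <;> simp
    rw [hc]
    simp only [Complex.mul_re, Complex.mul_im, Complex.I_re, Complex.I_im]
    match_scalars <;> simp
    · ring
    · linear_combination ((1 / 2) * (c.im : ℂ)) * hI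

end Calculus

/-! ### First-order operators in a coordinate domain -/

section Operators

open Topology

variable {E : Type*} [NormedAddCommGroup E] [NormedSpace ℂ E]
variable {M M' : Type*} [AddCommGroup M] [Module ℂ M] [AddCommGroup M'] [Module ℂ M']
variable {κ : Type*} [Fintype κ]

/-- The first-order operator `∑ c_k ∂_k` with constant coefficients, where `∂_k` is the
Wirtinger derivative of sign `ε k` in the direction `v k`. -/
def wirtOp (ε : κ → ℂ) (v : κ → E) (c : κ → Module.End ℂ M) (f : E → M) (y : E) : M :=
  ∑ k, c k (wirtSign (ε k) f y (v k))

theorem wirtOp_congr (ε : κ → ℂ) (v : κ → E) (c : κ → Module.End ℂ M) {f g : E → M} {y : E}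
    (h : f =ᶠ[𝓝 y] g) : wirtOp ε v c f y = wirtOp ε v c g y := by
  simp only [wirtOp, wirtSign_congr _ h]

theorem wirtOp_add [FiniteDimensional ℂ M] (ε : κ → ℂ) (v : κ → E) (c : κ → Module.End ℂ M)
    {f g : E → M} {y : E} (hf : WeakDiffAt f y) (hg : WeakDiffAt g y) :
    wirtOp ε v c (fun z => f z + g z) y = wirtOp ε v c f y + wirtOp ε v c g y := by
  simp only [wirtOp, wirtSign_add _ hf hg, map_add, Finset.sum_add_distrib]

theorem wirtOp_map [FiniteDimensional ℂ M] [FiniteDimensional ℂ M'] (ε : κ → ℂ) (v : κ → E)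
    {c : κ → Module.End ℂ M} {c' : κ → Module.End ℂ M'} {L L' : M →ₗ[ℂ] M'}
    (hL : ∀ k x, L' (c k x) = c' k (L x)) {f : E → M} {y : E} (hf : WeakDiffAt f y) :
    wirtOp ε v c' (fun z => L (f z)) y = L' (wirtOp ε v c f y) := by
  simp only [wirtOp, wirtSign_map _ hf, map_sum, hL]

theorem SmoothOn.wirtOp [FiniteDimensional ℂ M] (ε : κ → ℂ) (v : κ → E)
    (c : κ → Module.End ℂ M) {f : E → M} {s : Set E} (hf : SmoothOn f s) (hs : IsOpen s) :
    SmoothOn (wirtOp ε v c f) s :=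
  SmoothOn.sum _ fun k _ => (hf.wirtSign (ε k) hs (v k)).map (c k)

theorem sum_antisymm {f : κ → κ → M} (h : ∀ j k, f j k = -f k j) : ∑ j, ∑ k, f j k = 0 := by
  have h1 : ∑ j, ∑ k, f j k = -∑ j, ∑ k, f j k := by
    conv_lhs => rw [Finset.sum_comm]
    simp only [← Finset.sum_neg_distrib]
    exact Finset.sum_congr rfl fun j _ => Finset.sum_congr rfl fun k _ => h k j
  have h2 : (2 : ℂ) • ∑ j, ∑ k, f j k = 0 := by
    rw [two_smul]
    nth_rewrite 1 [h1]
    exact neg_add_cancel _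
  exact (smul_eq_zero.1 h2).resolve_left two_ne_zero

/-- The coefficients anticommute while the derivatives commute, so the double sum is antisymmetric
in its two indices. -/
theorem wirtOp_wirtOp [FiniteDimensional ℂ M] (ε : κ → ℂ) (v : κ → E)
    {c : κ → Module.End ℂ M} (hc : ∀ j k x, c j (c k x) = -c k (c j x)) {f : E → M} {s : Set E}
    (hf : SmoothOn f s) (hs : IsOpen s) {y : E} (hy : y ∈ s) :
    wirtOp ε v c (wirtOp ε v c f) y = 0 := by
  have h : ∀ j, c j (wirtSign (ε j) (wirtOp ε v c f) y (v j)) =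
      ∑ k, c j (c k (wirtSign (ε j) (fun z => wirtSign (ε k) f z (v k)) y (v j))) := by
    intro j
    have hk : ∀ k, WeakDiffAt (fun z => wirtSign (ε k) f z (v k)) y := fun k =>
      (hf.wirtSign (ε k) hs (v k)).weakDiffAt hs hy
    rw [← map_sum]
    congr 1
    refine (wirtSign_sum (ε j) Finset.univ (fun k _ => (hk k).map (c k)) (v j)).trans ?_
    exact Finset.sum_congr rfl fun k _ => wirtSign_map (ε j) (hk k) (c k) (v j)
  unfold wirtOp at h ⊢
  simp only [h]
  refine sum_antisymm fun j k => ?_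
  rw [hc, wirtSign_wirtSign_comm (ε k) (ε j) hf hs hy]

end Operators

/-! ### The operators `∂` and `\bar∂` in a coordinate domain, and pull-back by holomorphic maps. -/

section Local

open Topology

variable {E : Type*} [NormedAddCommGroup E] [NormedSpace ℂ E] [FiniteDimensional ℂ E]
variable {R : Type*} [Ring R] [Algebra ℂ R]

/-- Exterior multiplication by `a` on forms with coefficients in `R`. -/
abbrev wedgeR {V : Type*} [AddCommGroup V] [Module ℂ V] (R : Type*) [Ring R] [Algebra ℂ R]
    (a : FormAlg V) : Module.End ℂ (FormAlg V ⊗[ℂ] R) := (LinearMap.mulLeft ℂ a).rTensor R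

variable (E) in
/-- The form `dz_j`. -/
abbrev dz (j : Fin (Module.finrank ℂ E)) : FormAlg E := covForm (coordinate E j)

variable (E) in
/-- The form `d\bar z_j`. -/
abbrev dzBar (j : Fin (Module.finrank ℂ E)) : FormAlg E := conjForm (conjCovector (coordinate E j))

theorem delLoc_eq (f : E → FormAlg E ⊗[ℂ] R) :
    delLoc f = wirtOp (fun _ => -1) (Module.finBasis ℂ E) (fun j => wedgeR R (dz E j)) f := by
  funext y
  simp only [delLoc, wirtOp, wirt_eq]

theorem delbarLoc_eq (f : E → FormAlg E ⊗[ℂ] R) :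
    delbarLoc f = wirtOp (fun _ => 1) (Module.finBasis ℂ E) (fun j => wedgeR R (dzBar E j)) f := by
  funext y
  simp only [delbarLoc, wirtOp, wirtBar_eq]

theorem ι_anticomm {W : Type*} [AddCommGroup W] [Module ℂ W] (a b : W) :
    ExteriorAlgebra.ι ℂ a * ExteriorAlgebra.ι ℂ b =
      -(ExteriorAlgebra.ι ℂ b * ExteriorAlgebra.ι ℂ a) :=
  eq_neg_of_add_eq_zero_left (ExteriorAlgebra.ι_add_mul_swap _ _)

theorem wedgeR_wedgeR {a b : FormAlg E} (h : a * b = -(b * a)) (x : FormAlg E ⊗[ℂ] R) :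
    wedgeR R a (wedgeR R b x) = -wedgeR R b (wedgeR R a x) := by
  induction x with
  | zero => simp
  | add x y hx hy => simp only [map_add, hx, hy, neg_add]
  | tmul m t =>
    simp only [LinearMap.rTensor_tmul, LinearMap.mulLeft_apply, ← mul_assoc, h, neg_mul,
      TensorProduct.neg_tmul]

variable [FiniteDimensional ℂ R]

/-- `(\bar∂ + ∂)² = 0` in a coordinate domain. -/
theorem delLoc_sq {f : E → FormAlg E ⊗[ℂ] R} {s : Set E} (hf : SmoothOn f s) (hs : IsOpen s)
    {y : E} (hy : y ∈ s) :
    delbarLoc (fun z => delbarLoc f z + delLoc f z) y +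
      delLoc (fun z => delbarLoc f z + delLoc f z) y = 0 := by
  -- Indexing the `\bar z_j` and the `z_j` by one disjoint union makes `\bar∂ + ∂` a single operator
  -- with anticommuting coefficients, so the three bidegree components of its square need no
  -- separate treatment.
  let ε : Fin (Module.finrank ℂ E) ⊕ Fin (Module.finrank ℂ E) → ℂ :=
    Sum.elim (fun _ => 1) fun _ => -1
  let v : Fin (Module.finrank ℂ E) ⊕ Fin (Module.finrank ℂ E) → E :=
    Sum.elim (Module.finBasis ℂ E) (Module.finBasis ℂ E)
  let a : Fin (Module.finrank ℂ E) ⊕ Fin (Module.finrank ℂ E) → Module.Dual ℂ E × ConjDual E :=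
    Sum.elim (fun j => (0, conjCovector (coordinate E j))) fun j => (coordinate E j, 0)
  have key : ∀ g : E → FormAlg E ⊗[ℂ] R, (fun z => delbarLoc g z + delLoc g z) =
      wirtOp ε v (fun k => wedgeR R (ExteriorAlgebra.ι ℂ (a k))) g := by
    intro g
    funext z
    rw [delbarLoc_eq, delLoc_eq, wirtOp, wirtOp, wirtOp, Fintype.sum_sum_type]
    rfl
  rw [congrFun (key _) y, key]
  exact wirtOp_wirtOp ε v (fun j k x => wedgeR_wedgeR (ι_anticomm _ _) x) hf hs hy

/-! Pull-back by a holomorphic map. -/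

theorem weakDiffAt_of_hasFDerivAt {u : E → ℂ} {u' : E →L[ℝ] ℂ} {y : E} (h : HasFDerivAt u u' y) :
    WeakDiffAt u y ∧ ∀ v, dirDeriv u y v = u' v := by
  have hu : WeakDiffAt u y := fun l => by
    have : (fun z => l (u z)) = fun z => u z * l 1 := by
      funext z
      rw [← smul_eq_mul, ← map_smul, smul_eq_mul, mul_one]
    rw [this]
    exact h.differentiableAt.mul_const _
  refine ⟨hu, fun v => ?_⟩
  have := apply_dirDeriv hu v LinearMap.id
  simp only [LinearMap.id_apply] at this
  rw [this, h.fderiv]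

/-- For maps into a `Hom` space it is enough to test on a basis. This allows the pull-back operator
itself to be differentiated by the Leibniz rule. -/
theorem weakDiffAt_hom {M N : Type*} [AddCommGroup M] [Module ℂ M] [AddCommGroup N] [Module ℂ N]
    [FiniteDimensional ℂ M] {P : E → M →ₗ[ℂ] N} {y : E}
    (h : ∀ m, WeakDiffAt (fun z => P z m) y) : WeakDiffAt P y := fun l => by
  let b := Module.finBasis ℂ M
  have e : ∀ Q : M →ₗ[ℂ] N, Q = ∑ k, LinearMap.smulRightₗ (b.coord k) (Q (b k)) := by
    intro Q
    refine b.ext fun j => ?_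
    simp [LinearMap.sum_apply, Finsupp.single_apply, ite_smul]
  have e' : (fun z => l (P z)) =
      fun z => ∑ k, (l.comp (LinearMap.smulRightₗ (b.coord k))) (P z (b k)) := by
    funext z
    conv_lhs => rw [e (P z)]
    rw [map_sum]
    rfl
  rw [e']
  exact DifferentiableAt.fun_sum fun k _ => h (b k) _

/-- Here `D_{iv} = i D_v`, so `(D_v + ε i D_{iv}) / 2 = ((1 - ε) / 2) D_v`: the full derivative for
`∂` and zero for `\bar∂`. -/
theorem wirtSign_holomorphic {g : E → E} {y : E} (hg : ContDiffAt ℂ ω g y) (α : Module.Dual ℂ E)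
    (w : E) : WeakDiffAt (fun z => α (fderiv ℂ g z w)) y ∧ ∀ ε v,
      wirtSign ε (fun z => α (fderiv ℂ g z w)) y v =
        ((1 - ε) / 2) * α (fderiv ℂ (fderiv ℂ g) y v w) := by
  have hd : HasFDerivAt (fderiv ℂ g) (fderiv ℂ (fderiv ℂ g) y) y :=
    ((hg.fderiv_right (m := ω) le_top).differentiableAt (by simp)).hasFDerivAt
  have hu := (((LinearMap.toContinuousLinearMap α).hasFDerivAt.comp y
    (hd.clm_apply (hasFDerivAt_const w y))).restrictScalars ℝ)
  obtain ⟨h1, h2⟩ := weakDiffAt_of_hasFDerivAt hu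
  refine ⟨h1, fun ε v => ?_⟩
  have h2' : ∀ v, dirDeriv (fun z => α (fderiv ℂ g z w)) y v =
      α (fderiv ℂ (fderiv ℂ g) y v w) := fun v => (h2 v).trans (by simp)
  rw [wirtSign, h2', h2']
  have hI := Complex.I_mul_I
  simp only [map_smul, smul_apply, smul_eq_mul]
  linear_combination (ε / 2 * α (fderiv ℂ (fderiv ℂ g) y v w)) * hI

/-- Now `D_{iv} = -i D_v`, and the roles of `∂` and `\bar∂` are exchanged. The complex derivative is
taken of the conjugate functional `conjConj β`. -/
theorem wirtSign_antiholomorphic {g : E → E} {y : E} (hg : ContDiffAt ℂ ω g y) (β : ConjDual E)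
    (w : E) : WeakDiffAt (fun z => β (fderiv ℂ g z w)) y ∧ ∀ ε v,
      wirtSign ε (fun z => β (fderiv ℂ g z w)) y v =
        ((1 + ε) / 2) * β (fderiv ℂ (fderiv ℂ g) y v w) := by
  have hd : HasFDerivAt (fderiv ℂ g) (fderiv ℂ (fderiv ℂ g) y) y :=
    ((hg.fderiv_right (m := ω) le_top).differentiableAt (by simp)).hasFDerivAt
  have hu := (((LinearMap.toContinuousLinearMap (conjConj β)).hasFDerivAt.comp y
    (hd.clm_apply (hasFDerivAt_const w y))).restrictScalars ℝ)
  have hu' := (Complex.conjCLE : ℂ →L[ℝ] ℂ).hasFDerivAt.comp y hu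
  have hfun : ((Complex.conjCLE : ℂ →L[ℝ] ℂ) ∘ (LinearMap.toContinuousLinearMap (conjConj β)) ∘
      fun z => fderiv ℂ g z w) = fun z => β (fderiv ℂ g z w) := by
    funext z
    exact conj_conjConj β _
  obtain ⟨h1, h2⟩ := weakDiffAt_of_hasFDerivAt hu'
  rw [hfun] at h1 h2
  refine ⟨h1, fun ε v => ?_⟩
  have h2' : ∀ v, dirDeriv (fun z => β (fderiv ℂ g z w)) y v =
      β (fderiv ℂ (fderiv ℂ g) y v w) := fun v => (h2 v).trans (by
        rw [← conj_conjConj β]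
        simp)
  rw [wirtSign, h2', h2']
  have hI := Complex.I_mul_I
  simp only [map_smul, smul_apply, smul_eq_mul, LinearMap.map_smulₛₗ, Complex.conj_I]
  linear_combination (-ε / 2 * β (fderiv ℂ (fderiv ℂ g) y v w)) * hI

theorem covForm_comp_eq_sum (α : Module.Dual ℂ E) (A : E →ₗ[ℂ] E) :
    covForm (α.comp A) = ∑ k, α (A (Module.finBasis ℂ E k)) • dz E k := by
  conv_lhs => rw [dual_expand (Module.finBasis ℂ E) (α.comp A)]
  simp only [map_sum, map_smul]
  rfl

theorem conjForm_comp_eq_sum (β : ConjDual E) (A : E →ₗ[ℂ] E) :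
    conjForm (β.comp A) = ∑ k, β (A (Module.finBasis ℂ E k)) • dzBar E k := by
  conv_lhs => rw [conjDual_expand (Module.finBasis ℂ E) (β.comp A)]
  simp only [map_sum, map_smul]
  rfl

theorem sum_symm_smul_anticomm {n : ℕ} {S : Fin n → Fin n → ℂ} (hS : ∀ j k, S j k = S k j)
    {d : Fin n → FormAlg E} (hd : ∀ j k, d j * d k = -(d k * d j)) :
    ∑ j, ∑ k, S j k • (d j * d k) = 0 :=
  sum_antisymm fun j k => by rw [hS, hd, smul_neg]

theorem pullback_generator {g : E → E} {y : E} (hg : ContDiffAt ℂ ω g y)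
    (m : Module.Dual ℂ E × ConjDual E) :
    WeakDiffAt (fun z => formPull (fderiv ℂ g z).toLinearMap (ExteriorAlgebra.ι ℂ m)) y ∧
    ∀ ε v, wirtSign ε (fun z => formPull (fderiv ℂ g z).toLinearMap (ExteriorAlgebra.ι ℂ m)) y v =
      ∑ k, (((1 - ε) / 2) * m.1 (fderiv ℂ (fderiv ℂ g) y v (Module.finBasis ℂ E k))) • dz E k +
      ∑ k, (((1 + ε) / 2) * m.2 (fderiv ℂ (fderiv ℂ g) y v (Module.finBasis ℂ E k))) •
        dzBar E k := by
  let b := Module.finBasis ℂ E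
  have e : (fun z => formPull (fderiv ℂ g z).toLinearMap (ExteriorAlgebra.ι ℂ m)) = fun z =>
      (∑ k, LinearMap.toSpanSingleton ℂ (FormAlg E) (dz E k) (m.1 (fderiv ℂ g z (b k)))) +
      ∑ k, LinearMap.toSpanSingleton ℂ (FormAlg E) (dzBar E k) (m.2 (fderiv ℂ g z (b k))) := by
    funext z
    rw [formPull_ι, ι_eq_add, covForm_comp_eq_sum, conjForm_comp_eq_sum]
    rfl
  have h1 := fun k => wirtSign_holomorphic hg m.1 (b k)
  have h2 := fun k => wirtSign_antiholomorphic hg m.2 (b k)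
  have d1 := fun k => (h1 k).1.map (LinearMap.toSpanSingleton ℂ (FormAlg E) (dz E k))
  have d2 := fun k => (h2 k).1.map (LinearMap.toSpanSingleton ℂ (FormAlg E) (dzBar E k))
  have s1 := WeakDiffAt.sum Finset.univ fun k _ => d1 k
  have s2 := WeakDiffAt.sum Finset.univ fun k _ => d2 k
  rw [e]
  refine ⟨s1.add s2, fun ε v => ?_⟩
  rw [wirtSign_add ε s1 s2, wirtSign_sum ε _ fun k _ => d1 k, wirtSign_sum ε _ fun k _ => d2 k]
  refine congrArg₂ _ (Finset.sum_congr rfl fun k _ => ?_) (Finset.sum_congr rfl fun k _ => ?_)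
  · rw [wirtSign_map ε (h1 k).1, (h1 k).2]; rfl
  · rw [wirtSign_map ε (h2 k).1, (h2 k).2]; rfl

/-- The pull-back of a constant form is `∂`- and `\bar∂`-closed. -/
theorem pullback_closed {g : E → E} {y : E} (hg : ContDiffAt ℂ ω g y) (x : FormAlg E) :
    WeakDiffAt (fun z => formPull (fderiv ℂ g z).toLinearMap x) y ∧
    ∑ j, dz E j * wirtSign (-1) (fun z => formPull (fderiv ℂ g z).toLinearMap x) y
      (Module.finBasis ℂ E j) = 0 ∧
    ∑ j, dzBar E j * wirtSign 1 (fun z => formPull (fderiv ℂ g z).toLinearMap x) y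
      (Module.finBasis ℂ E j) = 0 := by
  have hsymm : IsSymmSndFDerivAt ℂ g y := hg.isSymmSndFDerivAt_of_omega
  induction x using exterior_left_induction with
  | algebraMap r =>
    simp only [formPull_algebraMap, wirtSign_const]
    exact ⟨WeakDiffAt.const _ _, by simp⟩
  | add x x' hx hx' =>
    simp only [map_add]
    refine ⟨hx.1.add hx'.1, ?_, ?_⟩
    · simp only [wirtSign_add _ hx.1 hx'.1, mul_add, Finset.sum_add_distrib, hx.2.1, hx'.2.1,
        add_zero]
    · simp only [wirtSign_add _ hx.1 hx'.1, mul_add, Finset.sum_add_distrib, hx.2.2, hx'.2.2,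
        add_zero]
  | ι_mul x m hx =>
    obtain ⟨hm, hw⟩ := pullback_generator hg m
    simp only [formPull_mul]
    have hb := fun ε v => wirtSign_bilin ε (LinearMap.mul ℂ (FormAlg E)) hm hx.1 v
    simp only [LinearMap.mul_apply'] at hb
    -- Closedness passes from the factors to the product by the Leibniz rule, the odd `d_j` picking
    -- up a sign when it crosses the first factor.
    have hprod : ∀ (ε : ℂ) (d : Fin (Module.finrank ℂ E) → FormAlg E),
        (∀ j a, d j * ExteriorAlgebra.ι ℂ a = -(ExteriorAlgebra.ι ℂ a * d j)) →
        ∑ j, d j * wirtSign ε (fun z => formPull (fderiv ℂ g z).toLinearMap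
          (ExteriorAlgebra.ι ℂ m)) y (Module.finBasis ℂ E j) = 0 →
        ∑ j, d j * wirtSign ε (fun z => formPull (fderiv ℂ g z).toLinearMap x) y
          (Module.finBasis ℂ E j) = 0 →
        ∑ j, d j * wirtSign ε (fun z => formPull (fderiv ℂ g z).toLinearMap
          (ExteriorAlgebra.ι ℂ m) * formPull (fderiv ℂ g z).toLinearMap x) y
          (Module.finBasis ℂ E j) = 0 := by
      intro ε d hd h1 h2
      simp only [hb, mul_add, Finset.sum_add_distrib, ← mul_assoc]
      rw [← Finset.sum_mul, h1, zero_mul, zero_add]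
      simp only [formPull_ι, hd, neg_mul, mul_assoc, Finset.sum_neg_distrib]
      rw [← Finset.mul_sum, h2, mul_zero, neg_zero]
    refine ⟨hm.bilin (LinearMap.mul ℂ (FormAlg E)) hx.1,
      hprod (-1) (dz E) (fun j a => ι_anticomm _ _) ?_ hx.2.1,
      hprod 1 (dzBar E) (fun j a => ι_anticomm _ _) ?_ hx.2.2⟩
    · simp only [hw, mul_add, Finset.mul_sum, mul_smul_comm]
      simp only [Finset.sum_add_distrib]
      -- The second derivative is symmetric in `j, k` and `dz_j ∧ dz_k` antisymmetric. The terms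
      -- with `d\bar z_k` carry the factor `(1 + -1) / 2 = 0`.
      have := sum_symm_smul_anticomm (d := dz E) (S := fun j k => (1 - -1) / 2 *
        m.1 (fderiv ℂ (fderiv ℂ g) y (Module.finBasis ℂ E j) (Module.finBasis ℂ E k)))
        (fun j k => by rw [hsymm]) fun j k => ι_anticomm _ _
      rw [this]
      simp
    · simp only [hw, mul_add, Finset.mul_sum, mul_smul_comm]
      simp only [Finset.sum_add_distrib]
      have := sum_symm_smul_anticomm (d := dzBar E) (S := fun j k => (1 + 1) / 2 *
        m.2 (fderiv ℂ (fderiv ℂ g) y (Module.finBasis ℂ E j) (Module.finBasis ℂ E k)))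
        (fun j k => by rw [hsymm]) fun j k => ι_anticomm _ _
      rw [this]
      simp

theorem weakDiffAt_formPull {g : E → E} {y : E} (hg : ContDiffAt ℂ ω g y) :
    WeakDiffAt (fun z => formPull (fderiv ℂ g z).toLinearMap) y :=
  weakDiffAt_hom fun x => (pullback_closed hg x).1

/-- By the Leibniz rule a derivative falls either on the pull-back operator, where `hclosed` makes
the sum vanish, or on `F`, where the chain rule applies. In the latter the matrix `a` that rotates
the directions is the one that expresses the pull-back of the `d j`, so it can be moved from one to
the other. -/
theorem wirtOp_pullback {g : E → E} {y : E} (hg : ContDiffAt ℂ ω g y)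
    {F : E → FormAlg E ⊗[ℂ] R} (hF : WeakDiffAt F (g y)) {ε : ℂ}
    {d : Fin (Module.finrank ℂ E) → FormAlg E}
    (hclosed : ∀ x, ∑ j, d j * wirtSign ε (fun z => formPull (fderiv ℂ g z).toLinearMap x) y
      (Module.finBasis ℂ E j) = 0)
    {a : Fin (Module.finrank ℂ E) → Fin (Module.finrank ℂ E) → ℂ}
    (hdir : ∀ k, wirtSign ε F (g y) (fderiv ℂ g y (Module.finBasis ℂ E k)) =
      ∑ j, a j k • wirtSign ε F (g y) (Module.finBasis ℂ E j))
    (hd : ∀ j, formPull (fderiv ℂ g y).toLinearMap (d j) = ∑ k, a j k • d k) :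
    wirtOp (fun _ => ε) (Module.finBasis ℂ E) (fun j => wedgeR R (d j))
      (fun z => (formPull (fderiv ℂ g z).toLinearMap).rTensor R (F (g z))) y =
    (formPull (fderiv ℂ g y).toLinearMap).rTensor R
      (wirtOp (fun _ => ε) (Module.finBasis ℂ E) (fun j => wedgeR R (d j)) F (g y)) := by
  have hg' : HasFDerivAt g (fderiv ℂ g y) y := (hg.differentiableAt (by simp)).hasFDerivAt
  have hP := weakDiffAt_formPull hg
  set P : E → FormAlg E →ₗ[ℂ] FormAlg E := fun z => formPull (fderiv ℂ g z).toLinearMap with hPdef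
  have hb := fun v => wirtSign_bilin ε (LinearMap.rTensorHom R) hP (hF.comp hg') v
  simp only [LinearMap.coe_rTensorHom, wirtSign_comp ε hg' hF] at hb
  have hmain : ∀ j x, (P y).rTensor R (wedgeR R (d j) x) =
      ∑ k, a j k • wedgeR R (d k) ((P y).rTensor R x) := by
    intro j x
    induction x with
    | zero => simp
    | add x x' hx hx' => simp only [map_add, hx, hx', smul_add, Finset.sum_add_distrib]
    | tmul m t =>
      simp only [LinearMap.rTensor_tmul, LinearMap.mulLeft_apply, hPdef, formPull_mul, hd,
        Finset.sum_mul, smul_mul_assoc, TensorProduct.sum_tmul, TensorProduct.smul_tmul']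
  have hzero : ∑ j, wedgeR R (d j) ((wirtSign ε P y (Module.finBasis ℂ E j)).rTensor R (F (g y)))
      = 0 := by
    induction F (g y) with
    | zero => simp
    | add x x' hx hx' => simp only [map_add, Finset.sum_add_distrib, hx, hx', add_zero]
    | tmul m t =>
      simp only [LinearMap.rTensor_tmul, LinearMap.mulLeft_apply, ← TensorProduct.sum_tmul]
      have : ∀ j, wirtSign ε P y (Module.finBasis ℂ E j) m =
          wirtSign ε (fun z => P z m) y (Module.finBasis ℂ E j) := fun j =>
        (wirtSign_map ε hP (LinearMap.applyₗ m) _).symm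
      simp only [this]
      rw [hclosed m, TensorProduct.zero_tmul]
  calc _ = ∑ j, wedgeR R (d j) ((wirtSign ε P y (Module.finBasis ℂ E j)).rTensor R (F (g y)) +
          (P y).rTensor R (wirtSign ε F (g y) (fderiv ℂ g y (Module.finBasis ℂ E j)))) :=
        Finset.sum_congr rfl fun j _ => congrArg _ (hb _)
    _ = ∑ k, ∑ j, a j k • wedgeR R (d k)
          ((P y).rTensor R (wirtSign ε F (g y) (Module.finBasis ℂ E j))) := by
        simp only [map_add, Finset.sum_add_distrib, hzero, zero_add, hdir, map_sum, map_smul]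
    _ = _ := by
        rw [Finset.sum_comm, wirtOp, map_sum]
        exact Finset.sum_congr rfl fun j _ => (hmain j _).symm

theorem delLoc_pullback {g : E → E} {y : E} (hg : ContDiffAt ℂ ω g y)
    {F : E → FormAlg E ⊗[ℂ] R} (hF : WeakDiffAt F (g y)) :
    delLoc (fun z => (formPull (fderiv ℂ g z).toLinearMap).rTensor R (F (g z))) y =
      (formPull (fderiv ℂ g y).toLinearMap).rTensor R (delLoc F (g y)) := by
  rw [delLoc_eq, delLoc_eq]
  refine wirtOp_pullback hg hF (fun x => (pullback_closed hg x).2.1)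
    (a := fun j k => coordinate E j (fderiv ℂ g y (Module.finBasis ℂ E k))) (fun k => ?_)
    fun j => ?_
  -- Complex linearity of `∂_v` in `v` yields the Jacobian entries as coefficients; for `\bar∂`
  -- conjugate-linearity yields their conjugates.
  · change wirtLin hF _ = ∑ j, _ • wirtLin hF _
    conv_lhs => rw [← (Module.finBasis ℂ E).sum_repr (fderiv ℂ g y (Module.finBasis ℂ E k))]
    rw [map_sum]
    simp only [map_smul]
    rfl
  · rw [formPull_covForm, covForm_comp_eq_sum]
    rfl

theorem delbarLoc_pullback {g : E → E} {y : E} (hg : ContDiffAt ℂ ω g y)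
    {F : E → FormAlg E ⊗[ℂ] R} (hF : WeakDiffAt F (g y)) :
    delbarLoc (fun z => (formPull (fderiv ℂ g z).toLinearMap).rTensor R (F (g z))) y =
      (formPull (fderiv ℂ g y).toLinearMap).rTensor R (delbarLoc F (g y)) := by
  rw [delbarLoc_eq, delbarLoc_eq]
  refine wirtOp_pullback hg hF (fun x => (pullback_closed hg x).2.2)
    (a := fun j k => conj (coordinate E j (fderiv ℂ g y (Module.finBasis ℂ E k)))) (fun k => ?_)
    fun j => ?_
  · change wirtBarLin hF _ = ∑ j, _ • wirtBarLin hF _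
    conv_lhs => rw [← (Module.finBasis ℂ E).sum_repr (fderiv ℂ g y (Module.finBasis ℂ E k))]
    rw [map_sum]
    simp only [LinearMap.map_smulₛₗ]
    rfl
  · rw [formPull_conjForm, conjForm_comp_eq_sum]
    rfl

end Local

/-! ### Commutators of `∂` and `\bar∂` with contractions -/

section LocalContraction

open Topology

variable {E : Type*} [NormedAddCommGroup E] [NormedSpace ℂ E] [FiniteDimensional ℂ E]
variable {R : Type*} [Ring R] [Algebra ℂ R] [FiniteDimensional ℂ R]
variable (𝒜 : ℤ → Submodule ℂ R) [GradedAlgebra 𝒜] [IsGradedArtin 𝒜]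
variable {γ : E → PolyAlg E ⊗[ℂ] R} {φ : E → FormAlg E ⊗[ℂ] R} {y : E}

/-- `[\bar∂, i_γ] = i_{\bar∂γ}`. -/
theorem delbarLoc_contractR (hγ : WeakDiffAt γ y) (hφ : WeakDiffAt φ y)
    (hpar : polyParity 𝒜 (γ y) = γ y) :
    delbarLoc (fun z => contractR 𝒜 (γ z) (φ z)) y =
      contractR 𝒜 (γ y) (delbarLoc φ y) + contractR 𝒜 (polyDelbarLoc γ y) (φ y) := by
  have hcomm : ∀ j x, wedgeR R (dzBar E j) (contractR 𝒜 (γ y) x) =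
      contractR 𝒜 (γ y) (wedgeR R (dzBar E j) x) := by
    intro j x
    rw [wedgeR, ← contraction_conjPoly, ← contractR_one_tmul 𝒜]
    exact (LinearMap.congr_fun (contractR_comm 𝒜 hpar _) x).symm
  have hmul : ∀ j g x, contractR 𝒜 ((LinearMap.mulLeft ℂ (conjPoly
      (conjCovector (coordinate E j)))).rTensor R g) x =
      wedgeR R (dzBar E j) (contractR 𝒜 g x) := by
    intro j g x
    rw [← polyMul_one_tmul 𝒜, contractR_polyMul, contractR_one_tmul, contraction_conjPoly]
    rfl
  simp only [delbarLoc_eq, wirtOp, polyDelbarLoc, wirtBar_eq,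
    wirtSign_bilin 1 (contractR 𝒜) hγ hφ, map_add, map_sum, LinearMap.sum_apply, hmul, hcomm,
    Finset.sum_add_distrib]
  exact add_comm _ _

/-- `[∂, i_γ]` as a first-order operator. -/
theorem delLoc_contractR (hγ : WeakDiffAt γ y) (hφ : WeakDiffAt φ y)
    (hpar : polyParity 𝒜 (γ y) = γ y) :
    delLoc (fun z => contractR 𝒜 (γ z) (φ z)) y = contractR 𝒜 (γ y) (delLoc φ y) +
      ∑ j, (wedgeR R (dz E j) (contractR 𝒜 (wirt γ y (Module.finBasis ℂ E j)) (φ y)) +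
        contractR 𝒜 ((thetaDeriv (coordinate E j)).rTensor R (γ y))
          (wirt φ y (Module.finBasis ℂ E j))) := by
  have hcomm : ∀ j x, wedgeR R (dz E j) (contractR 𝒜 (γ y) x) =
      contractR 𝒜 (γ y) (wedgeR R (dz E j) x) +
        contractR 𝒜 ((thetaDeriv (coordinate E j)).rTensor R (γ y)) x := by
    intro j x
    rw [← mulLeft_covForm_contractR, hpar, LinearMap.sub_apply, Module.End.mul_apply,
      Module.End.mul_apply]
    abel
  simp only [delLoc_eq, wirtOp, wirt_eq, wirtSign_bilin (-1) (contractR 𝒜) hγ hφ, map_add, map_sum,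
    hcomm, Finset.sum_add_distrib]
  abel

/-- `[[∂, i_γ], i_γ] = i_{[γ, γ]}`. -/
theorem delLoc_contractR_contractR (hγ : WeakDiffAt γ y) (hφ : WeakDiffAt φ y)
    (hpar : ∀ᶠ z in 𝓝 y, polyParity 𝒜 (γ z) = γ z) :
    delLoc (fun z => contractR 𝒜 (γ z) (contractR 𝒜 (γ z) (φ z))) y =
      (2 : ℂ) • contractR 𝒜 (γ y) (delLoc (fun z => contractR 𝒜 (γ z) (φ z)) y) -
      contractR 𝒜 (γ y) (contractR 𝒜 (γ y) (delLoc φ y)) +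
      contractR 𝒜 (schoutenLoc 𝒜 γ γ y) (φ y) := by
  have hpar' := hpar.self_of_nhds
  -- Evenness of `γ` on a neighbourhood can be differentiated. So `∂_j γ` is even as well, and
  -- contraction with it commutes with all contractions.
  have hparw : ∀ v, polyParity 𝒜 (wirt γ y v) = wirt γ y v := by
    intro v
    rw [wirt_eq, ← wirtSign_map (-1) hγ, wirtSign_congr (-1) hpar]
  have hAφ : WeakDiffAt (fun z => contractR 𝒜 (γ z) (φ z)) y := hγ.bilin (contractR 𝒜) hφ
  have hw : ∀ v, wirt (fun z => contractR 𝒜 (γ z) (φ z)) y v =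
      contractR 𝒜 (wirt γ y v) (φ y) + contractR 𝒜 (γ y) (wirt φ y v) := fun v => by
    simp only [wirt_eq, wirtSign_bilin (-1) (contractR 𝒜) hγ hφ]
  have hcomm : ∀ j x, contractR 𝒜 (γ y) (wedgeR R (dz E j) x) =
      wedgeR R (dz E j) (contractR 𝒜 (γ y) x) -
        contractR 𝒜 ((thetaDeriv (coordinate E j)).rTensor R (γ y)) x := by
    intro j x
    rw [← mulLeft_covForm_contractR, hpar', LinearMap.sub_apply, Module.End.mul_apply,
      Module.End.mul_apply]
    abel
  have hA : ∀ g x, contractR 𝒜 (γ y) (contractR 𝒜 g x) = contractR 𝒜 g (contractR 𝒜 (γ y) x) :=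
    fun g x => LinearMap.congr_fun (contractR_comm 𝒜 hpar' g) x
  -- For even `γ` the two summands of the bracket coincide after commuting the factors, hence the
  -- factor two.
  have hs : contractR 𝒜 (schoutenLoc 𝒜 γ γ y) (φ y) =
      ∑ j, (2 : ℂ) • contractR 𝒜 ((thetaDeriv (coordinate E j)).rTensor R (γ y))
        (contractR 𝒜 (wirt γ y (Module.finBasis ℂ E j)) (φ y)) := by
    simp only [schoutenLoc, hparw, polyMul_comm 𝒜 (hparw _), map_sum, map_add,
      LinearMap.sum_apply, LinearMap.add_apply, contractR_polyMul, Module.End.mul_apply, two_smul]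
  rw [hs, delLoc_contractR 𝒜 hγ hAφ hpar', delLoc_contractR 𝒜 hγ hφ hpar']
  simp only [hw, map_add, map_sum, hcomm, hA (wirt γ y _),
    hA ((thetaDeriv (coordinate E _)).rTensor R (γ y)), Finset.sum_add_distrib,
    Finset.sum_sub_distrib, ← Finset.smul_sum]
  module

end LocalContraction

/-! ### Charts -/

section Charts

open Topology

variable {E : Type*} [NormedAddCommGroup E] [NormedSpace ℂ E]
variable {X : Type*} [TopologicalSpace X] [ChartedSpace E X] [IsManifold 𝓘(ℂ, E) ω X]

theorem dChart_comp_dChartSymm_eq_fderiv {e e' : OpenPartialHomeomorph X E} (he : e ∈ atlas E X)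
    (he' : e' ∈ atlas E X) {y : E} (hy : y ∈ e.target) (hy' : e.symm y ∈ e'.source) :
    (dChart e' (e.symm y)).comp (dChartSymm e y) =
      (fderiv ℂ (fun z => e' (e.symm z)) y).toLinearMap := by
  have h1 : MDifferentiableAt 𝓘(ℂ, E) 𝓘(ℂ, E) e' (e.symm y) := mdifferentiableAt_atlas he' hy'
  have h2 : MDifferentiableAt 𝓘(ℂ, E) 𝓘(ℂ, E) e.symm y := mdifferentiableAt_atlas_symm he hy
  have h := mfderiv_comp y h1 h2
  rw [mfderiv_eq_fderiv] at h
  refine LinearMap.ext fun v => ?_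
  exact (congrArg (fun T : E →L[ℂ] E => T v) h).symm

theorem dChart_comp_dChartSymm {e : OpenPartialHomeomorph X E} (he : e ∈ atlas E X) {y : E}
    (hy : y ∈ e.target) : (dChart e (e.symm y)).comp (dChartSymm e y) = LinearMap.id := by
  rw [dChart_comp_dChartSymm_eq_fderiv he he hy (e.map_target hy)]
  have : (fun z => e (e.symm z)) =ᶠ[𝓝 y] id :=
    Filter.eventuallyEq_of_mem (e.open_target.mem_nhds hy) fun z hz => e.right_inv hz
  rw [this.fderiv_eq, fderiv_id]
  rfl

theorem contDiffAt_transition {e e' : OpenPartialHomeomorph X E} (he : e ∈ atlas E X)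
    (he' : e' ∈ atlas E X) {y : E} (hy : y ∈ e.target) (hy' : e.symm y ∈ e'.source) :
    ContDiffAt ℂ ω (fun z => e' (e.symm z)) y := by
  rw [← contMDiffAt_iff_contDiffAt]
  exact ContMDiffAt.comp y
    (contMDiffAt_of_mem_maximalAtlas (IsManifold.subset_maximalAtlas he') hy')
    (contMDiffAt_symm_of_mem_maximalAtlas (IsManifold.subset_maximalAtlas he) hy)

theorem dChartSymm_comp_dChart [FiniteDimensional ℂ E] {e : OpenPartialHomeomorph X E}
    (he : e ∈ atlas E X) {y : E} (hy : y ∈ e.target) :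
    (dChartSymm e y).comp (dChart e (e.symm y)) = LinearMap.id := by
  -- Tangent spaces unfold to `E`, so both differentials are endomorphisms of one finite-dimensional
  -- space and a one-sided inverse is two-sided.
  let A : E →ₗ[ℂ] E := dChart e (e.symm y)
  let B : E →ₗ[ℂ] E := dChartSymm e y
  have h : A * B = 1 := dChart_comp_dChartSymm he hy
  have h' : B * A = 1 := mul_eq_one_comm.1 h
  exact h'

end Charts

/-! ### Chart independence of `∂` and `\bar∂` on the manifold. -/

section FormsInCharts

open Topology

universe u

variable {E : Type u} [NormedAddCommGroup E] [NormedSpace ℂ E] [FiniteDimensional ℂ E]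
variable {X : Type*} [TopologicalSpace X] [ChartedSpace E X] [IsManifold 𝓘(ℂ, E) ω X]
variable {R R' : Type*} [Ring R] [Algebra ℂ R] [Ring R'] [Algebra ℂ R']

theorem rTensor_formPull_comp {V W U : Type*} [AddCommGroup V] [Module ℂ V] [AddCommGroup W]
    [Module ℂ W] [AddCommGroup U] [Module ℂ U] (A : V →ₗ[ℂ] W) (B : W →ₗ[ℂ] U)
    (x : FormAlg U ⊗[ℂ] R) :
    (formPull A).rTensor R ((formPull B).rTensor R x) = (formPull (B.comp A)).rTensor R x := by
  rw [← formPull_comp, LinearMap.rTensor_comp_apply]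

theorem FormSec.pull_inChart {e : OpenPartialHomeomorph X E} (he : e ∈ atlas E X)
    (φ : FormSec E X R) {y : E} (hy : y ∈ e.target) {x : X} (hx : e.symm y = x) :
    (formPull (dChart e x)).rTensor R (φ.inChart e y) = φ x := by
  subst hx
  rw [FormSec.inChart, rTensor_formPull_comp, dChartSymm_comp_dChart he hy, formPull_id,
    LinearMap.rTensor_id]
  rfl

theorem FormSec.ext_inChart {φ ψ : FormSec E X R}
    (h : ∀ e ∈ atlas E X, ∀ y ∈ e.target, φ.inChart e y = ψ.inChart e y) : φ = ψ := by
  funext x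
  have he := chart_mem_atlas E x
  have hy := (chartAt E x).map_source (mem_chart_source E x)
  have hx := (chartAt E x).left_inv (mem_chart_source E x)
  rw [← FormSec.pull_inChart he φ hy hx, ← FormSec.pull_inChart he ψ hy hx, h _ he _ hy]

theorem FormSec.inChart_transition {e e' : OpenPartialHomeomorph X E} (he : e ∈ atlas E X)
    (he' : e' ∈ atlas E X) (φ : FormSec E X R) {y : E} (hy : y ∈ e.target)
    (hy' : e.symm y ∈ e'.source) : φ.inChart e y =
      (formPull (fderiv ℂ (fun z => e' (e.symm z)) y).toLinearMap).rTensor R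
        (φ.inChart e' (e' (e.symm y))) := by
  rw [← dChart_comp_dChartSymm_eq_fderiv he he' hy hy', ← rTensor_formPull_comp,
    FormSec.pull_inChart he' φ (e'.map_source hy') (e'.left_inv hy')]
  rfl

theorem FormSec.IsSmooth.weakDiffAt {φ : FormSec E X R} (hφ : φ.IsSmooth)
    {e : OpenPartialHomeomorph X E} (he : e ∈ atlas E X) {y : E} (hy : y ∈ e.target) :
    WeakDiffAt (φ.inChart e) y := (hφ e he).weakDiffAt e.open_target hy

/-- The operator on forms which in the preferred charts is `∑ d_j ∧ ∂_j`, where `∂_j` is the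
Wirtinger derivative of sign `ε`. -/
def formOp (ε : ℂ) (d : Fin (Module.finrank ℂ E) → FormAlg E) (φ : FormSec E X R) :
    FormSec E X R := fun x =>
  (formPull (dChart (chartAt E x) x)).rTensor R
    (wirtOp (fun _ => ε) (Module.finBasis ℂ E) (fun j => wedgeR R (d j))
      (φ.inChart (chartAt E x)) (chartAt E x x))

theorem del_eq (φ : FormSec E X R) : del φ = formOp (-1) (dz E) φ := by
  funext x
  rw [del, delLoc_eq]
  rfl

theorem delbar_eq (φ : FormSec E X R) : delbar φ = formOp 1 (dzBar E) φ := by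
  funext x
  rw [delbar, delbarLoc_eq]
  rfl

/-- Linear maps of forms, defined for all vector spaces, that commute with pull-backs. -/
def FibreNatural (L : ∀ (V : Type u) [AddCommGroup V] [Module ℂ V],
    FormAlg V ⊗[ℂ] R →ₗ[ℂ] FormAlg V ⊗[ℂ] R') : Prop :=
  ∀ (V W : Type u) [AddCommGroup V] [Module ℂ V] [AddCommGroup W] [Module ℂ W] (A : V →ₗ[ℂ] W)
    (x : FormAlg W ⊗[ℂ] R), L V ((formPull A).rTensor R x) = (formPull A).rTensor R' (L W x)

/-- The action of a natural map of forms on sections. -/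
def FormSec.mapFibre (L : ∀ (V : Type u) [AddCommGroup V] [Module ℂ V],
    FormAlg V ⊗[ℂ] R →ₗ[ℂ] FormAlg V ⊗[ℂ] R') (φ : FormSec E X R) : FormSec E X R' :=
  fun x => L (TangentSpace 𝓘(ℂ, E) x) (φ x)

section Natural

variable {L L' : ∀ (V : Type u) [AddCommGroup V] [Module ℂ V],
    FormAlg V ⊗[ℂ] R →ₗ[ℂ] FormAlg V ⊗[ℂ] R'}

theorem FormSec.inChart_mapFibre (hL : FibreNatural L) (φ : FormSec E X R)
    (e : OpenPartialHomeomorph X E) :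
    (φ.mapFibre L).inChart e = fun y => L E (φ.inChart e y) := by
  funext y
  exact (hL _ _ _ _).symm

theorem FormSec.IsSmooth.mapFibre (hL : FibreNatural L) {φ : FormSec E X R} (hφ : φ.IsSmooth) :
    (φ.mapFibre L).IsSmooth := fun e he => by
  rw [FormSec.inChart_mapFibre hL]
  exact (hφ e he).map _

/-- Two maps `L` and `L'` are allowed because multiplication by `d j` may shift the weight or change
a sign. The lemma serves for scalars, weight projections, the parity involution and changes of
coefficients. -/
theorem formOp_mapFibre [FiniteDimensional ℂ R] [FiniteDimensional ℂ R'] {ε : ℂ}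
    {d : Fin (Module.finrank ℂ E) → FormAlg E} (hL : FibreNatural L) (hL' : FibreNatural L')
    (h : ∀ j x, L' E (wedgeR R (d j) x) = wedgeR R' (d j) (L E x)) {φ : FormSec E X R}
    (hφ : φ.IsSmooth) : formOp ε d (φ.mapFibre L) = (formOp ε d φ).mapFibre L' := by
  funext x
  have hd := hφ.weakDiffAt (chart_mem_atlas E x)
    ((chartAt E x).map_source (mem_chart_source E x))
  rw [formOp, FormSec.inChart_mapFibre hL, wirtOp_map (L' := L' E) _ _ h hd, ← hL']
  rfl

end Natural

theorem formOp_add [FiniteDimensional ℂ R] (ε : ℂ) (d : Fin (Module.finrank ℂ E) → FormAlg E)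
    {φ ψ : FormSec E X R} (hφ : φ.IsSmooth) (hψ : ψ.IsSmooth) :
    formOp ε d (φ + ψ) = formOp ε d φ + formOp ε d ψ := by
  funext x
  have he := chart_mem_atlas E x
  have hy := (chartAt E x).map_source (mem_chart_source E x)
  have h : (φ + ψ).inChart (chartAt E x) =
      fun y => φ.inChart (chartAt E x) y + ψ.inChart (chartAt E x) y := by
    funext y
    simp [FormSec.inChart]
  rw [formOp, h, wirtOp_add _ _ _ (hφ.weakDiffAt he hy) (hψ.weakDiffAt he hy), map_add]
  rfl

theorem fibreNatural_smul (c : ℂ) : FibreNatural fun (V : Type u) [AddCommGroup V] [Module ℂ V] =>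
    c • (LinearMap.id : FormAlg V ⊗[ℂ] R →ₗ[ℂ] FormAlg V ⊗[ℂ] R) :=
  fun V W _ _ _ _ A x => by simp

theorem formOp_smul [FiniteDimensional ℂ R] (ε : ℂ) (d : Fin (Module.finrank ℂ E) → FormAlg E)
    (c : ℂ) {φ : FormSec E X R} (hφ : φ.IsSmooth) : formOp ε d (c • φ) = c • formOp ε d φ :=
  formOp_mapFibre (fibreNatural_smul c) (fibreNatural_smul c) (fun j x => by simp) hφ

/-- The local operator commutes with pull-backs by holomorphic maps. -/
def PullbackInvariant (R : Type*) [Ring R] [Algebra ℂ R] (ε : ℂ)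
    (d : Fin (Module.finrank ℂ E) → FormAlg E) : Prop :=
  ∀ {g : E → E} {y : E}, ContDiffAt ℂ ω g y → ∀ {F : E → FormAlg E ⊗[ℂ] R},
    WeakDiffAt F (g y) →
    wirtOp (fun _ => ε) (Module.finBasis ℂ E) (fun j => wedgeR R (d j))
      (fun z => (formPull (fderiv ℂ g z).toLinearMap).rTensor R (F (g z))) y =
    (formPull (fderiv ℂ g y).toLinearMap).rTensor R
      (wirtOp (fun _ => ε) (Module.finBasis ℂ E) (fun j => wedgeR R (d j)) F (g y))

theorem pullbackInvariant_del [FiniteDimensional ℂ R] :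
    PullbackInvariant (E := E) R (-1) (dz E) := fun hg F hF => by
  simpa only [delLoc_eq] using delLoc_pullback hg hF

theorem pullbackInvariant_delbar [FiniteDimensional ℂ R] :
    PullbackInvariant (E := E) R 1 (dzBar E) := fun hg F hF => by
  simpa only [delbarLoc_eq] using delbarLoc_pullback hg hF

/-- Near `y` the expression of `φ` in `e` is the pull-back, along the holomorphic transition map, of
its expression in the preferred chart at `e.symm y`. Invariance of the operator under such
pull-backs then compares the two formulas. -/
theorem formOp_inChart {ε : ℂ} {d : Fin (Module.finrank ℂ E) → FormAlg E}
    (hinv : PullbackInvariant R ε d) {φ : FormSec E X R} (hφ : φ.IsSmooth)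
    {e : OpenPartialHomeomorph X E} (he : e ∈ atlas E X) {y : E} (hy : y ∈ e.target) :
    (formOp ε d φ).inChart e y =
      wirtOp (fun _ => ε) (Module.finBasis ℂ E) (fun j => wedgeR R (d j)) (φ.inChart e) y := by
  have he' := chart_mem_atlas E (e.symm y)
  have hy' := mem_chart_source E (e.symm y)
  have hev : φ.inChart e =ᶠ[𝓝 y] fun z =>
      (formPull (fderiv ℂ (fun z => chartAt E (e.symm y) (e.symm z)) z).toLinearMap).rTensor R
        (φ.inChart (chartAt E (e.symm y)) (chartAt E (e.symm y) (e.symm z))) := by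
    have hc : ∀ᶠ z in 𝓝 y, e.symm z ∈ (chartAt E (e.symm y)).source :=
      (e.continuousAt_symm hy).eventually ((chartAt E (e.symm y)).open_source.mem_nhds hy')
    filter_upwards [hc, e.open_target.mem_nhds hy] with z hz hz'
    exact φ.inChart_transition he he' hz' hz
  rw [wirtOp_congr _ _ _ hev, hinv (contDiffAt_transition he he' hy hy')
    (hφ.weakDiffAt he' ((chartAt E (e.symm y)).map_source hy')), FormSec.inChart, formOp,
    rTensor_formPull_comp, dChart_comp_dChartSymm_eq_fderiv he he' hy hy']

theorem del_inChart [FiniteDimensional ℂ R] {φ : FormSec E X R} (hφ : φ.IsSmooth)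
    {e : OpenPartialHomeomorph X E} (he : e ∈ atlas E X) {y : E} (hy : y ∈ e.target) :
    (del φ).inChart e y = delLoc (φ.inChart e) y := by
  rw [del_eq, formOp_inChart pullbackInvariant_del hφ he hy, delLoc_eq]

theorem delbar_inChart [FiniteDimensional ℂ R] {φ : FormSec E X R} (hφ : φ.IsSmooth)
    {e : OpenPartialHomeomorph X E} (he : e ∈ atlas E X) {y : E} (hy : y ∈ e.target) :
    (delbar φ).inChart e y = delbarLoc (φ.inChart e) y := by
  rw [delbar_eq, formOp_inChart pullbackInvariant_delbar hφ he hy, delbarLoc_eq]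

theorem FormSec.IsSmooth.formOp [FiniteDimensional ℂ R] {ε : ℂ}
    {d : Fin (Module.finrank ℂ E) → FormAlg E} (hinv : PullbackInvariant R ε d)
    {φ : FormSec E X R} (hφ : φ.IsSmooth) : (formOp ε d φ).IsSmooth := fun e he =>
  ((hφ e he).wirtOp _ _ _ e.open_target).congr fun _ hy => formOp_inChart hinv hφ he hy

theorem FormSec.IsSmooth.del [FiniteDimensional ℂ R] {φ : FormSec E X R} (hφ : φ.IsSmooth) :
    (del φ).IsSmooth := by
  rw [del_eq]
  exact hφ.formOp pullbackInvariant_del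

theorem FormSec.IsSmooth.delbar [FiniteDimensional ℂ R] {φ : FormSec E X R} (hφ : φ.IsSmooth) :
    (delbar φ).IsSmooth := by
  rw [delbar_eq]
  exact hφ.formOp pullbackInvariant_delbar

theorem FormSec.inChart_add (φ ψ : FormSec E X R) (e : OpenPartialHomeomorph X E) (y : E) :
    (φ + ψ).inChart e y = φ.inChart e y + ψ.inChart e y := by
  simp [FormSec.inChart]

theorem FormSec.inChart_sub (φ ψ : FormSec E X R) (e : OpenPartialHomeomorph X E) (y : E) :
    (φ - ψ).inChart e y = φ.inChart e y - ψ.inChart e y := by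
  simp [FormSec.inChart]

theorem FormSec.inChart_smul (c : ℂ) (φ : FormSec E X R) (e : OpenPartialHomeomorph X E) (y : E) :
    (c • φ).inChart e y = c • φ.inChart e y := by
  simp [FormSec.inChart]

variable (E X R) in
/-- The space `Ω^*(X, ℂ) ⊗ R`. -/
def smoothForms : Submodule ℂ (FormSec E X R) where
  carrier := {φ | φ.IsSmooth}
  zero_mem' e _ l := by
    have : (fun y => l (FormSec.inChart e (0 : FormSec E X R) y)) = fun _ => 0 := by
      funext y; simp [FormSec.inChart]
    rw [this]; exact contDiffOn_const
  add_mem' {φ ψ} hφ hψ e he := by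
    refine ((hφ e he).add (hψ e he)).congr fun y _ => φ.inChart_add ψ e y
  smul_mem' c φ hφ e he := ((hφ e he).smul c).congr fun y _ => φ.inChart_smul c e y

/-- `(\bar∂ + ∂)² = 0`. -/
theorem totalD_sq [FiniteDimensional ℂ R] {φ : FormSec E X R} (hφ : φ.IsSmooth) :
    delbar (delbar φ + del φ) + del (delbar φ + del φ) = 0 := by
  have hs : (delbar φ + del φ).IsSmooth := (smoothForms E X R).add_mem hφ.delbar hφ.del
  refine FormSec.ext_inChart fun e he y hy => ?_
  have hev : (delbar φ + del φ).inChart e =ᶠ[𝓝 y]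
      fun z => delbarLoc (φ.inChart e) z + delLoc (φ.inChart e) z :=
    Filter.eventuallyEq_of_mem (e.open_target.mem_nhds hy) fun z hz => by
      rw [FormSec.inChart_add, delbar_inChart hφ he hz, del_inChart hφ he hz]
  rw [FormSec.inChart_add, delbar_inChart hs he hy, del_inChart hs he hy, delbarLoc_eq, delLoc_eq,
    wirtOp_congr _ _ _ hev, wirtOp_congr _ _ _ hev, ← delbarLoc_eq, ← delLoc_eq,
    delLoc_sq (hφ e he) e.open_target hy]
  simp [FormSec.inChart]

theorem del_add [FiniteDimensional ℂ R] {φ ψ : FormSec E X R} (hφ : φ.IsSmooth)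
    (hψ : ψ.IsSmooth) : del (φ + ψ) = del φ + del ψ := by
  simp only [del_eq]
  exact formOp_add _ _ hφ hψ

theorem delbar_add [FiniteDimensional ℂ R] {φ ψ : FormSec E X R} (hφ : φ.IsSmooth)
    (hψ : ψ.IsSmooth) : delbar (φ + ψ) = delbar φ + delbar ψ := by
  simp only [delbar_eq]
  exact formOp_add _ _ hφ hψ

theorem del_smul [FiniteDimensional ℂ R] (c : ℂ) {φ : FormSec E X R} (hφ : φ.IsSmooth) :
    del (c • φ) = c • del φ := by
  simp only [del_eq]
  exact formOp_smul _ _ c hφ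

theorem delbar_smul [FiniteDimensional ℂ R] (c : ℂ) {φ : FormSec E X R} (hφ : φ.IsSmooth) :
    delbar (c • φ) = c • delbar φ := by
  simp only [delbar_eq]
  exact formOp_smul _ _ c hφ

end FormsInCharts

/-! ### Conjugation by the exponential of a nilpotent element -/

section ExpConj

variable {𝔈 : Type*} [Ring 𝔈] [Algebra ℂ 𝔈]

/-- The truncated exponential `∑_{k < N} a^k / k!`. -/
def truncExp (N : ℕ) (a : 𝔈) : 𝔈 := ∑ k ∈ Finset.range N, ((k.factorial : ℂ)⁻¹) • a ^ k

/-- The truncation may be lengthened at will, so sums of different lengths can be identified. -/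
theorem truncExp_eq {N N' : ℕ} {a : 𝔈} (h : a ^ N = 0) (hN : N ≤ N') :
    truncExp N' a = truncExp N a := by
  refine (Finset.sum_subset (Finset.range_subset_range.2 hN) fun k _ hk => ?_).symm
  rw [pow_eq_zero_of_le (by simpa using hk) h, smul_zero]

theorem truncExp_neg_mul_truncExp {N : ℕ} {a : 𝔈} (h : a ^ N = 0) :
    truncExp N (-a) * truncExp N a = 1 := by
  -- `IsNilpotent.exp` uses rational scalars, here restricted from the complex ones.
  let _ : Module ℚ 𝔈 := Module.compHom 𝔈 (algebraMap ℚ ℂ)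
  have hsm : ∀ (q : ℚ) (x : 𝔈), q • x = (q : ℂ) • x := fun q x => rfl
  have e : ∀ {b : 𝔈}, b ^ N = 0 → IsNilpotent.exp b = truncExp N b := by
    intro b hb
    rw [IsNilpotent.exp_eq_sum hb, truncExp]
    refine Finset.sum_congr rfl fun k _ => ?_
    rw [hsm]
    push_cast
    rfl
  have h' : (-a) ^ N = 0 := by rw [neg_pow, h, mul_zero]
  rw [← e h, ← e h']
  exact IsNilpotent.exp_neg_mul_exp_self ⟨N, h⟩

variable {A D Z B : 𝔈}

/-- With `[D, A] = Z + B` and `[[D, A], A] = -2 Z` commuting with `A`, this is `D A^n = A^n D + n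
A^{n-1} [D, A] + (n(n-1)/2) A^{n-2} [[D, A], A]` for `n = k + 2`. In the application `Z` is `[\bar∂,
i_γ] / ħ` and `B` is `[∂, i_γ]`, and `hB` is where the Maurer–Cartan equation enters. -/
theorem mul_pow_commutator (hD : D * A = A * D + (Z + B)) (hB : B * A = A * B - (2 : ℂ) • Z)
    (hZ : Z * A = A * Z) (k : ℕ) : D * A ^ (k + 2) = A ^ (k + 2) * D +
      (k + 2 : ℂ) • (A ^ (k + 1) * (Z + B)) - ((k + 2) * (k + 1) : ℂ) • (A ^ k * Z) := by
  have hZB : (Z + B) * A = A * (Z + B) - (2 : ℂ) • Z := by rw [add_mul, mul_add, hZ, hB]; abel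
  induction k with
  | zero =>
    have e : D * A ^ (0 + 2) = D * A * A := by rw [mul_assoc]; congr 1; exact sq A
    rw [e, hD, add_mul, mul_assoc, hD, hZB]
    simp only [pow_succ, pow_zero, one_mul, mul_add, mul_assoc, Nat.cast_zero, zero_add]
    module
  | succ k ih =>
    rw [show k + 1 + 2 = (k + 2) + 1 by ring, pow_succ, ← mul_assoc, ih, sub_mul, add_mul,
      smul_mul_assoc, smul_mul_assoc, mul_assoc _ D, hD, mul_assoc _ (Z + B), hZB, mul_assoc _ Z, hZ]
    simp only [pow_succ, mul_add, mul_sub, mul_assoc, mul_smul_comm, Nat.cast_succ]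
    module

/-- `D e^A = e^A (D + [D, A] + [[D, A], A] / 2)` when `[[D, A], A]` commutes with `A`. -/
theorem mul_truncExp (hD : D * A = A * D + (Z + B)) (hB : B * A = A * B - (2 : ℂ) • Z)
    (hZ : Z * A = A * Z) {N : ℕ} (hN : A ^ N = 0) :
    D * truncExp N A = truncExp N A * (D + B) := by
  let c : ℕ → 𝔈 := fun k => ((k.factorial : ℂ)⁻¹) • A ^ k
  have hc : ∀ k, D * c (k + 2) = c (k + 2) * D + c (k + 1) * (Z + B) - c k * Z := by
    intro k
    simp only [c, mul_smul_comm, smul_mul_assoc, mul_pow_commutator hD hB hZ k, smul_sub, smul_add,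
      smul_smul]
    have hk : (k.factorial : ℂ) ≠ 0 := Nat.cast_ne_zero.2 k.factorial_ne_zero
    have h1 : ((k : ℂ) + 1) ≠ 0 := Nat.cast_add_one_ne_zero k
    have h2 : ((k : ℂ) + 2) ≠ 0 := by exact_mod_cast (Nat.succ_ne_zero (k + 1))
    have f1 : ((k + 1).factorial : ℂ) = (k + 1) * k.factorial := by
      rw [Nat.factorial_succ]; push_cast; ring
    have f2 : ((k + 2).factorial : ℂ) = (k + 2) * ((k + 1) * k.factorial) := by
      rw [Nat.factorial_succ, Nat.factorial_succ]; push_cast; ring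
    have e1 : ((k + 2).factorial : ℂ)⁻¹ * (k + 2) = ((k + 1).factorial : ℂ)⁻¹ := by
      rw [f1, f2]; field_simp
    have e2 : ((k + 2).factorial : ℂ)⁻¹ * ((k + 2) * (k + 1)) = (k.factorial : ℂ)⁻¹ := by
      rw [f2]; field_simp
    rw [e1, e2]
  have hsum : ∀ n, D * ∑ k ∈ Finset.range (n + 2), c k = (∑ k ∈ Finset.range (n + 2), c k) * D +
      (∑ k ∈ Finset.range (n + 1), c k) * (Z + B) - (∑ k ∈ Finset.range n, c k) * Z := by
    intro n
    induction n with
    | zero =>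
      simp only [c, Finset.sum_range_succ, Finset.sum_range_zero, zero_add, Nat.factorial, pow_zero,
        Nat.cast_one, inv_one, one_smul, pow_one, mul_add, add_mul, mul_one, one_mul, zero_mul,
        sub_zero, hD]
      abel
    | succ n ih =>
      rw [show n + 1 + 2 = (n + 2) + 1 by ring, Finset.sum_range_succ, mul_add, ih, hc,
        Finset.sum_range_succ c (n + 1), Finset.sum_range_succ c n]
      simp only [add_mul]
      abel
  have h0 := hsum N
  -- From length `N` on the partial sums are constant, so the three sums in `hsum` agree and the two
  -- occurrences of `Z` cancel.
  have e2 : ∑ k ∈ Finset.range (N + 2), c k = truncExp N A := truncExp_eq hN (by omega)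
  have e1 : ∑ k ∈ Finset.range (N + 1), c k = truncExp N A := truncExp_eq hN (by omega)
  have e0 : ∑ k ∈ Finset.range N, c k = truncExp N A := rfl
  rw [e2, e1, e0] at h0
  rw [h0]
  simp only [mul_add]
  abel

end ExpConj

/-! ### Operators on smooth forms -/

section SmoothOperators

open Topology

universe u

variable {E : Type u} [NormedAddCommGroup E] [NormedSpace ℂ E] [FiniteDimensional ℂ E]
variable {X : Type*} [TopologicalSpace X] [ChartedSpace E X] [IsManifold 𝓘(ℂ, E) ω X]
variable {R : Type*} [Ring R] [Algebra ℂ R] [FiniteDimensional ℂ R]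
variable (𝒜 : ℤ → Submodule ℂ R) [GradedAlgebra 𝒜]

theorem contractSec_inChart (γ : PolySec E X R) (φ : FormSec E X R)
    {e : OpenPartialHomeomorph X E} (he : e ∈ atlas E X) {y : E} (hy : y ∈ e.target) :
    (contractSec 𝒜 γ φ).inChart e y = contractR 𝒜 (γ.inChart e y) (φ.inChart e y) :=
  (contractR_pull 𝒜 (dChartSymm_comp_dChart he hy) _ _).symm

theorem FormSec.IsSmooth.contractSec {γ : PolySec E X R} (hγ : γ.IsSmooth) {φ : FormSec E X R}
    (hφ : φ.IsSmooth) : (contractSec 𝒜 γ φ).IsSmooth := fun e he =>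
  (SmoothOn.bilin (contractR 𝒜) (hγ e he) (hφ e he)).congr fun _ hy =>
    contractSec_inChart 𝒜 γ φ he hy

theorem PolySec.polyParity_inChart {γ : PolySec E X R}
    (hγ : ∀ x, γ x ∈ degreeZeroPart 𝒜 (TangentSpace 𝓘(ℂ, E) x)) (e : OpenPartialHomeomorph X E)
    (y : E) : polyParity 𝒜 (γ.inChart e y) = γ.inChart e y := by
  rw [PolySec.inChart, polyParity_pull, polyParity_of_mem_degreeZeroPart 𝒜 (hγ _)]

/-! ### Commutators with `i_γ` for a Maurer–Cartan element. -/

section MaurerCartan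

variable [IsGradedArtin 𝒜] {γ : PolySec E X R} {φ : FormSec E X R}

theorem delbar_contractSec_inChart (hγ : IsMaurerCartan 𝒜 γ) (hφ : φ.IsSmooth)
    {e : OpenPartialHomeomorph X E} (he : e ∈ atlas E X) {y : E} (hy : y ∈ e.target) :
    (delbar (contractSec 𝒜 γ φ) - contractSec 𝒜 γ (delbar φ)).inChart e y =
      contractR 𝒜 (polyDelbarLoc (γ.inChart e) y) (φ.inChart e y) := by
  have hAφ := hφ.contractSec 𝒜 hγ.smooth
  have hev : (contractSec 𝒜 γ φ).inChart e =ᶠ[𝓝 y]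
      fun z => contractR 𝒜 (γ.inChart e z) (φ.inChart e z) :=
    Filter.eventuallyEq_of_mem (e.open_target.mem_nhds hy) fun z hz =>
      contractSec_inChart 𝒜 γ φ he hz
  rw [FormSec.inChart_sub, delbar_inChart hAφ he hy, contractSec_inChart 𝒜 γ _ he hy,
    delbar_inChart hφ he hy, delbarLoc_eq, wirtOp_congr _ _ _ hev, ← delbarLoc_eq,
    delbarLoc_contractR 𝒜 ((hγ.smooth e he).weakDiffAt e.open_target hy) (hφ.weakDiffAt he hy)
      (PolySec.polyParity_inChart 𝒜 hγ.degree e y)]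
  abel

/-- `[[\bar∂, i_γ], i_γ] = 0`. -/
theorem delbar_contractSec_comm (hγ : IsMaurerCartan 𝒜 γ) (hφ : φ.IsSmooth) :
    delbar (contractSec 𝒜 γ (contractSec 𝒜 γ φ)) -
      contractSec 𝒜 γ (delbar (contractSec 𝒜 γ φ)) =
    contractSec 𝒜 γ (delbar (contractSec 𝒜 γ φ) - contractSec 𝒜 γ (delbar φ)) := by
  refine FormSec.ext_inChart fun e he y hy => ?_
  rw [delbar_contractSec_inChart 𝒜 hγ (hφ.contractSec 𝒜 hγ.smooth) he hy,
    contractSec_inChart 𝒜 γ _ he hy, contractSec_inChart 𝒜 γ _ he hy,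
    delbar_contractSec_inChart 𝒜 hγ hφ he hy]
  exact (LinearMap.congr_fun
    (contractR_comm 𝒜 (PolySec.polyParity_inChart 𝒜 hγ.degree e y) _) _).symm

/-- `[[∂, i_γ], i_γ] = -2 [\bar∂, i_γ]`. -/
theorem del_contractSec_contractSec (hγ : IsMaurerCartan 𝒜 γ) (hφ : φ.IsSmooth) :
    del (contractSec 𝒜 γ (contractSec 𝒜 γ φ)) =
      (2 : ℂ) • contractSec 𝒜 γ (del (contractSec 𝒜 γ φ)) -
      contractSec 𝒜 γ (contractSec 𝒜 γ (del φ)) -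
      (2 : ℂ) • (delbar (contractSec 𝒜 γ φ) - contractSec 𝒜 γ (delbar φ)) := by
  have hAφ := hφ.contractSec 𝒜 hγ.smooth
  have hAAφ := hAφ.contractSec 𝒜 hγ.smooth
  refine FormSec.ext_inChart fun e he y hy => ?_
  have hmem := e.open_target.mem_nhds hy
  have hev : (contractSec 𝒜 γ φ).inChart e =ᶠ[𝓝 y]
      fun z => contractR 𝒜 (γ.inChart e z) (φ.inChart e z) :=
    Filter.eventuallyEq_of_mem hmem fun z hz => contractSec_inChart 𝒜 γ φ he hz
  have hev2 : (contractSec 𝒜 γ (contractSec 𝒜 γ φ)).inChart e =ᶠ[𝓝 y]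
      fun z => contractR 𝒜 (γ.inChart e z) (contractR 𝒜 (γ.inChart e z) (φ.inChart e z)) :=
    Filter.eventuallyEq_of_mem hmem fun z hz => by
      rw [contractSec_inChart 𝒜 γ _ he hz, contractSec_inChart 𝒜 γ φ he hz]
  have hmc := hγ.equation e he y hy
  -- The Maurer–Cartan equation replaces `i_{[γ, γ]}` by `-2 i_{\bar∂γ}`, which is `-2 [\bar∂, i_γ]`
  -- by `delbar_contractSec_inChart`.
  have hmc' : contractR 𝒜 (schoutenLoc 𝒜 (γ.inChart e) (γ.inChart e) y) (φ.inChart e y) =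
      -((2 : ℂ) • contractR 𝒜 (polyDelbarLoc (γ.inChart e) y) (φ.inChart e y)) := by
    have : schoutenLoc 𝒜 (γ.inChart e) (γ.inChart e) y =
        -((2 : ℂ) • polyDelbarLoc (γ.inChart e) y) := by
      rw [eq_neg_iff_add_eq_zero.2 hmc, smul_neg, smul_smul, neg_neg]
      norm_num
    rw [this]
    simp
  rw [FormSec.inChart_sub, FormSec.inChart_sub, FormSec.inChart_smul, FormSec.inChart_smul,
    delbar_contractSec_inChart 𝒜 hγ hφ he hy, del_inChart hAAφ he hy,
    contractSec_inChart 𝒜 γ _ he hy, contractSec_inChart 𝒜 γ _ he hy,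
    contractSec_inChart 𝒜 γ _ he hy, del_inChart hAφ he hy, del_inChart hφ he hy, delLoc_eq,
    wirtOp_congr _ _ _ hev2, ← delLoc_eq,
    delLoc_contractR_contractR 𝒜 ((hγ.smooth e he).weakDiffAt e.open_target hy)
      (hφ.weakDiffAt he hy) (Filter.Eventually.of_forall fun z =>
        PolySec.polyParity_inChart 𝒜 hγ.degree e z), hmc',
    delLoc_eq ((contractSec 𝒜 γ φ).inChart e), wirtOp_congr _ _ _ hev, ← delLoc_eq]
  abel

end MaurerCartan

variable (E X R) in
/-- `∂` on smooth forms. -/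
def delEnd : Module.End ℂ (smoothForms E X R) where
  toFun φ := ⟨del φ.1, FormSec.IsSmooth.del φ.2⟩
  map_add' φ ψ := Subtype.ext (del_add φ.2 ψ.2)
  map_smul' c φ := Subtype.ext (del_smul c φ.2)

variable (E X R) in
/-- `\bar∂` on smooth forms. -/
def delbarEnd : Module.End ℂ (smoothForms E X R) where
  toFun φ := ⟨delbar φ.1, FormSec.IsSmooth.delbar φ.2⟩
  map_add' φ ψ := Subtype.ext (delbar_add φ.2 ψ.2)
  map_smul' c φ := Subtype.ext (delbar_smul c φ.2)

/-- `i_γ` on smooth forms. -/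
def contractEnd {γ : PolySec E X R} (hγ : γ.IsSmooth) : Module.End ℂ (smoothForms E X R) where
  toFun φ := ⟨contractSec 𝒜 γ φ.1, FormSec.IsSmooth.contractSec 𝒜 hγ φ.2⟩
  map_add' _ _ := Subtype.ext (funext fun x => map_add (contractR 𝒜 (γ x)) _ _)
  map_smul' c _ := Subtype.ext (funext fun x => map_smul (contractR 𝒜 (γ x)) c _)

theorem contractEnd_pow_apply {γ : PolySec E X R} (hγ : γ.IsSmooth) (k : ℕ)
    (φ : smoothForms E X R) (x : X) :
    ((contractEnd 𝒜 hγ ^ k) φ).1 x = (contractR 𝒜 (γ x) ^ k) (φ.1 x) := by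
  induction k with
  | zero => simp only [pow_zero, Module.End.one_apply]
  | succ k ih =>
    rw [pow_succ', pow_succ']
    exact congrArg (contractR 𝒜 (γ x)) ih

end SmoothOperators

/-! ### Operators on series -/

section SeriesOperators

variable {S : Type*} [AddCommGroup S] [Module ℂ S]

/-- The operator `T ħ^{-n/2}` on series in powers of `ħ^{1/2}`. -/
def shiftEnd (n : ℤ) : Module.End ℂ S →ₗ[ℂ] Module.End ℂ (ℤ → S) where
  toFun T :=
    { toFun := fun ξ m => T (ξ (m + n))
      map_add' := fun _ _ => funext fun _ => map_add T _ _
      map_smul' := fun c _ => funext fun _ => map_smul T c _ }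
  map_add' _ _ := rfl
  map_smul' _ _ := rfl

theorem shiftEnd_apply (n : ℤ) (T : Module.End ℂ S) (ξ : ℤ → S) (m : ℤ) :
    shiftEnd n T ξ m = T (ξ (m + n)) := rfl

theorem shiftEnd_mul (n k : ℤ) (T U : Module.End ℂ S) :
    shiftEnd n T * shiftEnd k U = shiftEnd (n + k) (T * U) := by
  refine LinearMap.ext fun ξ => funext fun m => ?_
  simp only [Module.End.mul_apply, shiftEnd_apply, add_assoc]

theorem shiftEnd_pow (n : ℤ) (T : Module.End ℂ S) (k : ℕ) :
    shiftEnd n T ^ k = shiftEnd (n * k) (T ^ k) := by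
  induction k with
  | zero =>
    refine LinearMap.ext fun ξ => funext fun m => ?_
    simp [shiftEnd_apply]
  | succ k ih =>
    rw [pow_succ, ih, shiftEnd_mul, pow_succ, Nat.cast_succ, mul_add, mul_one]

/-- Conjugation of `\bar∂ + ħ∂` by `exp(A / ħ)`. -/
theorem hbar_conj {P Q A : Module.End ℂ S} {N : ℕ} (hN : A ^ N = 0)
    (hZ : (Q * A - A * Q) * A = A * (Q * A - A * Q))
    (hB : P * A * A = (2 : ℂ) • (A * P * A) - A * A * P - (2 : ℂ) • (Q * A - A * Q)) :
    (shiftEnd 0 Q + shiftEnd (-2) P) * truncExp N (shiftEnd 2 A) =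
      truncExp N (shiftEnd 2 A) *
        (shiftEnd 0 Q + shiftEnd (-2) P + shiftEnd 0 (P * A - A * P)) := by
  -- `shiftEnd 2` is multiplication by `ħ^{-1}`, so `Z` is the `ħ^{-1}` part of the first commutator
  -- and `B` its `ħ^0` part.
  refine mul_truncExp (Z := shiftEnd 2 (Q * A - A * Q)) ?_ ?_ ?_ ?_
  · simp only [add_mul, mul_add, shiftEnd_mul, map_sub]
    norm_num
    abel
  · simp only [shiftEnd_mul, zero_add, add_zero, ← map_smul, ← map_sub]
    congr 1
    simp only [sub_mul, mul_sub, hB, ← mul_assoc]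
    module
  · rw [shiftEnd_mul, shiftEnd_mul, hZ]
  · rw [shiftEnd_pow, hN, map_zero]

end SeriesOperators

/-! ### Natural maps on forms -/

section NaturalMaps

universe u

variable {R R' : Type*} [Ring R] [Algebra ℂ R] [Ring R'] [Algebra ℂ R']

theorem fibreNatural_lTensor (f : R →ₐ[ℂ] R') :
    FibreNatural fun (V : Type u) [AddCommGroup V] [Module ℂ V] =>
      f.toLinearMap.lTensor (FormAlg V) := fun V W _ _ _ _ A x => by
  rw [← LinearMap.comp_apply, ← LinearMap.comp_apply, LinearMap.lTensor_comp_rTensor,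
    LinearMap.rTensor_comp_lTensor]

theorem fibreNatural_rTensor {T : ∀ (V : Type u) [AddCommGroup V] [Module ℂ V],
    FormAlg V →ₗ[ℂ] FormAlg V} (hT : ∀ (V W : Type u) [AddCommGroup V] [Module ℂ V]
    [AddCommGroup W] [Module ℂ W] (A : V →ₗ[ℂ] W) (x : FormAlg W),
    T V (formPull A x) = formPull A (T W x)) :
    FibreNatural fun (V : Type u) [AddCommGroup V] [Module ℂ V] => (T V).rTensor R :=
  fun V W _ _ _ _ A x => by
    rw [← LinearMap.rTensor_comp_apply, ← LinearMap.rTensor_comp_apply]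
    exact congrArg (fun Q : FormAlg W →ₗ[ℂ] FormAlg V => Q.rTensor R x)
      (LinearMap.ext (hT V W A))

/-- The projection to weight `w` on forms with coefficients in `R`. -/
abbrev weightR (R : Type*) [Ring R] [Algebra ℂ R] (w : ℤ) (V : Type u) [AddCommGroup V]
    [Module ℂ V] : FormAlg V ⊗[ℂ] R →ₗ[ℂ] FormAlg V ⊗[ℂ] R := (weightPart w).rTensor R

theorem fibreNatural_weightR (w : ℤ) :
    FibreNatural fun (V : Type u) [AddCommGroup V] [Module ℂ V] => weightR R w V :=
  fibreNatural_rTensor fun _ _ _ _ _ _ A x => weightPart_formPull w A x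

/-- The parity involution of forms, up to a scalar, with coefficients in `R`. -/
abbrev involuteR (R : Type*) [Ring R] [Algebra ℂ R] (c : ℂ) (V : Type u) [AddCommGroup V]
    [Module ℂ V] : FormAlg V ⊗[ℂ] R →ₗ[ℂ] FormAlg V ⊗[ℂ] R :=
  (c • CliffordAlgebra.involute.toLinearMap).rTensor R

theorem fibreNatural_involuteR (c : ℂ) :
    FibreNatural fun (V : Type u) [AddCommGroup V] [Module ℂ V] => involuteR R c V :=
  fibreNatural_rTensor fun _ _ _ _ _ _ A x => by
    rw [LinearMap.smul_apply, LinearMap.smul_apply, map_smul]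
    exact congrArg _ (involute_formPull A x)

theorem rTensor_wedgeR {V : Type u} [AddCommGroup V] [Module ℂ V] {a : FormAlg V}
    {S T : FormAlg V →ₗ[ℂ] FormAlg V} (h : ∀ x, T (a * x) = a * S x) (x : FormAlg V ⊗[ℂ] R) :
    T.rTensor R (wedgeR R a x) = wedgeR R a (S.rTensor R x) := by
  rw [wedgeR, ← LinearMap.rTensor_comp_apply, ← LinearMap.rTensor_comp_apply]
  exact congrArg (fun Q : FormAlg V →ₗ[ℂ] FormAlg V => Q.rTensor R x) (LinearMap.ext h)

theorem involuteR_wedgeR {V : Type u} [AddCommGroup V] [Module ℂ V]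
    (a : Module.Dual ℂ V × ConjDual V) (x : FormAlg V ⊗[ℂ] R) :
    involuteR R 1 V (wedgeR R (ExteriorAlgebra.ι ℂ a) x) =
      wedgeR R (ExteriorAlgebra.ι ℂ a) (involuteR R (-1) V x) := by
  refine rTensor_wedgeR (fun y => ?_) x
  rw [LinearMap.smul_apply, LinearMap.smul_apply, one_smul, neg_one_smul, mul_neg, ← neg_mul,
    ← involute_ι']
  exact map_mul CliffordAlgebra.involute _ _

theorem lTensor_wedgeR {V : Type u} [AddCommGroup V] [Module ℂ V] (f : R →ₐ[ℂ] R')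
    (a : FormAlg V) (x : FormAlg V ⊗[ℂ] R) :
    f.toLinearMap.lTensor (FormAlg V) (wedgeR R a x) =
      wedgeR R' a (f.toLinearMap.lTensor (FormAlg V) x) := by
  rw [← LinearMap.comp_apply, ← LinearMap.comp_apply, LinearMap.lTensor_comp_rTensor,
    LinearMap.rTensor_comp_lTensor]

end NaturalMaps

/-! ### Series over an abstract space -/

section AbstractSeries

variable {S : Type*} [AddCommGroup S] [Module ℂ S]

/-- By the two vanishing hypotheses both sides are sums over all of `ℤ`, which are translation
invariant. -/
theorem sum_shift_eq {s : Finset ℤ} {F : ℤ → S} {c : ℤ}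
    (h1 : ∀ w, w ∉ s → F w = 0) (h2 : ∀ w, w ∉ s → F (w + c) = 0) :
    ∑ w ∈ s, F (w + c) = ∑ w ∈ s, F w := by
  rw [← finsum_eq_sum_of_support_subset (f := fun w => F (w + c)),
    ← finsum_eq_sum_of_support_subset (f := F)]
  · exact finsum_comp_equiv (Equiv.addRight c) (f := F)
  · exact fun w hw => by_contra fun h => hw (h1 w h)
  · exact fun w hw => by_contra fun h => hw (h2 w h)

/-- `Q` raises the weight by one, which absorbs the index shift of the prefactor `ħ^{1/2}`. `P`
lowers it by one, so the prefactor and the weight change together give a shift by two, that is, a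
factor `ħ`. -/
theorem rescale_intertwine {P Q : Module.End ℂ S} {W : ℤ → Module.End ℂ S} {s : Finset ℤ}
    (hQ : ∀ w, Q * W w = W (w + 1) * Q) (hP : ∀ w, P * W w = W (w - 1) * P)
    (hW : ∀ w, w ∉ s → W w = 0) (ξ : ℤ → S) (m : ℤ) :
    Q (∑ w ∈ s, W w (ξ (m - 1 - w))) + P (∑ w ∈ s, W w (ξ (m - 1 - w))) =
      ∑ w ∈ s, W w (Q (ξ (m - w)) + P (ξ (m - w - 2))) := by
  have h1 : ∀ w, Q (W w (ξ (m - 1 - w))) = W (w + 1) (Q (ξ (m - (w + 1)))) := by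
    intro w
    rw [show m - (w + 1) = m - 1 - w by ring]
    exact LinearMap.congr_fun (hQ w) _
  have h2 : ∀ w, P (W w (ξ (m - 1 - w))) = W (w + -1) (P (ξ (m - (w + -1) - 2))) := by
    intro w
    rw [show m - (w + -1) - 2 = m - 1 - w by ring]
    exact LinearMap.congr_fun (hP w) _
  simp only [map_sum, map_add, Finset.sum_add_distrib]
  congr 1
  · simp only [h1]
    refine sum_shift_eq (F := fun w => W w (Q (ξ (m - w))))
      (fun w hw => by rw [hW w hw, LinearMap.zero_apply]) fun w hw => ?_
    rw [← h1, hW w hw, LinearMap.zero_apply, map_zero]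
  · simp only [h2]
    refine sum_shift_eq (F := fun w => W w (P (ξ (m - w - 2))))
      (fun w hw => by rw [hW w hw, LinearMap.zero_apply]) fun w hw => ?_
    rw [← h2, hW w hw, LinearMap.zero_apply, map_zero]

/-- `exp(A / ħ)`, truncated at the power `N` of `A`, on series in powers of `ħ^{1/2}`. -/
def expSeries (N : ℕ) (A : Module.End ℂ S) (ξ : ℤ → S) (m : ℤ) : S :=
  ∑ k ∈ Finset.range N, ((k.factorial : ℂ)⁻¹) • (A ^ k) (ξ (m + 2 * k))

theorem expSeries_eq (N : ℕ) (A : Module.End ℂ S) (ξ : ℤ → S) :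
    expSeries N A ξ = truncExp N (shiftEnd 2 A) ξ := by
  funext m
  rw [truncExp, LinearMap.sum_apply, Finset.sum_apply]
  refine Finset.sum_congr rfl fun k _ => ?_
  rw [shiftEnd_pow]
  rfl

theorem expSeries_neg {N : ℕ} {A : Module.End ℂ S} (hN : A ^ N = 0) (ξ : ℤ → S) :
    expSeries N (-A) (expSeries N A ξ) = ξ := by
  have h : shiftEnd 2 A ^ N = 0 := by rw [shiftEnd_pow, hN, map_zero]
  rw [expSeries_eq, expSeries_eq, map_neg]
  exact LinearMap.congr_fun (truncExp_neg_mul_truncExp h) ξ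

theorem expSeries_conj {P Q A : Module.End ℂ S} {N : ℕ} (hN : A ^ N = 0)
    (hZ : (Q * A - A * Q) * A = A * (Q * A - A * Q))
    (hB : P * A * A = (2 : ℂ) • (A * P * A) - A * A * P - (2 : ℂ) • (Q * A - A * Q))
    (ξ : ℤ → S) (m : ℤ) : Q (expSeries N A ξ m) + P (expSeries N A ξ (m - 2)) =
      expSeries N A (fun m => Q (ξ m) + (P (A (ξ m)) - A (P (ξ m))) + P (ξ (m - 2))) m := by
  have h := congrFun (LinearMap.congr_fun (hbar_conj hN hZ hB) ξ) m
  have e : (shiftEnd 0 Q + shiftEnd (-2) P + shiftEnd 0 (P * A - A * P)) ξ =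
      fun m => Q (ξ m) + (P (A (ξ m)) - A (P (ξ m))) + P (ξ (m - 2)) := by
    funext m
    simp only [LinearMap.add_apply, Pi.add_apply, shiftEnd_apply, add_zero, LinearMap.sub_apply,
      Module.End.mul_apply, ← sub_eq_add_neg]
    abel
  rw [Module.End.mul_apply, Module.End.mul_apply, e, ← expSeries_eq, ← expSeries_eq] at h
  rw [← h]
  simp only [LinearMap.add_apply, Pi.add_apply, shiftEnd_apply, add_zero, ← sub_eq_add_neg]

end AbstractSeries

/-! ### Series of forms on the manifold. -/

section Series

open Topology

universe u

variable {E : Type u} [NormedAddCommGroup E] [NormedSpace ℂ E] [FiniteDimensional ℂ E]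
variable {X : Type*} [TopologicalSpace X] [ChartedSpace E X] [IsManifold 𝓘(ℂ, E) ω X]
variable {R : Type*} [Ring R] [Algebra ℂ R]

/-! ### The rescaling -/

section Rescale

variable [FiniteDimensional ℂ R]

variable (E X R) in
/-- The projection of smooth forms to weight `w`. -/
def weightEnd (w : ℤ) : Module.End ℂ (smoothForms E X R) where
  toFun φ := ⟨φ.1.mapFibre (weightR R w), FormSec.IsSmooth.mapFibre (fibreNatural_weightR w) φ.2⟩
  map_add' _ _ := Subtype.ext (funext fun _ => map_add _ _ _)
  map_smul' c _ := Subtype.ext (funext fun _ => map_smul _ c _)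

theorem delbarEnd_mul_weightEnd (w : ℤ) :
    delbarEnd E X R * weightEnd E X R w = weightEnd E X R (w + 1) * delbarEnd E X R := by
  refine LinearMap.ext fun φ => Subtype.ext ?_
  change delbar (φ.1.mapFibre (weightR R w)) = (delbar φ.1).mapFibre (weightR R (w + 1))
  rw [delbar_eq, delbar_eq]
  refine formOp_mapFibre (fibreNatural_weightR w) (fibreNatural_weightR (w + 1))
    (fun j x => rTensor_wedgeR (fun y => ?_) x) φ.2
  rw [weightPart_conjForm_mul, add_sub_cancel_right]

theorem delEnd_mul_weightEnd (w : ℤ) :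
    delEnd E X R * weightEnd E X R w = weightEnd E X R (w - 1) * delEnd E X R := by
  refine LinearMap.ext fun φ => Subtype.ext ?_
  change del (φ.1.mapFibre (weightR R w)) = (del φ.1).mapFibre (weightR R (w - 1))
  rw [del_eq, del_eq]
  refine formOp_mapFibre (fibreNatural_weightR w) (fibreNatural_weightR (w - 1))
    (fun j x => rTensor_wedgeR (fun y => ?_) x) φ.2
  rw [weightPart_covForm_mul, sub_add_cancel]

theorem weightEnd_eq_zero {w : ℤ}
    (hw : w ∉ Finset.Icc (-(Module.finrank ℂ E : ℤ)) (Module.finrank ℂ E)) :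
    weightEnd E X R w = 0 := by
  refine LinearMap.ext fun φ => Subtype.ext (funext fun x => ?_)
  have : weightPart (V := TangentSpace 𝓘(ℂ, E) x) w = 0 := weightPart_eq_zero (V := E) hw
  change (weightPart (V := TangentSpace 𝓘(ℂ, E) x) w).rTensor R (φ.1 x) = 0
  rw [this, LinearMap.rTensor_zero]
  rfl

variable (E X R) in
/-- The value of a smooth form at a point. -/
def evalAt (x : X) : smoothForms E X R →ₗ[ℂ] FormAlg (TangentSpace 𝓘(ℂ, E) x) ⊗[ℂ] R :=
  (LinearMap.proj x).comp (smoothForms E X R).subtype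

theorem evalAt_apply (φ : smoothForms E X R) (x : X) : evalAt E X R x φ = φ.1 x := rfl

theorem rescale_coe (ξ : ℤ → smoothForms E X R) (m : ℤ) :
    rescale E X R (fun k => (ξ k).1) m =
      (∑ w ∈ Finset.Icc (-(Module.finrank ℂ E : ℤ)) (Module.finrank ℂ E),
        weightEnd E X R w (ξ (m - w))).1 := by
  funext x
  rw [← evalAt_apply, map_sum]
  rfl

/-- `ħ^{1/2}(\bar∂ + ∂) l_ħ = l_ħ (\bar∂ + ħ∂)`. -/
theorem totalD_rescale {ξ : Series E X R} (hξ : ∀ m, (ξ m).IsSmooth) :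
    totalD (rescale E X R ξ) = rescale E X R (hbarD ξ) := by
  let ξ' : ℤ → smoothForms E X R := fun m => ⟨ξ m, hξ m⟩
  funext m
  have h1 : rescale E X R ξ (m - 1) = _ := rescale_coe ξ' (m - 1)
  have h2 : rescale E X R (hbarD ξ) m = _ :=
    rescale_coe (fun m => delbarEnd E X R (ξ' m) + delEnd E X R (ξ' (m - 2))) m
  have h3 := rescale_intertwine delbarEnd_mul_weightEnd delEnd_mul_weightEnd
    (fun w hw => weightEnd_eq_zero (E := E) (X := X) (R := R) hw) ξ' m
  rw [totalD, h1, h2]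
  exact congrArg Subtype.val h3

theorem rescale_smooth {ξ : Series E X R} (hξ : ∀ m, (ξ m).IsSmooth) (m : ℤ) :
    (rescale E X R ξ m).IsSmooth := by
  have h : rescale E X R ξ m = _ := rescale_coe (fun m => ⟨ξ m, hξ m⟩) m
  rw [h]
  exact Subtype.property _

end Rescale

/-! ### The exponential -/

section Exponential

variable (𝒜 : ℤ → Submodule ℂ R) [GradedAlgebra 𝒜]

/-- The definition truncates at the nilpotency class, which may vary with the point. Any uniform
bound gives the same value, as the extra terms vanish. -/
theorem expContract_eq {γ : PolySec E X R} {N : ℕ} {x : X} (hN : contractR 𝒜 (γ x) ^ N = 0)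
    (ξ : Series E X R) (m : ℤ) : expContract 𝒜 γ ξ m x =
      ∑ k ∈ Finset.range N, ((k.factorial : ℂ)⁻¹) • (contractR 𝒜 (γ x) ^ k) (ξ (m + 2 * k) x) := by
  have hle : nilpotencyClass (contractR 𝒜 (γ x)) ≤ N := Nat.sInf_le hN
  refine Finset.sum_subset (Finset.range_subset_range.2 hle) fun k _ hk => ?_
  rw [pow_eq_zero_of_le (not_lt.1 fun h => hk (Finset.mem_range.2 h))
    (pow_nilpotencyClass ⟨N, hN⟩), LinearMap.zero_apply, smul_zero]

theorem contractR_neg_pow {V : Type*} [AddCommGroup V] [Module ℂ V] {g : PolyAlg V ⊗[ℂ] R} {N : ℕ}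
    (h : contractR 𝒜 g ^ N = 0) : contractR 𝒜 (-g) ^ N = 0 := by
  rw [← neg_one_smul ℂ g, map_smul, smul_pow, h, smul_zero]

variable [FiniteDimensional ℂ R]

/-- With one bound for all points, the pointwise exponential is the exponential of a single
nilpotent endomorphism of the smooth forms; smoothness and the algebraic identities follow from
this. -/
theorem expContract_coe {γ : PolySec E X R} (hγ : γ.IsSmooth) {N : ℕ}
    (hN : ∀ x, contractR 𝒜 (γ x) ^ N = 0) (ξ : ℤ → smoothForms E X R) :
    expContract 𝒜 γ (fun m => (ξ m).1) =
      fun m => (expSeries N (contractEnd 𝒜 hγ) ξ m).1 := by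
  funext m x
  rw [expContract_eq 𝒜 (hN x), ← evalAt_apply, expSeries, map_sum]
  refine Finset.sum_congr rfl fun k _ => ?_
  rw [map_smul, evalAt_apply, contractEnd_pow_apply 𝒜 hγ]

theorem contractEnd_pow_eq_zero {γ : PolySec E X R} (hγ : γ.IsSmooth) {N : ℕ}
    (hN : ∀ x, contractR 𝒜 (γ x) ^ N = 0) : contractEnd 𝒜 hγ ^ N = 0 := by
  refine LinearMap.ext fun φ => Subtype.ext (funext fun x => ?_)
  exact (contractEnd_pow_apply 𝒜 hγ N φ x).trans (LinearMap.congr_fun (hN x) (φ.1 x))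

theorem expContract_smooth {γ : PolySec E X R} (hγ : γ.IsSmooth) {N : ℕ}
    (hN : ∀ x, contractR 𝒜 (γ x) ^ N = 0) {ξ : Series E X R} (hξ : ∀ m, (ξ m).IsSmooth) (m : ℤ) :
    (expContract 𝒜 γ ξ m).IsSmooth := by
  have h : expContract 𝒜 γ ξ = _ := expContract_coe 𝒜 hγ hN fun m => ⟨ξ m, hξ m⟩
  rw [h]
  exact Subtype.property _

theorem PolySec.IsSmooth.neg {γ : PolySec E X R} (hγ : γ.IsSmooth) :
    PolySec.IsSmooth (-γ) := fun e he =>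
  ((hγ e he).smul (-1)).congr fun y _ => by simp [PolySec.inChart]

theorem contractEnd_neg {γ : PolySec E X R} (hγ : γ.IsSmooth) :
    contractEnd 𝒜 hγ.neg = -contractEnd 𝒜 hγ := by
  refine LinearMap.ext fun φ => Subtype.ext (funext fun x => ?_)
  have h : contractR 𝒜 (-γ x) = -contractR 𝒜 (γ x) := map_neg _ _
  exact LinearMap.congr_fun h (φ.1 x)

theorem expContract_neg_expContract {γ : PolySec E X R} (hγ : γ.IsSmooth) {N : ℕ}
    (hN : ∀ x, contractR 𝒜 (γ x) ^ N = 0) {ξ : Series E X R} (hξ : ∀ m, (ξ m).IsSmooth) :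
    expContract 𝒜 (-γ) (expContract 𝒜 γ ξ) = ξ := by
  have hN' : ∀ x, contractR 𝒜 ((-γ) x) ^ N = 0 := fun x => contractR_neg_pow 𝒜 (hN x)
  have h := expSeries_neg (contractEnd_pow_eq_zero 𝒜 hγ hN)
    (fun m => (⟨ξ m, hξ m⟩ : smoothForms E X R))
  rw [← contractEnd_neg] at h
  have h1 : expContract 𝒜 γ ξ = _ := expContract_coe 𝒜 hγ hN fun m => ⟨ξ m, hξ m⟩
  rw [h1, expContract_coe 𝒜 hγ.neg hN', h]

variable [IsGradedArtin 𝒜]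

theorem twistedD_smooth {γ : PolySec E X R} (hγ : γ.IsSmooth) {ξ : Series E X R}
    (hξ : ∀ m, (ξ m).IsSmooth) (m : ℤ) : (twistedD 𝒜 γ ξ m).IsSmooth :=
  (smoothForms E X R).add_mem ((smoothForms E X R).add_mem (hξ m).delbar
    ((smoothForms E X R).sub_mem ((hξ m).contractSec 𝒜 hγ).del ((hξ m).del.contractSec 𝒜 hγ)))
    (hξ (m - 2)).del

/-- `(\bar∂ + ħ∂) exp(i_γ / ħ) = exp(i_γ / ħ) (\bar∂ + [∂, i_γ] + ħ∂)`. -/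
theorem hbarD_expContract {γ : PolySec E X R} (hγ : IsMaurerCartan 𝒜 γ) {N : ℕ}
    (hN : ∀ x, contractR 𝒜 (γ x) ^ N = 0) {ξ : Series E X R} (hξ : ∀ m, (ξ m).IsSmooth) :
    hbarD (expContract 𝒜 γ ξ) = expContract 𝒜 γ (twistedD 𝒜 γ ξ) := by
  have key := expSeries_conj (P := delEnd E X R) (Q := delbarEnd E X R)
    (contractEnd_pow_eq_zero 𝒜 hγ.smooth hN)
    (LinearMap.ext fun φ => Subtype.ext (delbar_contractSec_comm 𝒜 hγ φ.2))
    (LinearMap.ext fun φ => Subtype.ext (del_contractSec_contractSec 𝒜 hγ φ.2))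
    (fun m => (⟨ξ m, hξ m⟩ : smoothForms E X R))
  have h1 : expContract 𝒜 γ ξ = _ := expContract_coe 𝒜 hγ.smooth hN fun m => ⟨ξ m, hξ m⟩
  have h2 : expContract 𝒜 γ (twistedD 𝒜 γ ξ) = _ := expContract_coe 𝒜 hγ.smooth hN fun m =>
    ⟨twistedD 𝒜 γ ξ m, twistedD_smooth 𝒜 hγ.smooth hξ m⟩
  rw [h1, h2]
  funext m
  exact congrArg Subtype.val (key m)

end Exponential

end Series

/-! ### Change of coefficients and parity -/

section Coefficients

universe u

variable {E : Type u} [NormedAddCommGroup E] [NormedSpace ℂ E] [FiniteDimensional ℂ E]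
variable {X : Type*} [TopologicalSpace X] [ChartedSpace E X] [IsManifold 𝓘(ℂ, E) ω X]
variable {R R' : Type*} [Ring R] [Algebra ℂ R] [FiniteDimensional ℂ R] [Ring R'] [Algebra ℂ R']
  [FiniteDimensional ℂ R']

theorem formOp_lTensor (ε : ℂ) (d : Fin (Module.finrank ℂ E) → FormAlg E) (f : R →ₐ[ℂ] R')
    {φ : FormSec E X R} (hφ : φ.IsSmooth) {ψ : FormSec E X R'}
    (h : ∀ x, f.toLinearMap.lTensor _ (φ x) = ψ x) (x : X) :
    f.toLinearMap.lTensor _ (formOp ε d φ x) = formOp ε d ψ x := by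
  have hψ : ψ = φ.mapFibre fun V [AddCommGroup V] [Module ℂ V] =>
      f.toLinearMap.lTensor (FormAlg V) := funext fun x => (h x).symm
  rw [hψ, formOp_mapFibre (fibreNatural_lTensor f) (fibreNatural_lTensor f)
    (fun j x => lTensor_wedgeR f (d j) x) hφ]
  rfl

theorem del_lTensor (f : R →ₐ[ℂ] R') {φ : FormSec E X R} (hφ : φ.IsSmooth) {ψ : FormSec E X R'}
    (h : ∀ x, f.toLinearMap.lTensor _ (φ x) = ψ x) (x : X) :
    f.toLinearMap.lTensor _ (del φ x) = del ψ x := by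
  rw [del_eq, del_eq]
  exact formOp_lTensor _ _ f hφ h x

theorem delbar_lTensor (f : R →ₐ[ℂ] R') {φ : FormSec E X R} (hφ : φ.IsSmooth)
    {ψ : FormSec E X R'} (h : ∀ x, f.toLinearMap.lTensor _ (φ x) = ψ x) (x : X) :
    f.toLinearMap.lTensor _ (delbar φ x) = delbar ψ x := by
  rw [delbar_eq, delbar_eq]
  exact formOp_lTensor _ _ f hφ h x

theorem involuteR_one {V : Type*} [AddCommGroup V] [Module ℂ V] (x : FormAlg V ⊗[ℂ] R) :
    involuteR R 1 V x = CliffordAlgebra.involute.toLinearMap.rTensor R x := by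
  rw [involuteR, one_smul]

theorem involuteR_neg_one {V : Type*} [AddCommGroup V] [Module ℂ V] (x : FormAlg V ⊗[ℂ] R) :
    involuteR R (-1) V x = -CliffordAlgebra.involute.toLinearMap.rTensor R x := by
  rw [involuteR, LinearMap.rTensor_smul, LinearMap.smul_apply, neg_one_smul]

/-- An operator `∑ d_j ∧ ∂_j` with odd `d_j` changes the parity of forms. -/
theorem involute_formOp (ε : ℂ) (a : Fin (Module.finrank ℂ E) → Module.Dual ℂ E × ConjDual E)
    {φ : FormSec E X R} (hφ : φ.IsSmooth) {c : ℂ}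
    (h : ∀ x, CliffordAlgebra.involute.toLinearMap.rTensor R (φ x) = c • φ x) (x : X) :
    CliffordAlgebra.involute.toLinearMap.rTensor R
      (formOp ε (fun j => ExteriorAlgebra.ι ℂ (a j)) φ x) =
      -c • formOp ε (fun j => ExteriorAlgebra.ι ℂ (a j)) φ x := by
  -- The sign from crossing the odd `d_j` is put into the inner natural map, which acts on `φ` as
  -- the scalar `-c`.
  have hφ' : (-c) • φ = φ.mapFibre (involuteR R (-1)) := funext fun x =>
    ((involuteR_neg_one (φ x)).trans (by rw [h, ← neg_smul]; rfl)).symm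
  have h' := congrFun (formOp_mapFibre (ε := ε) (fibreNatural_involuteR (-1))
    (fibreNatural_involuteR 1) (fun j x => involuteR_wedgeR (a j) x) hφ) x
  rw [← hφ', formOp_smul _ _ _ hφ] at h'
  exact (involuteR_one _).symm.trans h'.symm

theorem involute_del {φ : FormSec E X R} (hφ : φ.IsSmooth) {c : ℂ}
    (h : ∀ x, CliffordAlgebra.involute.toLinearMap.rTensor R (φ x) = c • φ x) (x : X) :
    CliffordAlgebra.involute.toLinearMap.rTensor R (del φ x) = -c • del φ x := by
  rw [del_eq]
  exact involute_formOp _ (fun j => (coordinate E j, 0)) hφ h x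

theorem involute_delbar {φ : FormSec E X R} (hφ : φ.IsSmooth) {c : ℂ}
    (h : ∀ x, CliffordAlgebra.involute.toLinearMap.rTensor R (φ x) = c • φ x) (x : X) :
    CliffordAlgebra.involute.toLinearMap.rTensor R (delbar φ x) = -c • delbar φ x := by
  rw [delbar_eq]
  exact involute_formOp _ (fun j => (0, conjCovector (coordinate E j))) hφ h x

theorem involute_weightR {V : Type*} [AddCommGroup V] [Module ℂ V] (w : ℤ)
    (x : FormAlg V ⊗[ℂ] R) : CliffordAlgebra.involute.toLinearMap.rTensor R (weightR R w V x) =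
      ((w.negOnePow : ℤ) : ℂ) • weightR R w V x := by
  induction x with
  | zero => simp
  | add x y hx hy => simp only [map_add, hx, hy, smul_add]
  | tmul m t =>
    simp only [LinearMap.rTensor_tmul, AlgHom.toLinearMap_apply, involute_weightPart,
      TensorProduct.smul_tmul']

end Coefficients

/-! ### Compatible families -/

section Families

universe u

variable {E : Type u} [NormedAddCommGroup E] [NormedSpace ℂ E] [FiniteDimensional ℂ E]
variable {X : Type*} [TopologicalSpace X] [ChartedSpace E X] [IsManifold 𝓘(ℂ, E) ω X]
variable {ι : Type*} [Preorder ι] {R : ι → Type*} [∀ i, Ring (R i)] [∀ i, Algebra ℂ (R i)]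
  [∀ i, FiniteDimensional ℂ (R i)] {f : ∀ i j, i ≤ j → R j →ₐ[ℂ] R i}

theorem totalD_mem_smoothSeries {ξ : ProSeries E X R} (hξ : ξ ∈ smoothSeries E X f) :
    (fun i => totalD (ξ i)) ∈ smoothSeries E X f := by
  refine ⟨fun i m => (smoothForms E X (R i)).add_mem (hξ.1 i _).delbar (hξ.1 i _).del,
    fun i j h m x => ?_⟩
  simp only [totalD, Pi.add_apply, map_add]
  rw [delbar_lTensor _ (hξ.1 j _) (hξ.2 i j h _), del_lTensor _ (hξ.1 j _) (hξ.2 i j h _)]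

theorem isDifferentialOn_totalD :
    IsDifferentialOn (omegaHbar E X f) fun ξ i => totalD (ξ i) where
  map_mem ξ hξ := by
    refine ⟨totalD_mem_smoothSeries hξ.1, fun i m x => ?_⟩
    -- The factor `ħ^{1/2}` shifts the index by one, matching the change of parity caused by `∂` and
    -- `\bar∂`.
    have hm : (((m.negOnePow : ℤˣ) : ℤ) : ℂ) = -((((m - 1).negOnePow : ℤˣ) : ℤ) : ℂ) := by
      rw [Int.negOnePow_sub]; simp
    change _ = _ • (delbar _ x + del _ x)
    change CliffordAlgebra.involute.toLinearMap.rTensor (R i) (delbar _ x + del _ x) = _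
    rw [map_add, involute_delbar (hξ.1.1 i (m - 1)) (hξ.2 i (m - 1)),
      involute_del (hξ.1.1 i (m - 1)) (hξ.2 i (m - 1)), hm, smul_add]
  map_add ξ hξ η hη := by
    funext i m
    change delbar (ξ i (m - 1) + η i (m - 1)) + del (ξ i (m - 1) + η i (m - 1)) =
      (delbar (ξ i (m - 1)) + del (ξ i (m - 1))) + (delbar (η i (m - 1)) + del (η i (m - 1)))
    rw [del_add (hξ.1.1 i _) (hη.1.1 i _), delbar_add (hξ.1.1 i _) (hη.1.1 i _)]
    abel
  map_smul c ξ hξ := by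
    funext i m
    change delbar (c • ξ i (m - 1)) + del (c • ξ i (m - 1)) =
      c • (delbar (ξ i (m - 1)) + del (ξ i (m - 1)))
    rw [del_smul c (hξ.1.1 i _), delbar_smul c (hξ.1.1 i _), smul_add]
  sq_zero ξ hξ := by
    funext i m
    exact totalD_sq (hξ.1.1 i (m - 1 - 1))

theorem rescale_mem_smoothSeries {ξ : ProSeries E X R} (hξ : ξ ∈ smoothSeries E X f) :
    (fun i => rescale E X (R i) (ξ i)) ∈ smoothSeries E X f := by
  refine ⟨fun i m => rescale_smooth (hξ.1 i) m, fun i j h m x => ?_⟩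
  change (f i j h).toLinearMap.lTensor (FormAlg (TangentSpace 𝓘(ℂ, E) x))
      (∑ w ∈ Finset.Icc (-(Module.finrank ℂ E : ℤ)) (Module.finrank ℂ E),
        (weightPart w).rTensor (R j) (ξ j (m - w) x)) =
    ∑ w ∈ Finset.Icc (-(Module.finrank ℂ E : ℤ)) (Module.finrank ℂ E),
      (weightPart w).rTensor (R i) (ξ i (m - w) x)
  rw [map_sum]
  refine Finset.sum_congr rfl fun w _ => ?_
  rw [← hξ.2 i j h, ← LinearMap.comp_apply, ← LinearMap.comp_apply,
    LinearMap.lTensor_comp_rTensor, LinearMap.rTensor_comp_lTensor]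

variable (𝒜 : ∀ i, ℤ → Submodule ℂ (R i)) [∀ i, GradedAlgebra (𝒜 i)] [∀ i, IsGradedArtin (𝒜 i)]

theorem exists_contractSec_pow_eq_zero {R : Type*} [Ring R] [Algebra ℂ R]
    (𝒜 : ℤ → Submodule ℂ R) [GradedAlgebra 𝒜] [IsGradedArtin 𝒜] {γ : PolySec E X R}
    (hγ : ∀ x, γ x ∈ degreeZeroPart 𝒜 (TangentSpace 𝓘(ℂ, E) x)) :
    ∃ N : ℕ, ∀ x, contractR 𝒜 (γ x) ^ N = 0 := by
  obtain ⟨N, hN⟩ := exists_contractR_pow_eq_zero.{_, u} 𝒜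
  exact ⟨N, fun x => hN _ (hγ x)⟩

theorem contractR_pow_map {R R' : Type*} [Ring R] [Algebra ℂ R] [Ring R'] [Algebra ℂ R']
    (𝒜 : ℤ → Submodule ℂ R) [GradedAlgebra 𝒜] (ℬ : ℤ → Submodule ℂ R') [GradedAlgebra ℬ]
    (f : R →ₐ[ℂ] R') (hf : ∀ d : ℤ, ∀ r ∈ 𝒜 d, f r ∈ ℬ d) {V : Type*} [AddCommGroup V]
    [Module ℂ V] (g : PolyAlg V ⊗[ℂ] R) (k : ℕ) (x : FormAlg V ⊗[ℂ] R) :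
    f.toLinearMap.lTensor _ ((contractR 𝒜 g ^ k) x) =
      (contractR ℬ (f.toLinearMap.lTensor _ g) ^ k) (f.toLinearMap.lTensor _ x) := by
  induction k with
  | zero => simp
  | succ k ih =>
    rw [pow_succ', pow_succ', Module.End.mul_apply, Module.End.mul_apply, ← ih, contractR_map 𝒜 ℬ f hf]

variable {γ : ∀ i, PolySec E X (R i)}

theorem expContract_mem_smoothSeries
    (f_graded : ∀ i j (hij : i ≤ j) (d : ℤ), ∀ r ∈ 𝒜 j d, f i j hij r ∈ 𝒜 i d)
    (hγ : PolyCompatible f γ) (hmc : ∀ i, IsMaurerCartan (𝒜 i) (γ i)) {ξ : ProSeries E X R}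
    (hξ : ξ ∈ smoothSeries E X f) :
    (fun i => expContract (𝒜 i) (γ i) (ξ i)) ∈ smoothSeries E X f := by
  choose N hN using fun i => exists_contractSec_pow_eq_zero (𝒜 i) (hmc i).degree
  refine ⟨fun i m => expContract_smooth (𝒜 i) (hmc i).smooth (hN i) (hξ.1 i) m,
    fun i j h m x => ?_⟩
  -- The nilpotency bounds over `R i` and `R j` may differ; a common truncation lets the two
  -- exponentials be compared term by term.
  have hi : contractR (𝒜 i) (γ i x) ^ max (N i) (N j) = 0 :=
    pow_eq_zero_of_le (le_max_left _ _) (hN i x)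
  have hj : contractR (𝒜 j) (γ j x) ^ max (N i) (N j) = 0 :=
    pow_eq_zero_of_le (le_max_right _ _) (hN j x)
  change (f i j h).toLinearMap.lTensor _ (expContract (𝒜 j) (γ j) (ξ j) m x) =
    expContract (𝒜 i) (γ i) (ξ i) m x
  rw [expContract_eq (𝒜 i) hi, expContract_eq (𝒜 j) hj, map_sum]
  refine Finset.sum_congr rfl fun k _ => ?_
  rw [map_smul, contractR_pow_map (𝒜 j) (𝒜 i) (f i j h) (f_graded i j h), hγ i j h,
    hξ.2 i j h]

theorem twistedD_mem_smoothSeries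
    (f_graded : ∀ i j (hij : i ≤ j) (d : ℤ), ∀ r ∈ 𝒜 j d, f i j hij r ∈ 𝒜 i d)
    (hγ : PolyCompatible f γ) (hmc : ∀ i, IsMaurerCartan (𝒜 i) (γ i)) {ξ : ProSeries E X R}
    (hξ : ξ ∈ smoothSeries E X f) :
    (fun i => twistedD (𝒜 i) (γ i) (ξ i)) ∈ smoothSeries E X f := by
  refine ⟨fun i m => twistedD_smooth (𝒜 i) (hmc i).smooth (hξ.1 i) m, fun i j h m x => ?_⟩
  have hc : ∀ {φ : FormSec E X (R j)} {ψ : FormSec E X (R i)},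
      (∀ x, (f i j h).toLinearMap.lTensor _ (φ x) = ψ x) → ∀ x,
      (f i j h).toLinearMap.lTensor _ (contractSec (𝒜 j) (γ j) φ x) =
        contractSec (𝒜 i) (γ i) ψ x := by
    intro φ ψ hφ x
    rw [contractSec, contractSec, contractR_map (𝒜 j) (𝒜 i) (f i j h) (f_graded i j h), hγ i j h,
      hφ]
  have h1 := hξ.2 i j h m
  simp only [twistedD, Pi.add_apply, Pi.sub_apply, map_add, map_sub]
  rw [delbar_lTensor _ (hξ.1 j m) h1, del_lTensor _ (hξ.1 j (m - 2)) (hξ.2 i j h (m - 2)),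
    del_lTensor _ ((hξ.1 j m).contractSec (𝒜 j) (hmc j).smooth) (hc h1),
    hc (del_lTensor _ (hξ.1 j m) h1)]

/-- The conjugated operator contains only `ħ^0` and `ħ^1`, so neither negative nor half-integral
powers of `ħ` can arise. -/
theorem twistedD_mem_powerSeries
    (f_graded : ∀ i j (hij : i ≤ j) (d : ℤ), ∀ r ∈ 𝒜 j d, f i j hij r ∈ 𝒜 i d)
    (hγ : PolyCompatible f γ) (hmc : ∀ i, IsMaurerCartan (𝒜 i) (γ i)) {ξ : ProSeries E X R}
    (hξ : ξ ∈ powerSeries E X f) :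
    (fun i => twistedD (𝒜 i) (γ i) (ξ i)) ∈ powerSeries E X f := by
  refine ⟨twistedD_mem_smoothSeries 𝒜 f_graded hγ hmc hξ.1, fun i m hm => ?_⟩
  have h0 : ξ i m = 0 := hξ.2 i m hm
  have h2 : ξ i (m - 2) = 0 := hξ.2 i (m - 2) (hm.imp (fun h => by lia) fun h => h.sub_even even_two)
  have hdel : del (0 : FormSec E X (R i)) = 0 := congrArg Subtype.val (map_zero (delEnd E X (R i)))
  have hdelbar : delbar (0 : FormSec E X (R i)) = 0 :=
    congrArg Subtype.val (map_zero (delbarEnd E X (R i)))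
  have hcon : contractSec (𝒜 i) (γ i) (0 : FormSec E X (R i)) = 0 :=
    funext fun x => map_zero (contractR (𝒜 i) (γ i x))
  change twistedD (𝒜 i) (γ i) (ξ i) m = 0
  rw [twistedD, h0, h2, hdel, hdelbar, hcon, hdel]
  simp

/-- Before rescaling only integral powers of `ħ` occur. Hence the coefficient of `ħ^{m/2}` after
rescaling collects weights `w ≡ m` modulo two, and the weight `q - p` has the parity of the degree
`p + q`. -/
theorem Ltilde_le_omegaHbar
    (f_graded : ∀ i j (hij : i ≤ j) (d : ℤ), ∀ r ∈ 𝒜 j d, f i j hij r ∈ 𝒜 i d)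
    (hγ : PolyCompatible f γ) (hmc : ∀ i, IsMaurerCartan (𝒜 i) (γ i)) :
    Ltilde 𝒜 f γ ≤ omegaHbar E X f := by
  rintro _ ⟨φ, hφ, rfl⟩
  refine ⟨rescale_mem_smoothSeries (expContract_mem_smoothSeries 𝒜 f_graded hγ hmc hφ.1),
    fun i m x => ?_⟩
  -- The exponential moves indices by even amounts `2n`, so odd indices remain empty.
  have hodd : ∀ k : ℤ, Odd k → expContract (𝒜 i) (γ i) (φ i) k = 0 := by
    intro k hk
    funext x
    change ∑ n ∈ Finset.range (nilpotencyClass (contractR (𝒜 i) (γ i x))),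
      ((n.factorial : ℂ)⁻¹) • (contractR (𝒜 i) (γ i x) ^ n) (φ i (k + 2 * n) x) = 0
    refine Finset.sum_eq_zero fun n _ => ?_
    have : φ i (k + 2 * n) = 0 := hφ.2 i _ (Or.inr (hk.add_even (even_two_mul _)))
    rw [this]
    simp
  change CliffordAlgebra.involute.toLinearMap.rTensor (R i)
    (∑ w ∈ Finset.Icc (-(Module.finrank ℂ E : ℤ)) (Module.finrank ℂ E),
      weightR (R i) w (TangentSpace 𝓘(ℂ, E) x)
        (expContract (𝒜 i) (γ i) (φ i) (m - w) x)) =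
    (((m.negOnePow : ℤˣ) : ℤ) : ℂ) •
      ∑ w ∈ Finset.Icc (-(Module.finrank ℂ E : ℤ)) (Module.finrank ℂ E),
      weightR (R i) w (TangentSpace 𝓘(ℂ, E) x)
        (expContract (𝒜 i) (γ i) (φ i) (m - w) x)
  rw [map_sum, Finset.smul_sum]
  refine Finset.sum_congr rfl fun w _ => ?_
  rcases Int.even_or_odd (m - w) with h | h
  · rw [involute_weightR, ← (Int.negOnePow_eq_iff m w).2 h]
  · rw [hodd _ h]
    simp

theorem totalD_mem_Ltilde
    (f_graded : ∀ i j (hij : i ≤ j) (d : ℤ), ∀ r ∈ 𝒜 j d, f i j hij r ∈ 𝒜 i d)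
    (hγ : PolyCompatible f γ) (hmc : ∀ i, IsMaurerCartan (𝒜 i) (γ i)) {ξ : ProSeries E X R}
    (hξ : ξ ∈ Ltilde 𝒜 f γ) : (fun i => totalD (ξ i)) ∈ Ltilde 𝒜 f γ := by
  obtain ⟨φ, hφ, rfl⟩ := hξ
  -- The preimage of the differential is the conjugated operator applied to `φ`: `ħ^{1/2}(\bar∂ +
  -- ∂)` passes through `l_ħ` and then through the exponential.
  refine ⟨_, twistedD_mem_powerSeries 𝒜 f_graded hγ hmc hφ, funext fun i => ?_⟩
  obtain ⟨N, hN⟩ := exists_contractSec_pow_eq_zero (𝒜 i) (hmc i).degree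
  change rescale E X (R i) (expContract (𝒜 i) (γ i) (twistedD (𝒜 i) (γ i) (φ i))) =
    totalD (rescale E X (R i) (expContract (𝒜 i) (γ i) (φ i)))
  rw [totalD_rescale (expContract_smooth (𝒜 i) (hmc i).smooth hN (hφ.1.1 i)),
    hbarD_expContract (𝒜 i) (hmc i) hN (hφ.1.1 i)]

end Families

end SemiInfHodge

end

/-! ### The theorem. -/

theorem mainTheorem6
    {E : Type*} [NormedAddCommGroup E] [NormedSpace ℂ E] [FiniteDimensional ℂ E]
    {X : Type*} [TopologicalSpace X] [ChartedSpace E X] [IsManifold 𝓘(ℂ, E) ω X]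
    {ι : Type*} [Preorder ι] {R : ι → Type*} [∀ i, Ring (R i)] [∀ i, Algebra ℂ (R i)]
    (𝒜 : ∀ i, ℤ → Submodule ℂ (R i)) [∀ i, GradedAlgebra (𝒜 i)] [∀ i, IsGradedArtin (𝒜 i)]
    (f : ∀ i j, i ≤ j → R j →ₐ[ℂ] R i)
    (f_id : ∀ i r, f i i le_rfl r = r)
    (f_comp : ∀ i j k (hij : i ≤ j) (hjk : j ≤ k) r,
      f i j hij (f j k hjk r) = f i k (hij.trans hjk) r)
    (f_graded : ∀ i j (hij : i ≤ j) (d : ℤ), ∀ r ∈ 𝒜 j d, f i j hij r ∈ 𝒜 i d)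
    (γ : ∀ i, PolySec E X (R i))
    (γ_compatible : PolyCompatible f γ)
    (γ_mc : ∀ i, IsMaurerCartan (𝒜 i) (γ i)) :
    IsDifferentialOn (omegaHbar E X f) (fun ξ i => totalD (ξ i)) ∧
    Ltilde 𝒜 f γ ≤ omegaHbar E X f ∧
    (∀ ξ ∈ Ltilde 𝒜 f γ, (fun i => totalD (ξ i)) ∈ Ltilde 𝒜 f γ) ∧
    (∀ φ ∈ smoothSeries E X f, ∀ i,
      expContract (𝒜 i) (-γ i) (hbarD (expContract (𝒜 i) (γ i) (φ i))) =
        twistedD (𝒜 i) (γ i) (φ i)) := by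
  have hfin : ∀ i, FiniteDimensional ℂ (R i) := fun i => IsGradedArtin.finite (𝒜 i)
  refine ⟨isDifferentialOn_totalD, Ltilde_le_omegaHbar 𝒜 f_graded γ_compatible γ_mc,
    fun ξ hξ => totalD_mem_Ltilde 𝒜 f_graded γ_compatible γ_mc hξ, fun φ hφ i => ?_⟩
  obtain ⟨N, hN⟩ := exists_contractSec_pow_eq_zero (𝒜 i) (γ_mc i).degree
  -- Once the operator has been moved across `exp(i_γ / ħ)`, the outer `exp(-i_γ / ħ)` cancels the
  -- exponential.
  rw [hbarD_expContract (𝒜 i) (γ_mc i) hN (hφ.1 i)]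
  exact expContract_neg_expContract (𝒜 i) (γ_mc i).smooth hN
    (twistedD_smooth (𝒜 i) (γ_mc i).smooth (hφ.1 i))
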